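/- Let $h>0$ and consider on $\mathbb R$ the uniform fine grid $h\mathbb Z$ and the coarse grid $2h\mathbb Z$. For a mesh size $H$ let $V_H$ be the space of square-integrable functions on $\mathbb R$ of one of the following three kinds: - Courant elements: continuous and affine on each element $[jH,(j+1)H]$, $j\in\mathbb Z$; - $C^1$ quadratic splines: continuously differentiable and on each element a polynomial of degree at most $2$; - standard $P^2$ elements: continuous and on each element a polynomial of degree at most $2$. Let $|u|_{H^1}=\|u'\|_{L^2(\mathbb R)}$. Then for every $u\in V_h$ there is a unique $H^1$-orthogonal projection $\Pi u\in V_{2h}$, that is, a unique $\Pi u\in V_{2h}$ with $\int (u-\Pi u)'v'\,dx=0$ for all $v\in V_{2h}$. Let the two-grid approximation constant $C_A$ be the smallest constant such that $$\|u-\Pi u\|_{L^2(\mathbb R)}^2\le C_A\,h^2\,|u|_{H^1}^2\qquad\text{for all }u\in V_h .$$ *Symbols.* Use the hat functions, the quadratic B-splines, and the nodal basis (vertices and midpoints), respectively, as bases indexed by $\mathbb Z$; let $q=1,1,2$ be the number of degrees of freedom per element. Let $M,K$ be the mass and stiffness matrices for mesh size $h$, $K_c$ the stiffness matrix for mesh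 size $2h$, and $P$ the matrix of the canonical embedding of the coarse space into the fine one. Let $\widehat M(\theta),\widehat K(\theta)\in\mathbb C^{2q\times 2q}$, $\widehat K_c(\theta)\in\mathbb C^{q\times q}$, $\widehat P(\theta)\in\mathbb C^{2q\times q}$, $\widehat{P^T}(\theta)\in\mathbb C^{q\times 2q}$ be the matrices that represent these operators on the spans of the exponentials $(e^{\mathrm i j\omega})_{j\in\mathbb Z}$, where $\omega=\theta+a\pi/q$ $(0\le a<2q)$ on the fine grid and $\omega=2\theta+2\pi b/q$ $(0\le b<q)$ on the coarse grid. Put $$\widehat G(\theta)=\frac1{h^2}\,\widehat M\big(I-\widehat P\,\widehat K_c^{-1}\,\widehat{P^T}\,\widehat K\big)\widehat K^{-1}$$ for those $\theta$ for which $\widehat K(\theta)$ and $\widehat K_c(\theta)$ are invertible, which includes all $\theta$ with $\sin(q\theta)\ne0$. Then $C_A=\sup_{\theta}\rho(\widehat G(\theta))$, the supremum being over all such $\theta\in[0,2\pi)$ and $\rho$ denoting the spectral radius, and the common value is as follows. - Courant: $C_A=\tfrac13$; the eigenvalues of the $2\times2$ matrix $\widehat G(\theta)$ are $0,\tfrac13$.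 - $C^1$ quadratic splines: $C_A=\tfrac25$; the eigenvalues of the $2\times2$ matrix $\widehat G(\theta)$ are $0$ and $R(\cos\theta)$, where $$R(c)=\frac{-51+14(2c^2-1)+(8c^4-8c^2+1)}{40(-2+c)(2+c)(2+(2c^2-1))},\qquad \max_{-1\le c\le1}R(c)=\tfrac25 .$$ - Standard $P^2$: $C_A=\tfrac1{10}$; the eigenvalues of the $4\times4$ matrix $\widehat G(\theta)$ are $0,0,\tfrac1{30},\tfrac1{10}$. Eigenvalues are counted with algebraic multiplicity. If $h$ is replaced as unit of length (in the estimate and in $\widehat G$) by the distance $\hat h=h/q$ of neighbouring nodes, the resulting constant $\hat C_A$ is $\tfrac13$ for Courant elements and $\tfrac25$ for both quadratic discretizations. -/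

import Mathlib

open Polynomial
open scoped ENNReal

noncomputable section

namespace TwoGrid

/-- A finite element discretization of the real line on the uniform grids `{j h : j ∈ ℤ}`: piecewise
polynomials of degree at most `degree` that are globally `C ^ smoothness`, with `dof` degrees of
freedom per element and the basis `basis h i`, `i ∈ ℤ`, on the grid of mesh size `h`. -/
structure Discretization where
  degree : ℕ
  smoothness : ℕ
  dof : ℕ
  basis : ℝ → ℤ → ℝ → ℝ

/-- The hat function centred at the node `i h`. -/
def hat (h : ℝ) (i : ℤ) (x : ℝ) : ℝ := max 0 (1 - |x / h - i|)

/-- The quadratic B-spline with support `[(i - 1) h, (i + 2) h]`, written in `x / h - i`. -/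
def bspline (h : ℝ) (i : ℤ) (x : ℝ) : ℝ :=
  if -1 ≤ x / h - i ∧ x / h - i < 0 then (x / h - i + 1) ^ 2 / 2
  else if 0 ≤ x / h - i ∧ x / h - i < 1 then 3 / 4 - (2 * (x / h - i) - 1) ^ 2 / 4
  else if 1 ≤ x / h - i ∧ x / h - i < 2 then (x / h - i - 2) ^ 2 / 2
  else 0

/-- The nodal basis of the continuous piecewise quadratics; node number `i` is `i h / 2`, so that even
`i` are end points and odd `i` are midpoints of elements. With `t = (x - i h / 2) / h` the function
is `(1 - |t|) (1 - 2 |t|)` for `|t| ≤ 1` if `i` is even, and `1 - 4 t ^ 2` for `|t| ≤ 1 / 2` if `i`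
is odd. -/
def nodalP2 (h : ℝ) (i : ℤ) (x : ℝ) : ℝ :=
  if Even i then
    if |x / h - i / 2| ≤ 1 then (1 - |x / h - i / 2|) * (1 - 2 * |x / h - i / 2|) else 0
  else
    if |x / h - i / 2| ≤ 1 / 2 then 1 - 4 * (x / h - i / 2) ^ 2 else 0

/-- Courant elements. -/
def courant : Discretization := ⟨1, 0, 1, hat⟩

/-- Quadratic splines of class `C ^ 1`. -/
def splineP2 : Discretization := ⟨2, 1, 1, bspline⟩

/-- Continuous piecewise quadratics. -/
def standardP2 : Discretization := ⟨2, 0, 2, nodalP2⟩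

/-- The distance between two neighbouring nodes on the grid of mesh size `h`. -/
def Discretization.nodeDistance (D : Discretization) (h : ℝ) : ℝ := h / D.dof

/-! ### The two-grid estimate -/

/-- The finite element functions on the grid of mesh size `h` that are square integrable on the
line (such functions automatically have a square integrable weak derivative). -/
def Discretization.space (D : Discretization) (h : ℝ) : Set (ℝ → ℝ) :=
  {u | ContDiff ℝ D.smoothness u ∧
    (∀ j : ℤ, ∃ p : ℝ[X], p.natDegree ≤ D.degree ∧
      ∀ x ∈ Set.Icc (j * h) ((j + 1) * h), u x = p.eval x) ∧
    MeasureTheory.MemLp u 2 MeasureTheory.volume}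

/-- `p` is the orthogonal projection of `u` into the space on the grid of mesh size `H`, with respect
to the `H ^ 1` inner product `∫ u' v'`. -/
def IsH1Projection (D : Discretization) (H : ℝ) (u p : ℝ → ℝ) : Prop :=
  p ∈ D.space H ∧ ∀ v ∈ D.space H, ∫ x, (deriv u x - deriv p x) * deriv v x = 0

/-- For the fine mesh size `h` and the coarse mesh size `2 h`, the projection into the coarse space is
well defined on the fine space, and `C` is the smallest constant in
`‖(I - Π) u‖ ^ 2 ≤ C l ^ 2 |u|_{H^1} ^ 2` for `u` in the fine space, where `l` is the unit of length. -/
def IsTwoGridConstant (D : Discretization) (h l C : ℝ) : Prop :=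
  (∀ u ∈ D.space h, ∃! p, IsH1Projection D (2 * h) u p) ∧
  IsLeast {C : ℝ | ∀ u ∈ D.space h, ∀ p, IsH1Projection D (2 * h) u p →
    ∫ x, (u x - p x) ^ 2 ≤ C * l ^ 2 * ∫ x, deriv u x ^ 2} C

/-! ### Local Fourier analysis -/

/-- Mass matrix. -/
def Discretization.mass (D : Discretization) (h : ℝ) (i j : ℤ) : ℝ :=
  ∫ x, D.basis h j x * D.basis h i x

/-- Stiffness matrix. -/
def Discretization.stiffness (D : Discretization) (h : ℝ) (i j : ℤ) : ℝ :=
  ∫ x, deriv (D.basis h j) x * deriv (D.basis h i) x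

/-- `P` is the matrix of the canonical embedding of the space with mesh size `2 h` into the space with
mesh size `h`: column `j` holds the fine coefficients of the coarse basis function `j`. -/
def IsProlongation (D : Discretization) (h : ℝ) (P : ℤ → ℤ → ℝ) : Prop :=
  ∀ (j : ℤ) (x : ℝ), D.basis (2 * h) j x = ∑ᶠ i, P i j * D.basis h i x

/-- The vector of complex exponentials of frequency `θ`. -/
def mode (θ : ℝ) (j : ℤ) : ℂ := Complex.exp (j * θ * Complex.I)

/-- The (banded) matrix `A` maps the span of the modes with frequencies `ω` into the span of the modes
with frequencies `η`, and `S` represents it there. -/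
def IsSymbol {m n : ℕ} (A : ℤ → ℤ → ℝ) (ω : Fin m → ℝ) (η : Fin n → ℝ)
    (S : Matrix (Fin n) (Fin m) ℂ) : Prop :=
  ∀ (a : Fin m) (i : ℤ), ∑ᶠ j, (A i j : ℂ) * mode (ω a) j = ∑ b, S b a * mode (η b) i

/-- The fine grid frequencies that are coupled to `θ`: `θ, θ + π` for one degree of freedom per
element, `θ, θ + π / 2, θ + π, θ + 3 π / 2` for two. -/
def Discretization.fineFreq (D : Discretization) (θ : ℝ) (a : Fin (2 * D.dof)) : ℝ :=
  θ + a * Real.pi / D.dof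

/-- The coarse grid frequencies belonging to `θ`: `2 θ` for one degree of freedom per element,
`2 θ, 2 θ + π` for two. -/
def Discretization.coarseFreq (D : Discretization) (θ : ℝ) (b : Fin D.dof) : ℝ :=
  2 * θ + b * (2 * Real.pi) / D.dof

/-- `G` is the symbol at the frequency `θ` of
`l ^ (-2) M (I - P Kc ^ (-1) Pᵀ K) K ^ (-1)`, where `M`, `K` are the mass and stiffness matrix
for mesh size `h`, `Kc` is the stiffness matrix for mesh size `2 h`, `P` is the prolongation. -/
def IsTwoGridSymbol (D : Discretization) (h l θ : ℝ)
    (G : Matrix (Fin (2 * D.dof)) (Fin (2 * D.dof)) ℂ) : Prop :=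
  ∃ (P : ℤ → ℤ → ℝ)
    (symM symK : Matrix (Fin (2 * D.dof)) (Fin (2 * D.dof)) ℂ)
    (symKc : Matrix (Fin D.dof) (Fin D.dof) ℂ)
    (symP : Matrix (Fin (2 * D.dof)) (Fin D.dof) ℂ)
    (symPT : Matrix (Fin D.dof) (Fin (2 * D.dof)) ℂ),
    IsProlongation D h P ∧
    IsSymbol (D.mass h) (D.fineFreq θ) (D.fineFreq θ) symM ∧
    IsSymbol (D.stiffness h) (D.fineFreq θ) (D.fineFreq θ) symK ∧
    IsSymbol (D.stiffness (2 * h)) (D.coarseFreq θ) (D.coarseFreq θ) symKc ∧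
    IsSymbol P (D.coarseFreq θ) (D.fineFreq θ) symP ∧
    IsSymbol (fun j i => P i j) (D.fineFreq θ) (D.coarseFreq θ) symPT ∧
    IsUnit symK.det ∧ IsUnit symKc.det ∧
    G = ((1 / l ^ 2 : ℝ) : ℂ) • (symM * (1 - symP * symKc⁻¹ * symPT * symK) * symK⁻¹)

/-- `C` is the supremum over the frequencies in `[0, 2 π)` (at which the symbol is defined) of the
spectral radius of the two-grid symbol. -/
def IsFourierConstant (D : Discretization) (h l C : ℝ) : Prop :=
  IsLUB {r : ℝ≥0∞ | ∃ θ ∈ Set.Ico (0 : ℝ) (2 * Real.pi), ∃ G,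
    IsTwoGridSymbol D h l θ G ∧ r = spectralRadius ℂ G} (ENNReal.ofReal C)

/-- The nonzero eigenvalue in the spline case as a rational function of `c = cos θ`, with
`cos (2 θ) = 2 c ^ 2 - 1` and `cos (4 θ) = 8 c ^ 4 - 8 c ^ 2 + 1`. -/
def splineEigenvalue (c : ℝ) : ℝ :=
  (-51 + 14 * (2 * c ^ 2 - 1) + (8 * c ^ 4 - 8 * c ^ 2 + 1)) /
    (40 * (-2 + c) * (2 + c) * (2 + (2 * c ^ 2 - 1)))

end TwoGrid

end

/-!
The theorem has an analytic half (the sharp constant on the line) and an algebraic half (the Fourier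
symbols). Both rest on the same splitting: the fine space is the sum of the coarse space and an
explicit complement that is orthogonal to it in the energy inner product, and the two-grid constant
is the largest ratio of mass to energy on the complement.

*The constants on the line.* A finite element function is given by the coefficients of the
quadratics `a k + b k t + c k t ^ 2` in the local coordinate `t` of each element (`Pieces`), and
square integrability amounts to square summability of the coefficients (`exists_admissible`,
`Pieces.mem_space`). All integrals become sums of quadratic forms in the coefficients. By the
Pythagorean theorem, the estimate need only be checked for the projection errors `w = u - Π u`
(`isTwoGridConstant_of`), which are known explicitly.

* For Courant elements, `Π` is interpolation at the coarse nodes, and `∫ w ^ 2 = h ^ 2 / 3 ∫ w' ^ 2`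
  on each coarse element.
* For continuous piecewise quadratics, `Π u` has the nodal values and the mean values of `u` on the
  coarse elements. The estimate with `1 / 10` holds on each coarse element, since the deficit is a
  square.
* For quadratic splines, derivatives are continuous piecewise linear functions, and `w` is a sum of
  translates of the primitive of the linear prewavelet, with coefficients `d j`
  (`exists_wavelet_decomposition`; the `d j` solve a diagonally dominant tridiagonal system). The
  deficit `2 / 5 h ^ 2 ∫ w' ^ 2 - ∫ w ^ 2` is, up to a telescoping sum, a sum of squares in
  neighbouring coefficients that vanish when the signs alternate (`IsWaveletSum.hasSum_deficit`).
  Truncated alternating sequences show that `2 / 5` is sharp (`le_of_alternating`).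

*The symbols.* The sequences `x` with `x (j + 2 q) = ζ x j`, `ζ = exp (2 i q θ)`, are spanned by the
coupled modes, but have a simpler basis: the sequences that restrict to the unit vectors on a
period. In this basis the operators are represented by their Bloch matrices (`blochMatrix`), and a
Vandermonde matrix transforms the symbols into them (`isTwoGridSymbol_iff`). If the columns of `Z`
span the complement of the coarse space and the mass matrix is `N` times the stiffness matrix there,
then the two-grid matrix has the characteristic polynomial `X ^ q * N.charpoly`
(`charpoly_coarseGridCorrection`), where the factor `X ^ q` comes from the coarse space. It remains
to compute the entries of the matrices from the local coefficients of the basis functions, and to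
name `Z` and `N` in the three cases (`courant_hasSplitting`, `splineP2_hasSplitting`,
`standardP2_hasSplitting`).
-/

/-! ### Piecewise quadratics in local coordinates -/

namespace TwoGrid

open MeasureTheory Set

/-- `u` is the quadratic `a k + b k t + c k t ^ 2` in the local coordinate `t ∈ [0, 1]` of the
element `[h k, h (k + 1)]`, for every `k`. -/
def Pieces (h : ℝ) (a b c : ℤ → ℝ) (u : ℝ → ℝ) : Prop :=
  ∀ k : ℤ, ∀ t ∈ Icc (0 : ℝ) 1, u (h * (k + t)) = a k + b k * t + c k * t ^ 2

/-- The variant of `Pieces` for derivatives, which leaves the values at the nodes free. -/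
def OpenPieces (h : ℝ) (a b c : ℤ → ℝ) (u : ℝ → ℝ) : Prop :=
  ∀ k : ℤ, ∀ t ∈ Ioo (0 : ℝ) 1, u (h * (k + t)) = a k + b k * t + c k * t ^ 2

/-- The `L ^ 2` inner product on `[0, 1]` of two quadratics. -/
noncomputable def massForm (a b c a' b' c' : ℝ) : ℝ :=
  a * a' + (a * b' + b * a') / 2 + (a * c' + b * b' + c * a') / 3 + (b * c' + c * b') / 4 +
    c * c' / 5

/-- Square summable sequences. -/
def SqSummable (a : ℤ → ℝ) : Prop := Summable fun k => a k ^ 2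

lemma SqSummable.mul {a b : ℤ → ℝ} (ha : SqSummable a) (hb : SqSummable b) :
    Summable fun k => a k * b k := by
  refine Summable.of_norm_bounded (Summable.add ha hb) fun k => ?_
  rw [Real.norm_eq_abs, abs_le]
  constructor <;> nlinarith [sq_nonneg (a k + b k), sq_nonneg (a k - b k), sq_nonneg (a k),
    sq_nonneg (b k)]

lemma SqSummable.add {a b : ℤ → ℝ} (ha : SqSummable a) (hb : SqSummable b) :
    SqSummable fun k => a k + b k := by
  have := (Summable.add ha hb).add ((ha.mul hb).mul_left 2)
  refine this.congr fun k => ?_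
  ring

lemma SqSummable.const_mul {a : ℤ → ℝ} (ha : SqSummable a) (r : ℝ) :
    SqSummable fun k => r * a k := by
  refine (Summable.mul_left (r ^ 2) ha).congr fun k => ?_
  ring

lemma SqSummable.div_const {a : ℤ → ℝ} (ha : SqSummable a) (r : ℝ) :
    SqSummable fun k => a k / r := by
  simpa only [div_eq_inv_mul] using ha.const_mul r⁻¹

lemma SqSummable.sub {a b : ℤ → ℝ} (ha : SqSummable a) (hb : SqSummable b) :
    SqSummable fun k => a k - b k := by
  refine (ha.add (hb.const_mul (-1))).congr fun k => ?_
  ring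

lemma SqSummable.comp {a : ℤ → ℝ} (ha : SqSummable a) {f : ℤ → ℤ} (hf : Function.Injective f) :
    SqSummable fun k => a (f k) :=
  Summable.comp_injective ha hf

lemma sqSummable_zero : SqSummable fun _ => 0 := by
  simp [SqSummable, summable_zero]

lemma SqSummable.massForm {a b c a' b' c' : ℤ → ℝ} (ha : SqSummable a) (hb : SqSummable b)
    (hc : SqSummable c) (ha' : SqSummable a') (hb' : SqSummable b') (hc' : SqSummable c') :
    Summable fun k => massForm (a k) (b k) (c k) (a' k) (b' k) (c' k) := by
  unfold TwoGrid.massForm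
  exact (((((ha.mul ha').add (((ha.mul hb').add (hb.mul ha')).div_const 2)).add
    ((((ha.mul hc').add (hb.mul hb')).add (hc.mul ha')).div_const 3)).add
    (((hb.mul hc').add (hc.mul hb')).div_const 4)).add ((hc.mul hc').div_const 5))

lemma integral_quadratic_mul (a b c a' b' c' : ℝ) :
    ∫ t in (0 : ℝ)..1, (a + b * t + c * t ^ 2) * (a' + b' * t + c' * t ^ 2) =
      massForm a b c a' b' c' := by
  have key : ∀ t : ℝ, HasDerivAt (fun t : ℝ => a * a' * t + (a * b' + b * a') / 2 * t ^ 2 +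
      (a * c' + b * b' + c * a') / 3 * t ^ 3 + (b * c' + c * b') / 4 * t ^ 4 + c * c' / 5 * t ^ 5)
      ((a + b * t + c * t ^ 2) * (a' + b' * t + c' * t ^ 2)) t := by
    intro t
    have h1 := (hasDerivAt_id t).const_mul (a * a')
    have hp := fun n : ℕ => hasDerivAt_pow n t
    have := (((h1.add ((hp 2).const_mul ((a * b' + b * a') / 2))).add
      ((hp 3).const_mul ((a * c' + b * b' + c * a') / 3))).add
      ((hp 4).const_mul ((b * c' + c * b') / 4))).add ((hp 5).const_mul (c * c' / 5))
    refine this.congr_deriv ?_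
    push_cast
    ring
  rw [intervalIntegral.integral_eq_sub_of_hasDerivAt (fun t _ => key t)
    (Continuous.intervalIntegrable (by fun_prop) _ _)]
  simp only [massForm]
  ring

/-- Completion of squares by Legendre polynomials, which diagonalize the form. -/
lemma massForm_self_eq (a b c : ℝ) :
    massForm a b c a b c = (a + b / 2 + c / 3) ^ 2 + (b + c) ^ 2 / 12 + c ^ 2 / 180 := by
  simp only [massForm]; ring

lemma massForm_self_nonneg (a b c : ℝ) : 0 ≤ massForm a b c a b c := by
  rw [massForm_self_eq]; positivity

/-- All norms on the quadratics on an element are equivalent. The constants are not sharp. -/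
lemma sq_le_massForm (a b c : ℝ) :
    a ^ 2 ≤ 27 * massForm a b c a b c ∧ b ^ 2 ≤ 384 * massForm a b c a b c ∧
      c ^ 2 ≤ 180 * massForm a b c a b c := by
  rw [massForm_self_eq]
  set x := a + b / 2 + c / 3 with hx
  set y := b + c with hy
  have ha : a = x - y / 2 + c / 6 := by rw [hx, hy]; ring
  have hb : b = y - c := by rw [hy]; ring
  rw [ha, hb]
  refine ⟨?_, ?_, ?_⟩
  · nlinarith [sq_nonneg (x + y / 2), sq_nonneg (x - c / 6), sq_nonneg (y / 2 + c / 6),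
      sq_nonneg x, sq_nonneg y, sq_nonneg c]
  · nlinarith [sq_nonneg (y + c), sq_nonneg x, sq_nonneg y, sq_nonneg c]
  · nlinarith [sq_nonneg x, sq_nonneg y]

lemma Pieces.openPieces {h : ℝ} {a b c : ℤ → ℝ} {u : ℝ → ℝ} (H : Pieces h a b c u) :
    OpenPieces h a b c u :=
  fun k t ht => H k t (Ioo_subset_Icc_self ht)

lemma hasSum_integral_elements {h : ℝ} (hh : 0 < h) {f : ℝ → ℝ} (hf : Integrable f) :
    HasSum (fun k : ℤ => h * ∫ t in (0 : ℝ)..1, f (h * (k + t))) (∫ x, f x) := by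
  have hg : Integrable fun t => f (h * t) := hf.comp_mul_left' hh.ne'
  have := hg.hasSum_intervalIntegral_comp_add_int.mul_left h
  rw [Measure.integral_comp_mul_left f h, abs_inv, abs_of_pos hh, smul_eq_mul,
    mul_inv_cancel_left₀ hh.ne'] at this
  simpa only [add_comm] using this

lemma intervalIntegral_congr_Ioo {f g : ℝ → ℝ} (H : ∀ t ∈ Ioo (0 : ℝ) 1, f t = g t) :
    ∫ t in (0 : ℝ)..1, f t = ∫ t in (0 : ℝ)..1, g t := by
  rw [intervalIntegral.integral_of_le zero_le_one, intervalIntegral.integral_of_le zero_le_one,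
    integral_Ioc_eq_integral_Ioo, integral_Ioc_eq_integral_Ioo]
  exact setIntegral_congr_fun measurableSet_Ioo H

theorem OpenPieces.hasSum_integral_mul {h : ℝ} (hh : 0 < h) {a b c a' b' c' : ℤ → ℝ}
    {u v : ℝ → ℝ} (hu : OpenPieces h a b c u) (hv : OpenPieces h a' b' c' v)
    (huv : Integrable fun x => u x * v x) :
    HasSum (fun k => h * massForm (a k) (b k) (c k) (a' k) (b' k) (c' k)) (∫ x, u x * v x) := by
  convert hasSum_integral_elements hh huv using 3 with k
  rw [← integral_quadratic_mul]
  refine (intervalIntegral_congr_Ioo fun t ht => ?_).symm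
  rw [hu k t ht, hv k t ht]

theorem OpenPieces.sqSummable {h : ℝ} (hh : 0 < h) {a b c : ℤ → ℝ} {u : ℝ → ℝ}
    (hu : OpenPieces h a b c u) (hL : MemLp u 2) :
    SqSummable a ∧ SqSummable b ∧ SqSummable c := by
  have hs := (hu.hasSum_integral_mul hh hu (hL.integrable_mul hL)).summable
  have hs' : Summable fun k => massForm (a k) (b k) (c k) (a k) (b k) (c k) :=
    (summable_mul_left_iff hh.ne').1 hs
  refine ⟨?_, ?_, ?_⟩
  · exact Summable.of_nonneg_of_le (fun k => sq_nonneg _) (fun k => (sq_le_massForm _ _ _).1)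
      (hs'.mul_left 27)
  · exact Summable.of_nonneg_of_le (fun k => sq_nonneg _) (fun k => (sq_le_massForm _ _ _).2.1)
      (hs'.mul_left 384)
  · exact Summable.of_nonneg_of_le (fun k => sq_nonneg _) (fun k => (sq_le_massForm _ _ _).2.2)
      (hs'.mul_left 180)

theorem OpenPieces.memLp {h : ℝ} (hh : 0 < h) {a b c : ℤ → ℝ} {u : ℝ → ℝ}
    (hu : OpenPieces h a b c u) (hm : Measurable u) (ha : SqSummable a) (hb : SqSummable b)
    (hc : SqSummable c) : MemLp u 2 := by
  rw [memLp_two_iff_integrable_sq hm.aestronglyMeasurable]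
  rw [← integrable_comp_mul_left_iff (fun x => u x ^ 2) hh.ne', ← integrableOn_univ,
    ← iUnion_Ioc_intCast ℝ]
  have heq : ∀ k : ℤ, ∀ x ∈ Ioo (k : ℝ) (k + 1), u (h * x) ^ 2 =
      (a k + b k * (x - k) + c k * (x - k) ^ 2) ^ 2 := by
    intro k x hx
    have := hu k (x - k) ⟨by linarith [hx.1], by linarith [hx.2]⟩
    rw [add_sub_cancel] at this
    rw [this]
  apply integrableOn_iUnion_of_summable_integral_norm
  · intro k
    rw [integrableOn_Ioc_iff_integrableOn_Ioo]
    refine IntegrableOn.congr_fun ?_ (fun x hx => (heq k x hx).symm) measurableSet_Ioo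
    exact (Continuous.integrableOn_Icc (by fun_prop)).mono_set Ioo_subset_Icc_self
  · refine (ha.massForm hb hc ha hb hc).congr fun k => ?_
    rw [integral_Ioc_eq_integral_Ioo, ← integral_quadratic_mul]
    have : ∀ x ∈ Ioo (k : ℝ) (k + 1), ‖u (h * x) ^ 2‖ =
      (a k + b k * (x - k) + c k * (x - k) ^ 2) * (a k + b k * (x - k) + c k * (x - k) ^ 2) := by
      intro x hx
      rw [Real.norm_of_nonneg (sq_nonneg _), heq k x hx, sq]
    rw [setIntegral_congr_fun measurableSet_Ioo this, ← integral_Ioc_eq_integral_Ioo,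
      ← intervalIntegral.integral_of_le (by linarith)]
    have := intervalIntegral.integral_comp_sub_right (a := (k : ℝ)) (b := k + 1)
      (fun t => (a k + b k * t + c k * t ^ 2) * (a k + b k * t + c k * t ^ 2)) (k : ℝ)
    rw [this]
    simp

end TwoGrid

/-! ### The finite element spaces -/

namespace TwoGrid

open MeasureTheory Set

variable {h : ℝ} {a b c a' b' c' : ℤ → ℝ} {u v : ℝ → ℝ}

lemma exists_element (hh : 0 < h) (x : ℝ) : ∃ (k : ℤ) (t : ℝ),
    t ∈ Ico (0 : ℝ) 1 ∧ x = h * (k + t) := by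
  refine ⟨⌊x / h⌋, Int.fract (x / h), ⟨Int.fract_nonneg _, Int.fract_lt_one _⟩, ?_⟩
  rw [Int.floor_add_fract]
  field_simp

lemma Pieces.compat (H : Pieces h a b c u) (k : ℤ) : a (k + 1) = a k + b k + c k := by
  have h1 := H k 1 ⟨zero_le_one, le_rfl⟩
  have h2 := H (k + 1) 0 ⟨le_rfl, zero_le_one⟩
  push_cast at h2
  rw [add_zero] at h2
  rw [h1] at h2
  linarith

lemma Pieces.sub (H : Pieces h a b c u) (H' : Pieces h a' b' c' v) :
    Pieces h (fun k => a k - a' k) (fun k => b k - b' k) (fun k => c k - c' k) (u - v) := by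
  intro k t ht
  rw [Pi.sub_apply, H k t ht, H' k t ht]
  ring

lemma Pieces.hasDerivWithinAt (hh : 0 < h) (H : Pieces h a b c u) (k : ℤ) {t : ℝ}
    (ht : t ∈ Icc (0 : ℝ) 1) :
    HasDerivWithinAt u (b k / h + 2 * c k / h * t) (Icc (h * k) (h * (k + 1))) (h * (k + t)) := by
  have hp : HasDerivAt (fun x => a k + b k * (x / h - k) + c k * (x / h - k) ^ 2)
      (b k / h + 2 * c k / h * t) (h * (k + t)) := by
    have h1 : HasDerivAt (fun x : ℝ => x / h - k) (1 / h) (h * (k + t)) :=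
      ((hasDerivAt_id _).div_const h).sub_const _
    refine (((h1.const_mul (b k)).const_add (a k)).add ((h1.pow 2).const_mul (c k))).congr_deriv ?_
    field_simp
    push_cast
    ring
  have heq : ∀ x ∈ Icc (h * k) (h * (k + 1)),
      u x = a k + b k * (x / h - k) + c k * (x / h - k) ^ 2 := by
    intro x hx
    have := H k (x / h - k) ⟨by rw [sub_nonneg, le_div_iff₀ hh]; linarith [hx.1],
      by rw [sub_le_iff_le_add, div_le_iff₀ hh]; linarith [hx.2]⟩
    rw [← this]
    congr 1
    field_simp
    ring
  refine hp.hasDerivWithinAt.congr heq (heq _ ⟨?_, ?_⟩)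
  · nlinarith [ht.1]
  · nlinarith [ht.2]

lemma Pieces.hasDerivWithinAt_Ici (hh : 0 < h) (H : Pieces h a b c u) (k : ℤ) {t : ℝ}
    (ht : t ∈ Ico (0 : ℝ) 1) :
    HasDerivWithinAt u (b k / h + 2 * c k / h * t) (Ici (h * (k + t))) (h * (k + t)) := by
  refine (H.hasDerivWithinAt hh k (Ico_subset_Icc_self ht)).mono_of_mem_nhdsWithin
    (Icc_mem_nhdsGE_of_mem ⟨?_, ?_⟩)
  · nlinarith [ht.1]
  · nlinarith [ht.2]

lemma Pieces.hasDerivWithinAt_Iic (hh : 0 < h) (H : Pieces h a b c u) (k : ℤ) {t : ℝ}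
    (ht : t ∈ Ioc (0 : ℝ) 1) :
    HasDerivWithinAt u (b k / h + 2 * c k / h * t) (Iic (h * (k + t))) (h * (k + t)) := by
  refine (H.hasDerivWithinAt hh k (Ioc_subset_Icc_self ht)).mono_of_mem_nhdsWithin
    (Icc_mem_nhdsLE_of_mem ⟨?_, ?_⟩)
  · nlinarith [ht.1]
  · nlinarith [ht.2]

lemma node_eq (h : ℝ) (k : ℤ) : h * (((k + 1 : ℤ) : ℝ) + 0) = h * (k + 1) := by
  push_cast; ring

lemma Pieces.continuous (hh : 0 < h) (H : Pieces h a b c u) : Continuous u := by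
  rw [continuous_iff_continuousAt]
  intro x
  obtain ⟨k, t, ht, rfl⟩ := exists_element hh x
  rw [continuousAt_iff_continuous_left_right]
  refine ⟨?_, (H.hasDerivWithinAt_Ici hh k ht).continuousWithinAt⟩
  rcases ht.1.eq_or_lt with rfl | h0
  · have := (H.hasDerivWithinAt_Iic hh (k - 1) (t := 1) ⟨zero_lt_one, le_rfl⟩).continuousWithinAt
    rwa [← node_eq, sub_add_cancel] at this
  · exact (H.hasDerivWithinAt_Iic hh k ⟨h0, ht.2.le⟩).continuousWithinAt

lemma Pieces.hasDerivAt (hh : 0 < h) (H : Pieces h a b c u) (k : ℤ) {t : ℝ}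
    (ht : t ∈ Ioo (0 : ℝ) 1) : HasDerivAt u (b k / h + 2 * c k / h * t) (h * (k + t)) := by
  have := (H.hasDerivWithinAt_Iic hh k (Ioo_subset_Ioc_self ht)).union
    (H.hasDerivWithinAt_Ici hh k (Ioo_subset_Ico_self ht))
  rwa [Iic_union_Ici, hasDerivWithinAt_univ] at this

lemma Pieces.deriv_openPieces (hh : 0 < h) (H : Pieces h a b c u) :
    OpenPieces h (fun k => b k / h) (fun k => 2 * c k / h) (fun _ => 0) (deriv u) := by
  intro k t ht
  rw [(H.hasDerivAt hh k ht).deriv]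
  ring

lemma Pieces.deriv_pieces (hh : 0 < h) (H : Pieces h a b c u)
    (hs : ∀ k, b (k + 1) = b k + 2 * c k) :
    Differentiable ℝ u ∧
      Pieces h (fun k => b k / h) (fun k => 2 * c k / h) (fun _ => 0) (deriv u) := by
  have hnode : ∀ k : ℤ, HasDerivAt u (b (k + 1) / h) (h * (k + 1)) := by
    intro k
    have h1 := H.hasDerivWithinAt_Iic hh k (t := 1) ⟨zero_lt_one, le_rfl⟩
    have h2 := H.hasDerivWithinAt_Ici hh (k + 1) (t := 0) ⟨le_rfl, zero_lt_one⟩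
    rw [node_eq, mul_zero, add_zero] at h2
    have h3 : b k / h + 2 * c k / h * 1 = b (k + 1) / h := by rw [hs]; ring
    rw [h3] at h1
    have := h1.union h2
    rwa [Iic_union_Ici, hasDerivWithinAt_univ] at this
  have hall : ∀ k : ℤ, ∀ t ∈ Icc (0 : ℝ) 1,
      HasDerivAt u (b k / h + 2 * c k / h * t) (h * (k + t)) := by
    intro k t ht
    rcases ht.1.eq_or_lt with rfl | h0
    · have := hnode (k - 1)
      rw [← node_eq, sub_add_cancel] at this
      simpa using this
    rcases ht.2.eq_or_lt with rfl | h1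
    · refine (hnode k).congr_deriv ?_
      rw [hs]; ring
    · exact H.hasDerivAt hh k ⟨h0, h1⟩
  constructor
  · intro x
    obtain ⟨k, t, ht, rfl⟩ := exists_element hh x
    exact (hall k t (Ico_subset_Icc_self ht)).differentiableAt
  · intro k t ht
    rw [(hall k t ht).deriv]
    ring

lemma Pieces.smooth_of_differentiable (hh : 0 < h) (H : Pieces h a b c u)
    (hu : Differentiable ℝ u) (k : ℤ) : b (k + 1) = b k + 2 * c k := by
  have h1 := H.hasDerivWithinAt_Iic hh k (t := 1) ⟨zero_lt_one, le_rfl⟩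
  have h2 := H.hasDerivWithinAt_Ici hh (k + 1) (t := 0) ⟨le_rfl, zero_lt_one⟩
  rw [node_eq, mul_zero, add_zero] at h2
  have hd := (hu (h * (k + 1))).hasDerivAt
  have e1 := (uniqueDiffWithinAt_Iic _).eq_deriv _ h1 hd.hasDerivWithinAt
  have e2 := (uniqueDiffWithinAt_Ici _).eq_deriv _ h2 hd.hasDerivWithinAt
  have := e2.trans e1.symm
  field_simp at this
  linarith

/-- Continuous piecewise quadratics with prescribed local coefficients. -/
lemma exists_pieces (hh : 0 < h) (hc : ∀ k, a (k + 1) = a k + b k + c k) :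
    ∃ u, Pieces h a b c u := by
  refine ⟨fun x => a ⌊x / h⌋ + b ⌊x / h⌋ * Int.fract (x / h) + c ⌊x / h⌋ * Int.fract (x / h) ^ 2,
    fun k t ht => ?_⟩
  have hx : h * (k + t) / h = k + t := by field_simp
  simp only [hx]
  rcases ht.2.eq_or_lt with rfl | h1
  · have : (k : ℝ) + 1 = ((k + 1 : ℤ) : ℝ) := by push_cast; ring
    rw [this, Int.floor_intCast, Int.fract_intCast, hc]
    ring
  · have hf : ⌊(k : ℝ) + t⌋ = k := by
      rw [Int.floor_eq_iff]
      exact ⟨by linarith [ht.1], by linarith⟩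
    rw [Int.fract, hf]
    ring

/-- Discretizations by piecewise linear or quadratic functions that are continuous or `C ^ 1`. -/
structure Discretization.IsLowOrder (D : Discretization) : Prop where
  one_le_degree : 1 ≤ D.degree
  degree_le_two : D.degree ≤ 2
  smoothness_le_one : D.smoothness ≤ 1

/-- The sequences of local coefficients that the members of the finite element space have.
Continuity at the nodes is `compat`, continuity of the derivative is `smooth`. -/
structure Admissible (D : Discretization) (a b c : ℤ → ℝ) : Prop where
  left : SqSummable a
  slope : SqSummable b
  bend : SqSummable c
  compat : ∀ k, a (k + 1) = a k + b k + c k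
  linear : D.degree ≤ 1 → ∀ k, c k = 0
  smooth : 1 ≤ D.smoothness → ∀ k, b (k + 1) = b k + 2 * c k

/-- The finite element functions are the functions with admissible local coefficients, see also
`exists_admissible`. -/
theorem Pieces.mem_space {D : Discretization} (hD : D.IsLowOrder) (hh : 0 < h)
    (hA : Admissible D a b c) (H : Pieces h a b c u) : u ∈ D.space h := by
  refine ⟨?_, fun k => ?_, ?_⟩
  · have hs := hD.smoothness_le_one
    obtain h0 | h1 : D.smoothness = 0 ∨ D.smoothness = 1 := by omega
    · rw [h0]
      exact contDiff_zero.2 (H.continuous hh)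
    · obtain ⟨hd, hp⟩ := H.deriv_pieces hh (hA.smooth h1.ge)
      rw [h1]
      exact contDiff_one_iff_deriv.2 ⟨hd, hp.continuous hh⟩
  · refine ⟨C (a k - b k * k + c k * k ^ 2) + C (b k / h - 2 * c k / h * k) * X +
      C (c k / h ^ 2) * X ^ 2, ?_, fun x hx => ?_⟩
    · have h1 := hD.one_le_degree
      by_cases h2 : D.degree ≤ 1
      · rw [hA.linear h2 k]
        refine le_trans ?_ h1
        simp only [mul_zero, zero_div, map_zero, zero_mul, add_zero]
        compute_degree
      · refine le_trans (b := 2) ?_ (by omega)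
        compute_degree
    · have := H k (x / h - k) ⟨by rw [sub_nonneg, le_div_iff₀ hh]; linarith [hx.1],
        by rw [sub_le_iff_le_add, div_le_iff₀ hh]; linarith [hx.2]⟩
      rw [show h * (k + (x / h - k)) = x by field_simp; ring] at this
      rw [this]
      simp
      field_simp
      ring
  · exact H.openPieces.memLp hh (H.continuous hh).measurable hA.left hA.slope hA.bend

theorem exists_mem_space {D : Discretization} (hD : D.IsLowOrder) (hh : 0 < h)
    (hA : Admissible D a b c) : ∃ u ∈ D.space h, Pieces h a b c u := by
  obtain ⟨u, hu⟩ := exists_pieces hh hA.compat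
  exact ⟨u, hu.mem_space hD hh hA, hu⟩

theorem exists_admissible {D : Discretization} (hD : D.IsLowOrder) (hh : 0 < h)
    (hu : u ∈ D.space h) : ∃ a b c, Admissible D a b c ∧ Pieces h a b c u := by
  obtain ⟨hs, hp, hL⟩ := hu
  choose p hdeg hp using hp
  have hP : Pieces h (fun k => (p k).coeff 0 + (p k).coeff 1 * (h * k) +
      (p k).coeff 2 * (h * k) ^ 2)
      (fun k => h * ((p k).coeff 1 + 2 * (p k).coeff 2 * (h * k))) (fun k => h ^ 2 * (p k).coeff 2)
      u := by
    intro k t ht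
    have hlt : (p k).natDegree < 3 := by have := hdeg k; have := hD.degree_le_two; omega
    rw [hp k _ ⟨by nlinarith [ht.1], by nlinarith [ht.2]⟩, eval_eq_sum_range' hlt]
    simp only [Finset.sum_range_succ, Finset.sum_range_zero]
    ring
  obtain ⟨ha, hb, hc⟩ := hP.openPieces.sqSummable hh hL
  refine ⟨_, _, _, ⟨ha, hb, hc, hP.compat, fun h1 k => ?_, fun h1 => ?_⟩, hP⟩
  · have hlt : (p k).natDegree < 2 := by have := hdeg k; omega
    simp only [coeff_eq_zero_of_natDegree_lt hlt, mul_zero]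
  · have h2 : D.smoothness = 1 := le_antisymm hD.smoothness_le_one h1
    rw [h2] at hs
    exact hP.smooth_of_differentiable hh (hs.differentiable (by simp))

end TwoGrid

/-! ### Orthogonal projections and the two-grid estimate -/

namespace TwoGrid

open MeasureTheory Set

variable {h : ℝ} {a b c a' b' c' : ℤ → ℝ} {u v p : ℝ → ℝ} {D : Discretization}

lemma sub_mem_space (hu : u ∈ D.space h) (hv : v ∈ D.space h) : u - v ∈ D.space h := by
  obtain ⟨hs, hp, hL⟩ := hu
  obtain ⟨hs', hp', hL'⟩ := hv
  refine ⟨hs.sub hs', fun j => ?_, hL.sub hL'⟩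
  obtain ⟨p, hd, hp⟩ := hp j
  obtain ⟨p', hd', hp'⟩ := hp' j
  refine ⟨p - p', (natDegree_sub_le _ _).trans (max_le hd hd'), fun x hx => ?_⟩
  rw [Pi.sub_apply, hp x hx, hp' x hx, eval_sub]

lemma space_two_mul_subset (hh : 0 < h) : D.space (2 * h) ⊆ D.space h := by
  rintro u ⟨hs, hp, hL⟩
  refine ⟨hs, fun j => ?_, hL⟩
  obtain ⟨p, hd, hp⟩ := hp (j / 2)
  refine ⟨p, hd, fun x hx => hp x ⟨?_, ?_⟩⟩
  · have : ((2 * (j / 2) : ℤ) : ℝ) ≤ j := by exact_mod_cast (by omega)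
    push_cast at this
    nlinarith [hx.1]
  · have : (j + 1 : ℝ) ≤ ((2 * (j / 2) + 2 : ℤ) : ℝ) := by exact_mod_cast (by omega)
    push_cast at this
    nlinarith [hx.2]

lemma ae_differentiableAt (hD : D.IsLowOrder) (hh : 0 < h) (hu : u ∈ D.space h) :
    ∀ᵐ x, DifferentiableAt ℝ u x := by
  obtain ⟨a, b, c, -, hP⟩ := exists_admissible hD hh hu
  have hc : (range fun k : ℤ => h * (k : ℝ)).Countable := countable_range _
  filter_upwards [hc.ae_notMem volume] with x hx
  obtain ⟨k, t, ht, rfl⟩ := exists_element hh x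
  refine (hP.hasDerivAt hh k ⟨ht.1.lt_of_ne ?_, ht.2⟩).differentiableAt
  rintro rfl
  exact hx ⟨k, by simp⟩

lemma memLp_deriv (hD : D.IsLowOrder) (hh : 0 < h) (hu : u ∈ D.space h) : MemLp (deriv u) 2 := by
  obtain ⟨a, b, c, hA, hP⟩ := exists_admissible hD hh hu
  refine (hP.deriv_openPieces hh).memLp hh (measurable_deriv u) (hA.slope.div_const h) ?_
    sqSummable_zero
  exact (hA.bend.const_mul 2).div_const h

/-- The energy inner product on `[0, 1]` of two quadratics, in terms of their coefficients. -/
noncomputable def stiffForm (b c b' c' : ℝ) : ℝ := b * b' + b * c' + c * b' + 4 / 3 * (c * c')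

lemma hasSum_int_pairs {f : ℤ → ℝ} {S : ℝ} (hf : HasSum f S) :
    HasSum (fun j => f (2 * j) + f (2 * j + 1)) S := by
  have := (Equiv.hasSum_iff (Int.divModEquiv 2).symm).2 hf
  convert this.prod_fiberwise fun j => hasSum_fintype _ using 2 with j
  rw [Fin.sum_univ_two]
  simp [Int.divModEquiv, mul_comm]

lemma SqSummable.of_pairs {s : ℤ → ℝ} (h0 : SqSummable fun j => s (2 * j))
    (h1 : SqSummable fun j => s (2 * j + 1)) : SqSummable s := by
  unfold SqSummable
  rw [← Equiv.summable_iff (Int.divModEquiv 2).symm]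
  have hc : (fun x => s x ^ 2) ∘ (Int.divModEquiv 2).symm =
      fun x : ℤ × Fin 2 => if x.2 = 0 then s (2 * x.1) ^ 2 else s (2 * x.1 + 1) ^ 2 := by
    ext ⟨j, i⟩
    fin_cases i <;> simp [Int.divModEquiv, mul_comm]
  rw [hc, summable_prod_of_nonneg (fun x => by dsimp only; split_ifs <;> exact sq_nonneg _)]
  refine ⟨fun j => (hasSum_fintype _).summable, ?_⟩
  simp only [tsum_fintype, Fin.sum_univ_two]
  simpa using Summable.add h0 h1

theorem hasSum_energy (hD : D.IsLowOrder) (hh : 0 < h) (hu : u ∈ D.space h) (hv : v ∈ D.space h)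
    (H : Pieces h a b c u) (H' : Pieces h a' b' c' v) :
    HasSum (fun j => (stiffForm (b (2 * j)) (c (2 * j)) (b' (2 * j)) (c' (2 * j)) +
      stiffForm (b (2 * j + 1)) (c (2 * j + 1)) (b' (2 * j + 1)) (c' (2 * j + 1))) / h)
      (∫ x, deriv u x * deriv v x) := by
  have := hasSum_int_pairs ((H.deriv_openPieces hh).hasSum_integral_mul hh (H'.deriv_openPieces hh)
    ((memLp_deriv hD hh hu).integrable_mul (memLp_deriv hD hh hv)))
  convert this using 2 with j
  simp only [stiffForm, massForm]
  field_simp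
  ring

theorem hasSum_mass (hh : 0 < h) (hu : u ∈ D.space h) (H : Pieces h a b c u) :
    HasSum (fun j => h * (massForm (a (2 * j)) (b (2 * j)) (c (2 * j)) (a (2 * j)) (b (2 * j))
      (c (2 * j)) + massForm (a (2 * j + 1)) (b (2 * j + 1)) (c (2 * j + 1)) (a (2 * j + 1))
      (b (2 * j + 1)) (c (2 * j + 1)))) (∫ x, u x ^ 2) := by
  have := hasSum_int_pairs (H.openPieces.hasSum_integral_mul hh H.openPieces
    (hu.2.2.integrable_mul hu.2.2))
  simpa only [mul_add, sq] using this

/-- The functions that are orthogonal to the coarse space in the `H ^ 1` inner product. -/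
def CoarseOrthogonal (D : Discretization) (h : ℝ) (w : ℝ → ℝ) : Prop :=
  ∀ v ∈ D.space (2 * h), ∫ x, deriv w x * deriv v x = 0

lemma isH1Projection_iff (hD : D.IsLowOrder) (hh : 0 < h) (hu : u ∈ D.space h) :
    IsH1Projection D (2 * h) u p ↔ p ∈ D.space (2 * h) ∧ CoarseOrthogonal D h (u - p) := by
  refine and_congr_right fun hp => forall₂_congr fun v _ => ?_
  have : (fun x => (deriv u x - deriv p x) * deriv v x) =ᵐ[volume]
      fun x => deriv (u - p) x * deriv v x := by
    filter_upwards [ae_differentiableAt hD hh hu,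
      ae_differentiableAt hD hh (space_two_mul_subset hh hp)] with x h1 h2
    rw [deriv_sub h1 h2]
  rw [integral_congr_ae this]

lemma integral_deriv_sub_mul (hD : D.IsLowOrder) (hh : 0 < h) (hu : u ∈ D.space h)
    (hp : p ∈ D.space h) (hv : v ∈ D.space h) :
    ∫ x, deriv (u - p) x * deriv v x =
      (∫ x, deriv u x * deriv v x) - ∫ x, deriv p x * deriv v x := by
  have hL := memLp_deriv hD hh hv
  refine Eq.trans (integral_congr_ae ?_) (integral_sub ((memLp_deriv hD hh hu).integrable_mul hL)
    ((memLp_deriv hD hh hp).integrable_mul hL))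
  filter_upwards [ae_differentiableAt hD hh hu, ae_differentiableAt hD hh hp] with x h1 h2
  rw [deriv_sub h1 h2]
  exact sub_mul _ _ _

/-- A square integrable finite element function of energy zero vanishes. -/
lemma eq_zero_of_energy (hD : D.IsLowOrder) (hh : 0 < h) (hu : u ∈ D.space h)
    (h0 : ∫ x, deriv u x * deriv u x = 0) : u = 0 := by
  obtain ⟨a, b, c, hA, hP⟩ := exists_admissible hD hh hu
  have hs := (hP.deriv_openPieces hh).hasSum_integral_mul hh (hP.deriv_openPieces hh)
    ((memLp_deriv hD hh hu).integrable_mul (memLp_deriv hD hh hu))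
  rw [h0, hasSum_zero_iff_of_nonneg fun k => mul_nonneg hh.le (massForm_self_nonneg _ _ _)] at hs
  have hbc : ∀ k, b k = 0 ∧ c k = 0 := by
    intro k
    have hk := congrFun hs k
    have hm := (mul_eq_zero.1 hk).resolve_left hh.ne'
    obtain ⟨h1, h2, -⟩ := sq_le_massForm (b k / h) (2 * c k / h) 0
    rw [hm] at h1 h2
    have e1 := pow_eq_zero_iff two_ne_zero |>.1
      (le_antisymm (by simpa only [mul_zero] using h1) (sq_nonneg _))
    have e2 := pow_eq_zero_iff two_ne_zero |>.1
      (le_antisymm (by simpa only [mul_zero] using h2) (sq_nonneg _))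
    simpa [hh.ne'] using And.intro e1 e2
  have ha : ∀ k, a k = a 0 := by
    intro k
    induction k using Int.induction_on with
    | zero => rfl
    | succ k ih => rw [hA.compat, (hbc _).1, (hbc _).2, ih]; ring
    | pred k ih =>
      have := hA.compat (-k - 1)
      rw [(hbc _).1, (hbc _).2, sub_add_cancel, ih] at this
      linarith
  have ha0 : a 0 = 0 := by
    have : Summable fun _ : ℤ => a 0 ^ 2 := Summable.congr hA.left fun k => by rw [ha k]
    rw [summable_const_iff] at this
    exact pow_eq_zero_iff two_ne_zero |>.1 this
  ext x
  obtain ⟨k, t, ht, rfl⟩ := exists_element hh x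
  rw [hP k t (Ico_subset_Icc_self ht), ha, ha0, (hbc k).1, (hbc k).2]
  simp

/-- The two-grid constant is the largest ratio of mass to energy among the projection errors.
Since the projection error is orthogonal to the coarse space, the two-grid estimate need only be
checked for functions that are orthogonal to the coarse space. -/
theorem isTwoGridConstant_of (hD : D.IsLowOrder) (hh : 0 < h) {C l : ℝ} (hC : 0 ≤ C) (hl : 0 < l)
    (hproj : ∀ u ∈ D.space h, ∃ p ∈ D.space (2 * h), CoarseOrthogonal D h (u - p) ∧
      ∫ x, (u - p) x ^ 2 ≤ C * h ^ 2 * ∫ x, deriv (u - p) x * deriv (u - p) x)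
    (hlower : ∀ C' : ℝ, (∀ w ∈ D.space h, CoarseOrthogonal D h w →
      ∫ x, w x ^ 2 ≤ C' * h ^ 2 * ∫ x, deriv w x * deriv w x) → C ≤ C') :
    IsTwoGridConstant D h l (C * h ^ 2 / l ^ 2) := by
  have hsub := space_two_mul_subset (D := D) hh
  have huniq : ∀ u ∈ D.space h, ∀ p q, IsH1Projection D (2 * h) u p → IsH1Projection D (2 * h) u q →
      p = q := by
    intro u hu p q hp hq
    rw [isH1Projection_iff hD hh hu] at hp hq
    have hpq := sub_mem_space hp.1 hq.1
    have h1 := hp.2 _ hpq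
    have h2 := hq.2 _ hpq
    rw [integral_deriv_sub_mul hD hh hu (hsub hp.1) (hsub hpq)] at h1
    rw [integral_deriv_sub_mul hD hh hu (hsub hq.1) (hsub hpq)] at h2
    refine sub_eq_zero.1 (eq_zero_of_energy hD hh (hsub hpq) ?_)
    rw [integral_deriv_sub_mul hD hh (hsub hp.1) (hsub hq.1) (hsub hpq)]
    linarith
  refine ⟨fun u hu => ?_, fun u hu q hq => ?_, fun C' hC' => ?_⟩
  · obtain ⟨p, hp, ho, -⟩ := hproj u hu
    have hP := (isH1Projection_iff hD hh hu).2 ⟨hp, ho⟩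
    exact ⟨p, hP, fun q hq => huniq u hu q p hq hP⟩
  · obtain ⟨p, hp, ho, hb⟩ := hproj u hu
    obtain rfl := huniq u hu q p hq ((isH1Projection_iff hD hh hu).2 ⟨hp, ho⟩)
    have hw := sub_mem_space hu (hsub hp)
    -- Pythagoras: the energy of `u - q` is that of `u` minus that of `q`
    have e1 := integral_deriv_sub_mul hD hh hu (hsub hp) hw
    have e2 := integral_deriv_sub_mul hD hh hu (hsub hp) (hsub hp)
    have e3 := integral_deriv_sub_mul hD hh hu (hsub hp) hu
    have e4 := ho q hp
    have comm : ∀ f g : ℝ → ℝ, ∫ x, deriv f x * deriv g x = ∫ x, deriv g x * deriv f x :=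
      fun f g => integral_congr_ae (ae_of_all _ fun x => mul_comm _ _)
    have hq0 : 0 ≤ ∫ x, deriv q x * deriv q x := integral_nonneg fun x => mul_self_nonneg _
    have hle : ∫ x, deriv (u - q) x * deriv (u - q) x ≤ ∫ x, deriv u x ^ 2 := by
      simp only [sq]
      rw [comm u (u - q), comm q (u - q)] at e1
      rw [comm q u] at e3
      linarith
    calc ∫ x, (u x - q x) ^ 2 ≤ _ := hb
      _ ≤ C * h ^ 2 * ∫ x, deriv u x ^ 2 := by gcongr
      _ = _ := by field_simp
  · have : C ≤ C' * l ^ 2 / h ^ 2 := by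
      refine hlower _ fun w hw ho => ?_
      have hz : (0 : ℝ → ℝ) ∈ D.space (2 * h) := by
        obtain ⟨p, hp, -⟩ := hproj w hw
        simpa using sub_mem_space hp hp
      have := hC' w hw 0 ((isH1Projection_iff hD hh hw).2 ⟨hz, by simpa using ho⟩)
      simp only [Pi.zero_apply, sub_zero, sq (deriv w _)] at this
      convert this using 2
      field_simp
    rw [div_le_iff₀ (by positivity)]
    rwa [le_div_iff₀ (by positivity)] at this

/-- The local coefficients on the two halves of each element of the coarse grid. -/
structure Refines (A B C a b c : ℤ → ℝ) : Prop where
  left0 : ∀ j, a (2 * j) = A j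
  slope0 : ∀ j, b (2 * j) = B j / 2
  bend0 : ∀ j, c (2 * j) = C j / 4
  left1 : ∀ j, a (2 * j + 1) = A j + B j / 2 + C j / 4
  slope1 : ∀ j, b (2 * j + 1) = B j / 2 + C j / 2
  bend1 : ∀ j, c (2 * j + 1) = C j / 4

lemma quadratic_coeff_unique {a b c a' b' c' : ℝ}
    (H : ∀ t ∈ Icc (0 : ℝ) 1, a + b * t + c * t ^ 2 = a' + b' * t + c' * t ^ 2) :
    a = a' ∧ b = b' ∧ c = c' := by
  have h0 := H 0 (by simp)
  have h1 := H 1 (by simp)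
  have h2 := H (1 / 2) (by constructor <;> norm_num)
  refine ⟨?_, ?_, ?_⟩ <;> linarith

lemma Pieces.refines {A B C : ℤ → ℝ} (hc : Pieces (2 * h) A B C v) (hf : Pieces h a b c v) :
    Refines A B C a b c := by
  have h0 : ∀ j, a (2 * j) = A j ∧ b (2 * j) = B j / 2 ∧ c (2 * j) = C j / 4 := by
    refine fun j => quadratic_coeff_unique fun t ht => ?_
    have e1 := hf (2 * j) t ht
    have e2 := hc j (t / 2) ⟨by linarith [ht.1], by linarith [ht.2]⟩
    rw [← e1, show h * (((2 * j : ℤ) : ℝ) + t) = 2 * h * (j + t / 2) by push_cast; ring, e2]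
    ring
  have h1 : ∀ j, a (2 * j + 1) = A j + B j / 2 + C j / 4 ∧ b (2 * j + 1) = B j / 2 + C j / 2 ∧
      c (2 * j + 1) = C j / 4 := by
    refine fun j => quadratic_coeff_unique fun t ht => ?_
    have e1 := hf (2 * j + 1) t ht
    have e2 := hc j ((t + 1) / 2) ⟨by linarith [ht.1], by linarith [ht.2]⟩
    rw [← e1, show h * (((2 * j + 1 : ℤ) : ℝ) + t) = 2 * h * (j + (t + 1) / 2) by push_cast; ring,
      e2]
    ring
  exact ⟨fun j => (h0 j).1, fun j => (h0 j).2.1, fun j => (h0 j).2.2, fun j => (h1 j).1,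
    fun j => (h1 j).2.1, fun j => (h1 j).2.2⟩

lemma exists_refinement (hD : D.IsLowOrder) (hh : 0 < h) {A B C : ℤ → ℝ}
    (hA : Admissible D A B C) (hP : Pieces (2 * h) A B C v) :
    ∃ a b c, Admissible D a b c ∧ Pieces h a b c v ∧ Refines A B C a b c := by
  obtain ⟨a, b, c, ha, hp⟩ :=
    exists_admissible hD hh (space_two_mul_subset hh (hP.mem_space hD (by positivity) hA))
  exact ⟨a, b, c, ha, hp, hP.refines hp⟩

lemma exists_coarse_admissible (hD : D.IsLowOrder) (hh : 0 < h) (hv : v ∈ D.space (2 * h)) :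
    ∃ A B C a b c, Admissible D A B C ∧ Pieces h a b c v ∧ Refines A B C a b c := by
  obtain ⟨A, B, C, hA, hP⟩ := exists_admissible hD (by positivity) hv
  obtain ⟨a, b, c, -, hp, hr⟩ := exists_refinement hD hh hA hP
  exact ⟨A, B, C, a, b, c, hA, hp, hr⟩

/-- A sequence with given even and odd parts. -/
lemma exists_int_pairs (f g : ℤ → ℝ) : ∃ s : ℤ → ℝ, (∀ j, s (2 * j) = f j) ∧
    ∀ j, s (2 * j + 1) = g j := by
  refine ⟨fun k => if k % 2 = 0 then f (k / 2) else g (k / 2), fun j => ?_, fun j => ?_⟩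
  · have h1 : 2 * j % 2 = 0 := by omega
    have h2 : 2 * j / 2 = j := by omega
    simp [h1, h2]
  · have h1 : (2 * j + 1) % 2 = 1 := by omega
    have h2 : (2 * j + 1) / 2 = j := by omega
    simp [h1, h2]

end TwoGrid

/-! ### The two-grid constants for Courant elements and continuous piecewise quadratics -/

namespace TwoGrid

open MeasureTheory Set

variable {h : ℝ} {a b c : ℤ → ℝ} {w : ℝ → ℝ} {D : Discretization}

lemma courant_isLowOrder : courant.IsLowOrder := ⟨by simp [courant], by simp [courant],
    by simp [courant]⟩

lemma splineP2_isLowOrder : splineP2.IsLowOrder :=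
  ⟨by simp [splineP2], by simp [splineP2], by simp [splineP2]⟩

lemma standardP2_isLowOrder : standardP2.IsLowOrder :=
  ⟨by simp [standardP2], by simp [standardP2], by simp [standardP2]⟩

lemma integral_sq_le_of_pairs (hD : D.IsLowOrder) (hh : 0 < h) (hw : w ∈ D.space h)
    (H : Pieces h a b c w) {C : ℝ}
    (hle : ∀ j, massForm (a (2 * j)) (b (2 * j)) (c (2 * j)) (a (2 * j)) (b (2 * j)) (c (2 * j)) +
      massForm (a (2 * j + 1)) (b (2 * j + 1)) (c (2 * j + 1)) (a (2 * j + 1)) (b (2 * j + 1))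
        (c (2 * j + 1)) ≤ C * (stiffForm (b (2 * j)) (c (2 * j)) (b (2 * j)) (c (2 * j)) +
      stiffForm (b (2 * j + 1)) (c (2 * j + 1)) (b (2 * j + 1)) (c (2 * j + 1)))) :
    ∫ x, w x ^ 2 ≤ C * h ^ 2 * ∫ x, deriv w x * deriv w x := by
  refine hasSum_le (fun j => ?_) (hasSum_mass hh hw H)
    ((hasSum_energy hD hh hw hw H H).mul_left (C * h ^ 2))
  refine (mul_le_mul_of_nonneg_left (hle j) hh.le).trans_eq ?_
  field_simp

/-- A function whose energy product with every quadratic vanishes on each element of the coarse grid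
is orthogonal to the coarse space. -/
lemma coarseOrthogonal_of_pairs (hD : D.IsLowOrder) (hh : 0 < h) (hw : w ∈ D.space h)
    (H : Pieces h a b c w)
    (horth : ∀ j B C, (D.degree ≤ 1 → C = 0) →
      stiffForm (b (2 * j)) (c (2 * j)) (B / 2) (C / 4) +
        stiffForm (b (2 * j + 1)) (c (2 * j + 1)) (B / 2 + C / 2) (C / 4) = 0) :
    CoarseOrthogonal D h w := by
  intro v hv
  obtain ⟨A, B, C, a', b', c', hA, hP, hr⟩ := exists_coarse_admissible hD hh hv
  refine (hasSum_energy hD hh hw (space_two_mul_subset hh hv) H hP).unique ?_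
  convert hasSum_zero using 2 with j
  rw [hr.slope0, hr.slope1, hr.bend0, hr.bend1, horth j _ _ fun h1 => hA.linear h1 j, zero_div]

lemma sqSummable_of_support {s : ℤ → ℝ} (S : Finset ℤ) (hs : ∀ k ∉ S, s k = 0) : SqSummable s :=
  summable_of_ne_finset_zero (s := S) fun k hk => by simp [hs k hk]

/-- Sharpness of the two-grid estimate, tested with the function supported in one coarse element
that has the local coefficients `0, b₀, c₀` and `b₀ + c₀, b₁, c₁` on its halves. -/
lemma le_of_bubble (hD : D.IsLowOrder) (hs : D.smoothness = 0) (hh : 0 < h) {b₀ c₀ b₁ c₁ C C' : ℝ}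
    (hlin : D.degree ≤ 1 → c₀ = 0 ∧ c₁ = 0) (hz : b₀ + c₀ + b₁ + c₁ = 0)
    (horth : ∀ B C, (D.degree ≤ 1 → C = 0) →
      stiffForm b₀ c₀ (B / 2) (C / 4) + stiffForm b₁ c₁ (B / 2 + C / 2) (C / 4) = 0)
    (hE : 0 < stiffForm b₀ c₀ b₀ c₀ + stiffForm b₁ c₁ b₁ c₁)
    (hC : massForm 0 b₀ c₀ 0 b₀ c₀ + massForm (b₀ + c₀) b₁ c₁ (b₀ + c₀) b₁ c₁ =
      C * (stiffForm b₀ c₀ b₀ c₀ + stiffForm b₁ c₁ b₁ c₁))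
    (hC' : ∀ w ∈ D.space h, CoarseOrthogonal D h w →
      ∫ x, w x ^ 2 ≤ C' * h ^ 2 * ∫ x, deriv w x * deriv w x) : C ≤ C' := by
  obtain ⟨a, ha0, ha1⟩ := exists_int_pairs (fun _ => 0) (fun j => if j = 0 then b₀ + c₀ else 0)
  obtain ⟨b, hb0, hb1⟩ := exists_int_pairs (fun j => if j = 0 then b₀ else 0)
    (fun j => if j = 0 then b₁ else 0)
  obtain ⟨c, hc0, hc1⟩ := exists_int_pairs (fun j => if j = 0 then c₀ else 0)
    (fun j => if j = 0 then c₁ else 0)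
  have hfin : ∀ r : ℝ, SqSummable fun j : ℤ => if j = 0 then r else 0 :=
    fun r => sqSummable_of_support {0} fun k hk => by simp_all
  have hA : Admissible D a b c := by
    refine ⟨.of_pairs ?_ ?_, .of_pairs ?_ ?_, .of_pairs ?_ ?_, fun k => ?_, fun h1 k => ?_,
      fun h1 => absurd h1 (by omega)⟩
    · simpa only [ha0] using sqSummable_zero
    · simpa only [ha1] using hfin _
    · simpa only [hb0] using hfin _
    · simpa only [hb1] using hfin _
    · simpa only [hc0] using hfin _
    · simpa only [hc1] using hfin _
    · obtain ⟨j, rfl | rfl⟩ := Int.even_or_odd' k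
      · rw [ha0, ha1, hb0, hc0]
        split_ifs <;> ring
      · rw [show 2 * j + 1 + 1 = 2 * (j + 1) by ring, ha0, ha1, hb1, hc1]
        split_ifs <;> linarith
    · obtain ⟨h2, h3⟩ := hlin h1
      obtain ⟨j, rfl | rfl⟩ := Int.even_or_odd' k <;> simp [hc0, hc1, h2, h3]
  obtain ⟨w, hw, hP⟩ := exists_mem_space hD hh hA
  have ho : CoarseOrthogonal D h w := by
    refine coarseOrthogonal_of_pairs hD hh hw hP fun j B C hBC => ?_
    rw [hb0, hc0, hb1, hc1]
    split_ifs
    · exact horth B C hBC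
    · simp [stiffForm]
  have hle := hC' w hw ho
  have e1 := hasSum_mass hh hw hP
  have e2 := hasSum_energy hD hh hw hw hP hP
  simp only [ha0, ha1, hb0, hb1, hc0, hc1] at e1 e2
  have e1' := hasSum_single (f := fun j : ℤ => h * (massForm 0 (if j = 0 then b₀ else 0)
    (if j = 0 then c₀ else 0) 0 (if j = 0 then b₀ else 0) (if j = 0 then c₀ else 0) +
    massForm (if j = 0 then b₀ + c₀ else 0) (if j = 0 then b₁ else 0) (if j = 0 then c₁ else 0)
      (if j = 0 then b₀ + c₀ else 0) (if j = 0 then b₁ else 0) (if j = 0 then c₁ else 0))) 0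
    fun j hj => by simp [hj, massForm]
  have e2' := hasSum_single (f := fun j : ℤ => (stiffForm (if j = 0 then b₀ else 0)
    (if j = 0 then c₀ else 0) (if j = 0 then b₀ else 0) (if j = 0 then c₀ else 0) +
    stiffForm (if j = 0 then b₁ else 0) (if j = 0 then c₁ else 0)
      (if j = 0 then b₁ else 0) (if j = 0 then c₁ else 0)) / h) 0
    fun j hj => by simp [hj, stiffForm]
  rw [e1.unique e1', e2.unique e2'] at hle
  simp only [if_true, hC] at hle
  set E := stiffForm b₀ c₀ b₀ c₀ + stiffForm b₁ c₁ b₁ c₁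
  have : h * E * C ≤ h * E * C' := by
    calc h * E * C = h * (C * E) := by ring
      _ ≤ _ := hle
      _ = _ := by field_simp
  exact le_of_mul_le_mul_left this (by positivity)

theorem courant_isTwoGridConstant (hh : 0 < h) {l : ℝ} (hl : 0 < l) :
    IsTwoGridConstant courant h l (1 / 3 * h ^ 2 / l ^ 2) := by
  have hD := courant_isLowOrder
  refine isTwoGridConstant_of hD hh (by norm_num) hl (fun u hu => ?_) (fun C' => ?_)
  · obtain ⟨a, b, c, hA, hP⟩ := exists_admissible hD hh hu
    have hc : ∀ k, c k = 0 := hA.linear le_rfl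
    have hb : ∀ k, b k = a (k + 1) - a k := fun k => by rw [hA.compat, hc]; ring
    -- the projection interpolates at the nodes of the coarse grid
    have hs : SqSummable fun j => a (2 * j) := hA.left.comp fun i j hij => by simpa using hij
    have hs' : SqSummable fun j => a (2 * (j + 1)) := hA.left.comp fun i j hij => by simpa using hij
    have hAc : Admissible courant (fun j => a (2 * j)) (fun j => a (2 * (j + 1)) - a (2 * j))
        (fun _ => 0) :=
      ⟨hs, hs'.sub hs, sqSummable_zero, fun k => by ring, fun _ _ => rfl,
        fun h1 => by simp [courant] at h1⟩
    obtain ⟨p, hp, hPp⟩ := exists_mem_space (h := 2 * h) hD (by positivity) hAc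
    obtain ⟨a', b', c', -, hP', hr⟩ := exists_refinement hD hh hAc hPp
    have hw := sub_mem_space hu (space_two_mul_subset hh hp)
    have hPw := hP.sub hP'
    refine ⟨p, hp, coarseOrthogonal_of_pairs hD hh hw hPw fun j B C hC => ?_,
      integral_sq_le_of_pairs hD hh hw hPw fun j => le_of_eq ?_⟩
    · simp only [hr.slope0, hr.slope1, hr.bend0, hr.bend1, hC le_rfl, hb, hc, stiffForm, mul_add,
        mul_one, add_assoc, one_add_one_eq_two]
      ring
    · simp only [hr.left0, hr.left1, hr.slope0, hr.slope1, hr.bend0, hr.bend1, hb, hc, stiffForm,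
        massForm, mul_add, mul_one, add_assoc, one_add_one_eq_two]
      ring
  -- the extremal function is the hat function at the midpoint of a coarse element
  · refine le_of_bubble hD rfl hh (b₀ := 1) (c₀ := 0) (b₁ := -1) (c₁ := 0) (fun _ => ⟨rfl, rfl⟩)
      (by norm_num) (fun B C hC => ?_) ?_ ?_
    · rw [hC le_rfl]
      simp only [stiffForm]
      ring
    all_goals norm_num [stiffForm, massForm]

theorem standardP2_isTwoGridConstant (hh : 0 < h) {l : ℝ} (hl : 0 < l) :
    IsTwoGridConstant standardP2 h l (1 / 10 * h ^ 2 / l ^ 2) := by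
  have hD := standardP2_isLowOrder
  have hdeg : ¬ standardP2.degree ≤ 1 := by simp [standardP2]
  refine isTwoGridConstant_of hD hh (by norm_num) hl (fun u hu => ?_) (fun C' => ?_)
  · obtain ⟨a, b, c, hA, hP⟩ := exists_admissible hD hh hu
    -- the projection has the same nodal values and the same mean as `u` on each coarse element
    have inj0 : Function.Injective fun j : ℤ => 2 * j := fun i j hij => by simpa using hij
    have inj1 : Function.Injective fun j : ℤ => 2 * j + 1 := fun i j hij => by simpa using hij
    have a0 : SqSummable fun j => a (2 * j) := hA.left.comp inj0
    have b0 : SqSummable fun j => b (2 * j) := hA.slope.comp inj0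
    have c0 : SqSummable fun j => c (2 * j) := hA.bend.comp inj0
    have a1 : SqSummable fun j => a (2 * j + 1) := hA.left.comp inj1
    have b1 : SqSummable fun j => b (2 * j + 1) := hA.slope.comp inj1
    have c1 : SqSummable fun j => c (2 * j + 1) := hA.bend.comp inj1
    have hstep : ∀ j, a (2 * j + 1) = a (2 * j) + b (2 * j) + c (2 * j) := fun j => hA.compat _
    have hend : SqSummable fun j => a (2 * (j + 1)) :=
      hA.left.comp fun i j hij => by simpa using hij
    have hend' : ∀ j, a (2 * (j + 1)) = a (2 * j + 1) + b (2 * j + 1) + c (2 * j + 1) :=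
      fun j => by rw [← hA.compat]; ring_nf
    -- `m j` is the mean value of `u` on the coarse element `j`
    obtain ⟨m, hm⟩ : ∃ m : ℤ → ℝ, m = fun j => (a (2 * j) + b (2 * j) / 2 + c (2 * j) / 3 +
      (a (2 * j + 1) + b (2 * j + 1) / 2 + c (2 * j + 1) / 3)) / 2 := ⟨_, rfl⟩
    have hms : SqSummable m := hm ▸
      ((((a0.add (b0.div_const 2)).add (c0.div_const 3)).add
        ((a1.add (b1.div_const 2)).add (c1.div_const 3))).div_const 2)
    have hC : SqSummable fun j => 3 * (a (2 * j) + a (2 * (j + 1))) - 6 * m j :=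
      ((a0.add hend).const_mul 3).sub (hms.const_mul 6)
    have hAc : Admissible standardP2 (fun j => a (2 * j))
        (fun j => a (2 * (j + 1)) - a (2 * j) - (3 * (a (2 * j) + a (2 * (j + 1))) - 6 * m j))
        (fun j => 3 * (a (2 * j) + a (2 * (j + 1))) - 6 * m j) :=
      ⟨a0, (hend.sub a0).sub hC, hC, fun k => by ring, fun h1 => absurd h1 hdeg,
        fun h1 => by simp [standardP2] at h1⟩
    obtain ⟨p, hp, hPp⟩ := exists_mem_space (h := 2 * h) hD (by positivity) hAc
    obtain ⟨a', b', c', -, hP', hr⟩ := exists_refinement hD hh hAc hPp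
    have hw := sub_mem_space hu (space_two_mul_subset hh hp)
    have hPw := hP.sub hP'
    refine ⟨p, hp, coarseOrthogonal_of_pairs hD hh hw hPw fun j B C _ => ?_,
      integral_sq_le_of_pairs hD hh hw hPw fun j => ?_⟩
    · simp only [hr.slope0, hr.slope1, hr.bend0, hr.bend1, hm, hend', hstep, stiffForm]
      ring
    · simp only [hr.left0, hr.left1, hr.slope0, hr.slope1, hr.bend0, hr.bend1, hm, hend', hstep,
        stiffForm, massForm]
      rw [← sub_nonneg]
      -- the eigenvalues of the local problem are `1 / 30` and `1 / 10`, and the eigenfunctions for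
      -- `1 / 10` vanish at the midpoint of the coarse element
      refine (mul_nonneg (show (0 : ℝ) ≤ 8 / 15 by norm_num) (sq_nonneg (a (2 * j) + b (2 * j) +
        c (2 * j) + (2 * a (2 * j) + b (2 * j) + c (2 * j) + b (2 * j + 1) + c (2 * j + 1)) / 4 -
        3 / 4 * (2 * a (2 * j) + 3 / 2 * b (2 * j) + 4 / 3 * c (2 * j) + b (2 * j + 1) / 2 +
        c (2 * j + 1) / 3)))).trans_eq ?_
      ring
  -- the extremal function is the difference of the bubbles `4 t (1 - t)` of the two halves
  · refine le_of_bubble hD rfl hh (b₀ := 4) (c₀ := -4) (b₁ := -4) (c₁ := 4)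
      (fun h1 => absurd h1 hdeg) (by norm_num) (fun B C hC => ?_) ?_ ?_
    · simp only [stiffForm]
      ring
    all_goals norm_num [stiffForm, massForm]

end TwoGrid

/-! ### The two-grid constant for quadratic splines -/

namespace TwoGrid

open MeasureTheory Set

variable {h : ℝ} {a b c : ℤ → ℝ} {u w : ℝ → ℝ}

lemma sqSummable_iff_memℓp {s : ℤ → ℝ} : SqSummable s ↔ Memℓp s 2 := by
  rw [memℓp_gen_iff (by norm_num)]
  simp [SqSummable]

/-- The translation by `m` on the square summable sequences. -/
noncomputable def shift (m : ℤ) :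
    lp (fun _ : ℤ => ℝ) 2 →L[ℝ] lp (fun _ : ℤ => ℝ) 2 :=
  LinearMap.mkContinuous
    { toFun := fun s => ⟨fun j => s (j + m), sqSummable_iff_memℓp.1
        ((sqSummable_iff_memℓp.2 s.2).comp (add_left_injective m))⟩
      map_add' := fun _ _ => rfl
      map_smul' := fun _ _ => rfl } 1 fun s => by
    rw [one_mul]
    refine le_of_eq ?_
    rw [lp.norm_eq_tsum_rpow (by norm_num), lp.norm_eq_tsum_rpow (by norm_num)]
    congr 1
    exact (Equiv.addRight m).tsum_eq fun j => ‖s j‖ ^ (2 : ℝ≥0∞).toReal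

lemma norm_shift_le (m : ℤ) : ‖shift m‖ ≤ 1 :=
  LinearMap.mkContinuous_norm_le _ zero_le_one _

/-- The tridiagonal Toeplitz operator with entries `1, 4, 1` is diagonally dominant, hence
invertible on the square summable sequences. -/
lemma exists_tridiagonal_solution {e : ℤ → ℝ} (he : SqSummable e) :
    ∃ d, SqSummable d ∧ ∀ j, d (j - 1) + 4 * d j + d (j + 1) = e j := by
  let T : lp (fun _ : ℤ => ℝ) 2 →L[ℝ] lp (fun _ : ℤ => ℝ) 2 :=
    -((1 / 4 : ℝ) • (shift (-1) + shift 1))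
  have hT : ‖T‖ < 1 := by
    rw [norm_neg, norm_smul]
    have := (norm_add_le (shift (-1)) (shift 1)).trans
      (add_le_add (norm_shift_le _) (norm_shift_le _))
    calc ‖(1 / 4 : ℝ)‖ * ‖shift (-1) + shift 1‖ ≤ 1 / 4 * (1 + 1) := by
          rw [Real.norm_of_nonneg (by norm_num)]; gcongr
      _ < 1 := by norm_num
  obtain ⟨U, hU⟩ := isUnit_one_sub_of_norm_lt_one hT
  let E : lp (fun _ : ℤ => ℝ) 2 := ⟨e, sqSummable_iff_memℓp.1 he⟩
  let d : lp (fun _ : ℤ => ℝ) 2 := (↑U⁻¹ : lp (fun _ : ℤ => ℝ) 2 →L[ℝ] _) ((1 / 4 : ℝ) • E)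
  refine ⟨d, sqSummable_iff_memℓp.2 d.2, fun j => ?_⟩
  have h1 : (1 - T) d = (1 / 4 : ℝ) • E := by
    rw [← hU]
    exact congrArg (fun f : lp (fun _ : ℤ => ℝ) 2 →L[ℝ] lp (fun _ : ℤ => ℝ) 2 =>
      f ((1 / 4 : ℝ) • E))
      U.mul_inv
  have h2 : d j - -(1 / 4 * (d (j + -1) + d (j + 1))) = 1 / 4 * e j :=
    congrArg (fun f : lp (fun _ : ℤ => ℝ) 2 => f j) h1
  rw [← sub_eq_add_neg] at h2
  linarith

/-- The coefficients of `∑ j, d j Ψ (· - 2 j)` on the fine grid, where `Ψ` is the primitive of the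
semi-orthogonal linear prewavelet, whose nodal values are `1, -6, 10, -6, 1`. -/
structure IsWaveletSum (d a b c : ℤ → ℝ) : Prop where
  left0 : ∀ j, a (2 * j) = 2 * (d (j - 1) - d j)
  left1 : ∀ j, a (2 * j + 1) = (d (j + 1) - d (j - 1)) / 2
  slope0 : ∀ j, b (2 * j) = -6 * (d (j - 1) + d j)
  slope1 : ∀ j, b (2 * j + 1) = 10 * d j + d (j - 1) + d (j + 1)
  bend0 : ∀ j, c (2 * j) = (16 * d j + 7 * d (j - 1) + d (j + 1)) / 2
  bend1 : ∀ j, c (2 * j + 1) = -(16 * d j + d (j - 1) + 7 * d (j + 1)) / 2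

lemma exists_isWaveletSum {d : ℤ → ℝ} (hd : SqSummable d) :
    ∃ a b c, Admissible splineP2 a b c ∧ IsWaveletSum d a b c := by
  obtain ⟨a, ha0, ha1⟩ := exists_int_pairs (fun j => 2 * (d (j - 1) - d j))
    (fun j => (d (j + 1) - d (j - 1)) / 2)
  obtain ⟨b, hb0, hb1⟩ := exists_int_pairs (fun j => -6 * (d (j - 1) + d j))
    (fun j => 10 * d j + d (j - 1) + d (j + 1))
  obtain ⟨c, hc0, hc1⟩ := exists_int_pairs (fun j => (16 * d j + 7 * d (j - 1) + d (j + 1)) / 2)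
    (fun j => -(16 * d j + d (j - 1) + 7 * d (j + 1)) / 2)
  have hm : SqSummable fun j => d (j - 1) := hd.comp sub_left_injective
  have hp : SqSummable fun j => d (j + 1) := hd.comp (add_left_injective 1)
  have e0 : ∀ j : ℤ, 2 * j + 1 + 1 = 2 * (j + 1) := fun j => by ring
  refine ⟨a, b, c, ⟨.of_pairs ?_ ?_, .of_pairs ?_ ?_, .of_pairs ?_ ?_, fun k => ?_, fun h1 => ?_,
    fun _ k => ?_⟩, ha0, ha1, hb0, hb1, hc0, hc1⟩
  · simpa only [ha0] using (hm.sub hd).const_mul 2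
  · simpa only [ha1] using (hp.sub hm).div_const 2
  · simpa only [hb0] using (hm.add hd).const_mul (-6)
  · simpa only [hb1] using ((hd.const_mul 10).add hm).add hp
  · simpa only [hc0] using (((hd.const_mul 16).add (hm.const_mul 7)).add hp).div_const 2
  · simpa only [hc1, neg_one_mul] using
      ((((hd.const_mul 16).add hm).add (hp.const_mul 7)).const_mul (-1)).div_const 2
  · obtain ⟨j, rfl | rfl⟩ := Int.even_or_odd' k
    · rw [ha0, ha1, hb0, hc0]; ring
    · rw [e0, ha0, ha1, hb1, hc1, add_sub_cancel_right]; ring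
  · simp [splineP2] at h1
  · obtain ⟨j, rfl | rfl⟩ := Int.even_or_odd' k
    · rw [hb0, hb1, hc0]; ring
    · rw [e0, hb0, hb1, hc1, add_sub_cancel_right]; ring

lemma IsWaveletSum.coarseOrthogonal {d : ℤ → ℝ} (hh : 0 < h) (hd : SqSummable d)
    (hW : IsWaveletSum d a b c) (hw : w ∈ splineP2.space h) (H : Pieces h a b c w) :
    CoarseOrthogonal splineP2 h w := by
  intro v hv
  have hD := splineP2_isLowOrder
  obtain ⟨A, B, C, a', b', c', hA, hP, hr⟩ := exists_coarse_admissible hD hh hv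
  refine (hasSum_energy hD hh hw (space_two_mul_subset hh hv) H hP).unique ?_
  have hm : SqSummable fun j => d (j - 1) := hd.comp sub_left_injective
  have hp : SqSummable fun j => d (j + 1) := hd.comp (add_left_injective 1)
  have hBs : ∀ j, B (j + 1) = B j + 2 * C j := hA.smooth le_rfl
  -- the energy products of the coarse elements telescope
  have hs : Summable fun j => B j * (d j - d (j - 1)) / h :=
    (hA.slope.mul (hd.sub hm)).div_const h
  have := hs.hasSum.sub ((Equiv.addRight (1 : ℤ)).hasSum_iff.2 hs.hasSum)
  rw [sub_self] at this
  refine this.congr_fun fun j => ?_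
  simp only [Function.comp_apply, Equiv.coe_addRight, add_sub_cancel_right, hBs, hr.slope0,
    hr.slope1, hr.bend0, hr.bend1, hW.slope0, hW.slope1, hW.bend0, hW.bend1, stiffForm]
  ring

/-- The coarse element contribution to the energy of a wavelet sum with consecutive coefficients
`x, y, z`. -/
noncomputable def waveletEnergy (x y z : ℝ) : ℝ :=
  32 / 3 * (x ^ 2 + z ^ 2) + 152 / 3 * y ^ 2 + 40 / 3 * (x * y + y * z) - 8 / 3 * (x * z)

/-- The deficit in the sharp two-grid estimate. It is a sum of squares, which all vanish for
alternating coefficients. -/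
noncomputable def waveletDeficit (x y z : ℝ) : ℝ :=
  18 / 5 * ((x + y) ^ 2 + (y + z) ^ 2) + 2 / 5 * (x - z) ^ 2

lemma IsWaveletSum.hasSum_deficit {d : ℤ → ℝ} (hh : 0 < h) (hd : SqSummable d)
    (hW : IsWaveletSum d a b c) (hw : w ∈ splineP2.space h) (H : Pieces h a b c w) :
    HasSum (fun j => waveletEnergy (d (j - 1)) (d j) (d (j + 1)) / h)
      (∫ x, deriv w x * deriv w x) ∧
    HasSum (fun j => h * waveletDeficit (d (j - 1)) (d j) (d (j + 1)))
      (2 / 5 * h ^ 2 * (∫ x, deriv w x * deriv w x) - ∫ x, w x ^ 2) := by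
  have hE := hasSum_energy splineP2_isLowOrder hh hw hw H H
  have hM := hasSum_mass hh hw H
  have hL := (hE.mul_left (2 / 5 * h ^ 2)).sub hM
  -- the difference to the sum of squares telescopes
  have hT : HasSum (fun j => h * (2 / 5) * (2 * d j ^ 2 - d (j - 1) ^ 2 - d (j + 1) ^ 2)) 0 := by
    have h0 := Summable.hasSum hd
    have h1 := (Equiv.addRight (1 : ℤ)).hasSum_iff.2 h0
    have h2 := (Equiv.addRight (-1 : ℤ)).hasSum_iff.2 h0
    have h3 := (((h0.mul_left 2).sub h2).sub h1).mul_left (h * (2 / 5))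
    rw [two_mul, add_sub_cancel_right, sub_self, mul_zero] at h3
    exact h3
  constructor
  · refine hE.congr_fun fun j => ?_
    simp only [waveletEnergy, hW.slope0, hW.slope1, hW.bend0, hW.bend1, stiffForm]
    ring
  · have hLT := hL.sub hT
    rw [sub_zero] at hLT
    refine hLT.congr_fun fun j => ?_
    simp only [waveletDeficit, hW.left0, hW.left1, hW.slope0, hW.slope1, hW.bend0, hW.bend1,
      stiffForm, massForm]
    field_simp
    ring

/-- Any spline is the sum of a coarse spline and a wavelet sum: the wavelet coefficients are
determined by the kinks of the derivative at the odd nodes. -/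
lemma exists_wavelet_decomposition (hh : 0 < h) (hu : u ∈ splineP2.space h) :
    ∃ p ∈ splineP2.space (2 * h), ∃ d a b c, SqSummable d ∧ IsWaveletSum d a b c ∧
      Pieces h a b c (u - p) := by
  have hD := splineP2_isLowOrder
  obtain ⟨a, b, c, hA, hP⟩ := exists_admissible hD hh hu
  have inj0 : Function.Injective fun j : ℤ => 2 * j := fun i j hij => by simpa using hij
  have inj1 : Function.Injective fun j : ℤ => 2 * j + 1 := fun i j hij => by simpa using hij
  -- the difference of the second derivatives on the halves of a coarse element has to cancel
  obtain ⟨d, hd, hde⟩ := exists_tridiagonal_solution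
    (((hA.bend.comp inj0).sub (hA.bend.comp inj1)).div_const 4)
  obtain ⟨a', b', c', hA', hW⟩ := exists_isWaveletSum hd
  obtain ⟨w, hw, hPw⟩ := exists_mem_space hD hh hA'
  have hc : ∀ j, c (2 * j + 1) - c' (2 * j + 1) = c (2 * j) - c' (2 * j) := by
    intro j
    rw [hW.bend0, hW.bend1]
    linarith [hde j]
  have hb : ∀ j, b (2 * j + 1) = b (2 * j) + 2 * c (2 * j) := fun j => hA.smooth le_rfl _
  have hb' : ∀ j, b' (2 * j + 1) = b' (2 * j) + 2 * c' (2 * j) := fun j => hA'.smooth le_rfl _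
  have ha : ∀ j, a (2 * j + 1) = a (2 * j) + b (2 * j) + c (2 * j) := fun j => hA.compat _
  have ha' : ∀ j, a' (2 * j + 1) = a' (2 * j) + b' (2 * j) + c' (2 * j) := fun j => hA'.compat _
  have e0 : ∀ j : ℤ, 2 * (j + 1) = 2 * j + 1 + 1 := fun j => by ring
  have hP' := hP.sub hPw
  have hAc : Admissible splineP2 (fun j => a (2 * j) - a' (2 * j))
      (fun j => 2 * (b (2 * j) - b' (2 * j))) (fun j => 4 * (c (2 * j) - c' (2 * j))) := by
    refine ⟨(hA.left.sub hA'.left).comp inj0, ((hA.slope.sub hA'.slope).comp inj0).const_mul 2,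
      ((hA.bend.sub hA'.bend).comp inj0).const_mul 4, fun j => ?_, fun h1 => ?_, fun _ j => ?_⟩
    · simp only [e0]
      rw [hA.compat, hA'.compat, ha, ha', hb, hb']
      linarith [hc j]
    · simp [splineP2] at h1
    · simp only [e0]
      rw [hA.smooth le_rfl, hA'.smooth le_rfl, hb, hb']
      linarith [hc j]
  have hPc : Pieces (2 * h) (fun j => a (2 * j) - a' (2 * j))
      (fun j => 2 * (b (2 * j) - b' (2 * j))) (fun j => 4 * (c (2 * j) - c' (2 * j))) (u - w) := by
    intro j t ht
    rcases le_total t (1 / 2) with h2 | h2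
    · have := hP' (2 * j) (2 * t) ⟨by linarith [ht.1], by linarith⟩
      rw [show 2 * h * ((j : ℝ) + t) = h * (((2 * j : ℤ) : ℝ) + 2 * t) by push_cast; ring, this]
      ring
    · have := hP' (2 * j + 1) (2 * t - 1) ⟨by linarith, by linarith [ht.2]⟩
      rw [show 2 * h * ((j : ℝ) + t) = h * (((2 * j + 1 : ℤ) : ℝ) + (2 * t - 1)) by push_cast; ring,
        this]
      simp only [hc, hb, hb', ha, ha']
      ring
  refine ⟨u - w, hPc.mem_space hD (by positivity) hAc, d, a', b', c', hd, hW, ?_⟩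
  rwa [sub_sub_cancel]

/-- Alternating coefficients on a long interval show that the two-grid constant for the spline space
cannot be improved. -/
lemma le_of_alternating (hh : 0 < h) {C' : ℝ}
    (hC' : ∀ w ∈ splineP2.space h, CoarseOrthogonal splineP2 h w →
      ∫ x, w x ^ 2 ≤ C' * h ^ 2 * ∫ x, deriv w x * deriv w x) : 2 / 5 ≤ C' := by
  have hD := splineP2_isLowOrder
  by_contra! hlt
  -- for `N` alternating coefficients, the energy is at least `40 N / h`, while only the four terms
  -- at the ends of the sequence contribute to the deficit
  have key : ∀ N : ℕ, (2 / 5 - C') * (40 * N) ≤ 128 := by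
    intro N
    obtain ⟨σ, hσ, hσ1⟩ : ∃ σ : ℤ → ℝ, (∀ j, σ (j + 1) = -σ j) ∧ ∀ j, σ j = 1 ∨ σ j = -1 := by
      refine ⟨fun j => if Even j then 1 else -1, fun j => ?_, fun j => ?_⟩
      · by_cases hj : Even j <;> simp [hj]
      · by_cases hj : Even j <;> simp [hj]
    obtain ⟨d, hdef⟩ : ∃ d : ℤ → ℝ, d = fun j => if 0 ≤ j ∧ j < (N : ℤ) then σ j else 0 := ⟨_, rfl⟩
    have hd : SqSummable d := sqSummable_of_support (Finset.Ico 0 N) fun k hk => by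
      rw [hdef]
      exact if_neg fun h1 => hk (Finset.mem_Ico.2 h1)
    have hsum : HasSum (fun j => d j ^ 2) N := by
      have : HasSum (fun j => d j ^ 2) (∑ j ∈ Finset.Ico (0 : ℤ) N, d j ^ 2) :=
        hasSum_sum_of_ne_finset_zero fun k hk => by
          have h0 : d k = 0 := by
            rw [hdef]
            exact if_neg fun h1 => hk (Finset.mem_Ico.2 h1)
          simp [h0]
      rw [Finset.sum_congr rfl (g := fun _ => (1 : ℝ)) fun k hk => ?_] at this
      · simpa using this
      · replace hk := Finset.mem_Ico.1 hk
        rcases hσ1 k with h1 | h1 <;> simp [hdef, hk, h1]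
    obtain ⟨a, b, c, hA, hW⟩ := exists_isWaveletSum hd
    obtain ⟨w, hw, hP⟩ := exists_mem_space hD hh hA
    obtain ⟨hE, hdef'⟩ := hW.hasSum_deficit hh hd hw hP
    have hle := hC' w hw (hW.coarseOrthogonal hh hd hw hP)
    have h1 : 40 * N / h ≤ ∫ x, deriv w x * deriv w x := by
      refine hasSum_le (fun j => ?_) ((hsum.mul_left 40).div_const h) hE
      gcongr
      simp only [waveletEnergy]
      nlinarith [sq_nonneg (d (j - 1) - d (j + 1)), sq_nonneg (d (j - 1) + d (j + 1) + d j),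
        sq_nonneg (d (j - 1)), sq_nonneg (d (j + 1)), sq_nonneg (d (j - 1) + d j),
        sq_nonneg (d (j + 1) + d j)]
    have h2 : 2 / 5 * h ^ 2 * (∫ x, deriv w x * deriv w x) - ∫ x, w x ^ 2 ≤
        h * (32 + 32 + 32 + 32) := by
      have hI := fun i : ℤ => hasSum_ite_eq i (32 : ℝ)
      refine hasSum_le (fun j => mul_le_mul_of_nonneg_left ?_ hh.le) hdef'
        (((((hI (-1)).add (hI 0)).add (hI (N - 1))).add (hI N)).mul_left h)
      have hb : ∀ k, |d k| ≤ 1 := fun k => by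
        simp only [hdef]
        split_ifs
        · rcases hσ1 k with h3 | h3 <;> simp [h3]
        · simp
      by_cases hj : j = -1 ∨ j = 0 ∨ j = N - 1 ∨ j = N
      · have hx := abs_le.1 (hb (j - 1))
        have hy := abs_le.1 (hb j)
        have hz := abs_le.1 (hb (j + 1))
        have h4 : waveletDeficit (d (j - 1)) (d j) (d (j + 1)) ≤ 32 := by
          simp only [waveletDeficit]
          nlinarith
        refine h4.trans ?_
        have hpos : ∀ q : Prop, [Decidable q] → (0 : ℝ) ≤ if q then 32 else 0 := fun q _ => by
          split_ifs <;> norm_num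
        have p1 := hpos (j = -1)
        have p2 := hpos (j = 0)
        have p3 := hpos (j = N - 1)
        have p4 := hpos (j = N)
        rcases hj with h3 | h3 | h3 | h3
        · rw [if_pos h3] at p1 ⊢; linarith
        · rw [if_pos h3] at p2 ⊢; linarith
        · rw [if_pos h3] at p3 ⊢; linarith
        · rw [if_pos h3] at p4 ⊢; linarith
      · push Not at hj
        obtain ⟨j1, j2, j3, j4⟩ := hj
        have hm : σ (j - 1) = -σ j := by
          have := hσ (j - 1)
          rw [sub_add_cancel] at this
          linarith
        rw [if_neg j1, if_neg j2, if_neg j3, if_neg j4]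
        refine le_of_eq ?_
        by_cases hin : 0 ≤ j ∧ j < N
        · have i1 : 0 ≤ j - 1 ∧ j - 1 < N := by omega
          have i2 : 0 ≤ j + 1 ∧ j + 1 < N := by omega
          simp only [hdef, waveletDeficit, if_pos hin, if_pos i1, if_pos i2, hm, hσ]
          ring
        · have i1 : ¬(0 ≤ j - 1 ∧ j - 1 < N) := by omega
          have i2 : ¬(0 ≤ j + 1 ∧ j + 1 < N) := by omega
          simp only [hdef, waveletDeficit, if_neg hin, if_neg i1, if_neg i2]
          norm_num
    have h3 : (2 / 5 - C') * h ^ 2 * ∫ x, deriv w x * deriv w x ≤ h * 128 := by linarith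
    have h4 : (2 / 5 - C') * h ^ 2 * (40 * N / h) ≤ h * 128 :=
      (mul_le_mul_of_nonneg_left h1 (mul_nonneg (by linarith) (sq_nonneg h))).trans h3
    have h5 : h * ((2 / 5 - C') * (40 * N)) ≤ h * 128 := by
      refine le_of_eq_of_le ?_ h4
      field_simp
    exact le_of_mul_le_mul_left h5 hh
  obtain ⟨N, hN⟩ := exists_nat_gt (128 / ((2 / 5 - C') * 40))
  rw [div_lt_iff₀ (by linarith)] at hN
  linarith [key N]

theorem splineP2_isTwoGridConstant (hh : 0 < h) {l : ℝ} (hl : 0 < l) :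
    IsTwoGridConstant splineP2 h l (2 / 5 * h ^ 2 / l ^ 2) := by
  refine isTwoGridConstant_of splineP2_isLowOrder hh (by norm_num) hl (fun u hu => ?_)
    fun C' => le_of_alternating hh
  obtain ⟨p, hp, d, a, b, c, hd, hW, hP⟩ := exists_wavelet_decomposition hh hu
  have hw := sub_mem_space hu (space_two_mul_subset hh hp)
  refine ⟨p, hp, hW.coarseOrthogonal hh hd hw hP, ?_⟩
  have := (hW.hasSum_deficit hh hd hw hP).2.nonneg fun j => mul_nonneg hh.le
    (by simp only [waveletDeficit]; positivity)
  linarith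

end TwoGrid

/-! ### Bloch matrices and two-grid symbols -/

namespace TwoGrid

open Set

/-- A matrix with `m × n` blocks that are constant along the diagonals, and with at most two blocks
on either side of the diagonal. -/
structure IsBlockToeplitz (m n : ℕ) (A : ℤ → ℤ → ℝ) : Prop where
  periodic : ∀ i j, A (i + m) (j + n) = A i j
  banded : ∀ i j, 0 ≤ i → i < m → A i j ≠ 0 → -2 * (n : ℤ) ≤ j ∧ j < 3 * n

/-- The action of a block Toeplitz matrix on the sequences `x` with `x (j + n) = ζ x j`, which are
represented by their values at `0, ..., n - 1`. -/
noncomputable def blochMatrix (m n : ℕ) (A : ℤ → ℤ → ℝ) (ζ : ℂ) : Matrix (Fin m) (Fin n) ℂ :=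
  .of fun r s => ∑ k ∈ Finset.Icc (-2 : ℤ) 2, (A (r : ℕ) (k * n + (s : ℕ)) : ℂ) * ζ ^ k

/-- The initial values of the modes with frequencies `ω`. -/
noncomputable def modeMatrix {n : ℕ} (ω : Fin n → ℝ) : Matrix (Fin n) (Fin n) ℂ :=
  .of fun r a => mode (ω a) (r : ℕ)

lemma mode_add (θ : ℝ) (i j : ℤ) : mode θ (i + j) = mode θ i * mode θ j := by
  rw [mode, mode, mode, ← Complex.exp_add]
  push_cast
  ring_nf

lemma mode_mul (θ : ℝ) (k j : ℤ) : mode θ (k * j) = mode θ j ^ k := by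
  rw [mode, mode, ← Complex.exp_int_mul]
  push_cast
  ring_nf

lemma mode_ne_zero (θ : ℝ) (i : ℤ) : mode θ i ≠ 0 := Complex.exp_ne_zero _

lemma IsBlockToeplitz.shift {m n : ℕ} {A : ℤ → ℤ → ℝ} (hA : IsBlockToeplitz m n A) (i j k : ℤ) :
    A (k * m + i) (k * n + j) = A i j := by
  induction k using Int.induction_on with
  | zero => simp
  | succ k ih => rw [← ih, ← hA.periodic (k * m + i)]; ring_nf
  | pred k ih => rw [← ih, ← hA.periodic]; ring_nf

lemma IsBlockToeplitz.finsum_eq {m n : ℕ} (hn : 0 < n) {A : ℤ → ℤ → ℝ} (hA : IsBlockToeplitz m n A)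
    {ζ : ℂ} {ω : ℝ} (hω : mode ω n = ζ) (r : Fin m) (k : ℤ) :
    ∑ᶠ j, (A (k * m + (r : ℕ)) j : ℂ) * mode ω j =
      ζ ^ k * ∑ s, blochMatrix m n A ζ r s * mode ω (s : ℕ) := by
  have : NeZero n := ⟨hn.ne'⟩
  have hζ : ζ ≠ 0 := hω ▸ mode_ne_zero _ _
  rw [← finsum_comp_equiv (Equiv.addLeft (k * n : ℤ)),
    ← finsum_comp_equiv (Int.divModEquiv n).symm,
    finsum_eq_sum_of_support_subset (s := Finset.Icc (-2 : ℤ) 2 ×ˢ (Finset.univ : Finset (Fin n)))]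
  · rw [Finset.sum_product, Finset.mul_sum, Finset.sum_comm]
    refine Finset.sum_congr rfl fun s _ => ?_
    rw [blochMatrix, Matrix.of_apply, Finset.sum_mul, Finset.mul_sum]
    refine Finset.sum_congr rfl fun l _ => ?_
    simp only [Int.divModEquiv, Equiv.coe_fn_symm_mk, Equiv.coe_addLeft, hA.shift, mode_add,
        mode_mul,
      hω]
    ring
  · rintro ⟨l, s⟩ hl
    simp only [Function.mem_support, Int.divModEquiv, Equiv.coe_fn_symm_mk, Equiv.coe_addLeft,
      hA.shift, ne_eq, mul_eq_zero, not_or, Complex.ofReal_eq_zero] at hl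
    obtain ⟨h1, h2⟩ := hA.banded _ _ (by positivity) (by exact_mod_cast r.2) hl.1
    have hs : ((s : ℕ) : ℤ) < n := by exact_mod_cast s.2
    have hn' : (0 : ℤ) < n := by exact_mod_cast hn
    simp only [Finset.coe_product, Finset.coe_univ, Finset.coe_Icc, mem_prod, mem_Icc, mem_univ,
      and_true]
    constructor <;> by_contra! hcon
    · nlinarith
    · nlinarith [s.val.cast_nonneg (α := ℤ)]

/-- The symbol and the Bloch matrix represent the same operator in two bases. -/
theorem isSymbol_iff {m n : ℕ} (hm : 0 < m) (hn : 0 < n) {A : ℤ → ℤ → ℝ}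
    (hA : IsBlockToeplitz m n A) {ζ : ℂ} {ω : Fin n → ℝ} {η : Fin m → ℝ}
    (hω : ∀ a, mode (ω a) n = ζ) (hη : ∀ b, mode (η b) m = ζ) {S : Matrix (Fin m) (Fin n) ℂ} :
    IsSymbol A ω η S ↔ modeMatrix η * S = blochMatrix m n A ζ * modeMatrix ω := by
  have : NeZero m := ⟨hm.ne'⟩
  have hζ : ζ ≠ 0 := hω ⟨0, hn⟩ ▸ mode_ne_zero _ _
  have key : ∀ a (r : Fin m) (k : ℤ), (∑ᶠ j, (A (k * m + (r : ℕ)) j : ℂ) * mode (ω a) j =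
      ∑ b, S b a * mode (η b) (k * m + (r : ℕ))) ↔
      (modeMatrix η * S) r a = (blochMatrix m n A ζ * modeMatrix ω) r a := by
    intro a r k
    rw [hA.finsum_eq hn (hω a)]
    have : ∑ b, S b a * mode (η b) (k * m + (r : ℕ)) = ζ ^ k * (modeMatrix η * S) r a := by
      rw [Matrix.mul_apply, Finset.mul_sum]
      refine Finset.sum_congr rfl fun b _ => ?_
      rw [mode_add, mode_mul, hη, modeMatrix, Matrix.of_apply]
      ring
    rw [this, mul_right_inj' (zpow_ne_zero _ hζ), Matrix.mul_apply (M := blochMatrix m n A ζ)]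
    exact eq_comm
  constructor
  · intro H
    ext r a
    have := H a (0 * m + (r : ℕ))
    exact (key a r 0).1 this
  · intro H a i
    obtain ⟨⟨k, r⟩, rfl⟩ := (Int.divModEquiv m).symm.surjective i
    exact (key a r k).2 (by rw [H])

/-- Equidistant frequencies over a full period give linearly independent modes. -/
lemma isUnit_det_modeMatrix {n : ℕ} {ω : Fin n → ℝ} {α : ℝ}
    (hω : ∀ a, ω a = α + (a : ℕ) * (2 * Real.pi) / n) : IsUnit (modeMatrix ω).det := by
  have : modeMatrix ω = (Matrix.vandermonde fun a => mode (ω a) 1).transpose := by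
    ext r a
    rw [modeMatrix, Matrix.of_apply, Matrix.transpose_apply, Matrix.vandermonde_apply,
      ← zpow_natCast, ← mode_mul, mul_one]
  rw [this, Matrix.det_transpose, isUnit_iff_ne_zero, Matrix.det_vandermonde_ne_zero_iff]
  intro a b hab
  obtain ⟨k, hk⟩ := Complex.exp_eq_exp_iff_exists_int.1 hab
  have hn : (0 : ℝ) < n := by exact_mod_cast a.pos
  have h1 : ω a = ω b + k * (2 * Real.pi) := by
    have h2 : (ω a : ℂ) = ω b + k * (2 * Real.pi) := by
      apply mul_right_cancel₀ Complex.I_ne_zero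
      push_cast at hk
      linear_combination hk
    exact_mod_cast h2
  rw [hω, hω] at h1
  have h3 : ((a : ℕ) : ℝ) = (b : ℕ) + k * n := by
    have := Real.pi_pos
    field_simp at h1
    have h5 : (2 * Real.pi) * ((a : ℕ) : ℝ) = (2 * Real.pi) * ((b : ℕ) + k * n) := by linarith
    exact mul_left_cancel₀ (by positivity) h5
  have h4 : ((a : ℕ) : ℤ) = (b : ℕ) + k * n := by exact_mod_cast h3
  have ha : ((a : ℕ) : ℤ) < n := by exact_mod_cast a.2
  have hb : ((b : ℕ) : ℤ) < n := by exact_mod_cast b.2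
  have h0 : (0 : ℤ) ≤ (a : ℕ) := by positivity
  have h0' : (0 : ℤ) ≤ (b : ℕ) := by positivity
  have hk0 : k = 0 := by
    by_contra hne
    rcases lt_or_gt_of_ne hne with h6 | h6 <;> nlinarith
  rw [hk0, zero_mul, add_zero] at h4
  exact Fin.ext (by exact_mod_cast h4)

lemma mode_period {n : ℕ} {ω : Fin n → ℝ} {α : ℝ}
    (hω : ∀ a, ω a = α + (a : ℕ) * (2 * Real.pi) / n) (a : Fin n) : mode (ω a) n = mode α n := by
  have hn : (n : ℂ) ≠ 0 := by exact_mod_cast a.pos.ne'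
  rw [mode, mode, Complex.exp_eq_exp_iff_exists_int]
  refine ⟨(a : ℕ), ?_⟩
  rw [hω]
  push_cast
  field_simp

section Frequencies

variable (D : Discretization) (θ : ℝ)

lemma fineFreq_eq (a : Fin (2 * D.dof)) :
    D.fineFreq θ a = θ + (a : ℕ) * (2 * Real.pi) / (2 * D.dof : ℕ) := by
  have : (D.dof : ℝ) ≠ 0 := by
    have := a.pos
    exact_mod_cast (by omega : D.dof ≠ 0)
  rw [Discretization.fineFreq]
  push_cast
  field_simp

lemma coarseFreq_eq (b : Fin D.dof) :
    D.coarseFreq θ b = 2 * θ + (b : ℕ) * (2 * Real.pi) / D.dof := rfl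

lemma mode_fineFreq (a : Fin (2 * D.dof)) :
    mode (D.fineFreq θ a) (2 * D.dof : ℕ) = mode θ (2 * D.dof : ℕ) :=
  mode_period (fineFreq_eq D θ) a

lemma mode_coarseFreq (b : Fin D.dof) :
    mode (D.coarseFreq θ b) D.dof = mode θ (2 * D.dof : ℕ) := by
  rw [mode_period (coarseFreq_eq D θ) b, mode, mode]
  push_cast
  ring_nf

end Frequencies

section LinearAlgebra

open Matrix

/-- With respect to the `K`-orthogonal decomposition into the range of `P` and the range of `Z`, the
coarse grid correction is the projection onto the range of `Z` along the range of `P`. -/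
theorem charpoly_coarseGridCorrection {q : ℕ} {M K : Matrix (Fin (2 * q)) (Fin (2 * q)) ℂ}
    {Kc N : Matrix (Fin q) (Fin q) ℂ} {P Z : Matrix (Fin (2 * q)) (Fin q) ℂ}
    {R Z' : Matrix (Fin q) (Fin (2 * q)) ℂ} (hK : IsUnit K.det) (hKc : IsUnit Kc.det)
    (hRP : R * K * P = Kc) (hRZ : R * K * Z = 0) (hZP : Z' * K * P = 0)
    (hN : Z' * M * Z = N * (Z' * K * Z)) (hS : IsUnit (Z' * K * Z).det) :
    (M * (1 - P * Kc⁻¹ * R * K) * K⁻¹).charpoly = X ^ q * N.charpoly := by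
  have h1 : fromRows (Kc⁻¹ * (R * K)) ((Z' * K * Z)⁻¹ * (Z' * K)) * fromCols P Z = 1 := by
    rw [fromRows_mul_fromCols, Matrix.mul_assoc _ (R * K) P, Matrix.mul_assoc _ (R * K) Z,
      Matrix.mul_assoc _ (Z' * K) P, Matrix.mul_assoc _ (Z' * K) Z, hRP, hRZ, hZP,
      nonsing_inv_mul _ hKc, nonsing_inv_mul _ hS, Matrix.mul_zero, Matrix.mul_zero, fromBlocks_one]
  have h2 := (mul_eq_one_comm_of_equiv
    (((finCongr (two_mul q)).trans finSumFinEquiv.symm).symm)).1 h1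
  rw [fromCols_mul_fromRows] at h2
  have h3 : 1 - P * Kc⁻¹ * R * K = Z * ((Z' * K * Z)⁻¹ * (Z' * K)) := by
    rw [← h2]
    simp only [Matrix.mul_assoc]
    abel
  have h4 : M * (1 - P * Kc⁻¹ * R * K) * K⁻¹ = (M * Z * (Z' * K * Z)⁻¹) * Z' := by
    rw [h3]
    simp only [Matrix.mul_assoc]
    rw [mul_nonsing_inv _ hK, Matrix.mul_one]
  have h5 : Z' * (M * Z * (Z' * K * Z)⁻¹) = N := by
    rw [← Matrix.mul_assoc, ← Matrix.mul_assoc, hN, Matrix.mul_assoc, mul_nonsing_inv _ hS,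
      Matrix.mul_one]
  have h6 := charpoly_mul_comm' (M * Z * (Z' * K * Z)⁻¹) Z'
  rw [h5, ← h4, Fintype.card_fin, Fintype.card_fin,
    show (X : ℂ[X]) ^ (2 * q) = X ^ q * X ^ q by rw [two_mul, pow_add],
    mul_assoc ((X : ℂ[X]) ^ q)] at h6
  exact mul_left_cancel₀ (pow_ne_zero _ X_ne_zero) h6

/-- A change of bases transforms a coarse grid correction into a coarse grid correction. -/
lemma coarseGridCorrection_conj {m n : ℕ} {M K M' K' F : Matrix (Fin m) (Fin m) ℂ}
    {Kc Kc' Fc : Matrix (Fin n) (Fin n) ℂ} {P P' : Matrix (Fin m) (Fin n) ℂ}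
    {R R' : Matrix (Fin n) (Fin m) ℂ} (hM : F * M = M' * F) (hK : F * K = K' * F)
    (hKc : Fc * Kc = Kc' * Fc) (hP : F * P = P' * Fc) (hR : Fc * R = R' * F)
    (hK0 : IsUnit K.det) (hK0' : IsUnit K'.det) (hKc0 : IsUnit Kc.det) (hKc0' : IsUnit Kc'.det) :
    F * (M * (1 - P * Kc⁻¹ * R * K) * K⁻¹) = M' * (1 - P' * Kc'⁻¹ * R' * K') * K'⁻¹ * F := by
  have hKi : F * K⁻¹ = K'⁻¹ * F := by
    calc F * K⁻¹ = K'⁻¹ * (K' * F) * K⁻¹ := by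
          rw [← Matrix.mul_assoc, nonsing_inv_mul _ hK0', Matrix.one_mul]
      _ = K'⁻¹ * F * (K * K⁻¹) := by rw [← hK]; simp only [Matrix.mul_assoc]
      _ = K'⁻¹ * F := by rw [mul_nonsing_inv _ hK0, Matrix.mul_one]
  have hKci : Fc * Kc⁻¹ = Kc'⁻¹ * Fc := by
    calc Fc * Kc⁻¹ = Kc'⁻¹ * (Kc' * Fc) * Kc⁻¹ := by
          rw [← Matrix.mul_assoc, nonsing_inv_mul _ hKc0', Matrix.one_mul]
      _ = Kc'⁻¹ * Fc * (Kc * Kc⁻¹) := by rw [← hKc]; simp only [Matrix.mul_assoc]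
      _ = Kc'⁻¹ * Fc := by rw [mul_nonsing_inv _ hKc0, Matrix.mul_one]
  have hC : F * (P * Kc⁻¹ * R * K) = P' * Kc'⁻¹ * R' * K' * F := by
    calc F * (P * Kc⁻¹ * R * K) = F * P * Kc⁻¹ * R * K := by simp only [Matrix.mul_assoc]
      _ = P' * (Fc * Kc⁻¹) * R * K := by rw [hP]; simp only [Matrix.mul_assoc]
      _ = P' * Kc'⁻¹ * (Fc * R) * K := by rw [hKci]; simp only [Matrix.mul_assoc]
      _ = P' * Kc'⁻¹ * R' * (F * K) := by rw [hR]; simp only [Matrix.mul_assoc]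
      _ = P' * Kc'⁻¹ * R' * K' * F := by rw [hK]; simp only [Matrix.mul_assoc]
  calc F * (M * (1 - P * Kc⁻¹ * R * K) * K⁻¹) = F * M * (1 - P * Kc⁻¹ * R * K) * K⁻¹ := by
        simp only [Matrix.mul_assoc]
    _ = M' * (F - F * (P * Kc⁻¹ * R * K)) * K⁻¹ := by
        rw [hM, Matrix.mul_assoc M' F, Matrix.mul_sub, Matrix.mul_one]
    _ = M' * (1 - P' * Kc'⁻¹ * R' * K') * (F * K⁻¹) := by
        rw [hC, ← Matrix.mul_assoc, Matrix.mul_assoc M' _ F, Matrix.sub_mul, Matrix.one_mul]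
    _ = _ := by rw [hKi]; simp only [Matrix.mul_assoc]

lemma isUnit_det_of_intertwines {n : ℕ} {F A B : Matrix (Fin n) (Fin n) ℂ} (hF : IsUnit F.det)
    (h : F * A = B * F) : IsUnit A.det ↔ IsUnit B.det := by
  have := congrArg det h
  rw [det_mul, det_mul, mul_comm] at this
  rw [mul_right_cancel₀ hF.ne_zero this]

end LinearAlgebra

/-- The structure of the matrices of a discretization: the prolongation is uniquely determined by
the embedding of the spaces, and all matrices are block Toeplitz matrices. -/
structure IsProlongationMatrix (D : Discretization) (h : ℝ) (P : ℤ → ℤ → ℝ) : Prop where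
  dof_pos : 0 < D.dof
  prolongation_iff : ∀ P', IsProlongation D h P' ↔ P' = P
  mass : IsBlockToeplitz (2 * D.dof) (2 * D.dof) (D.mass h)
  stiffness : IsBlockToeplitz (2 * D.dof) (2 * D.dof) (D.stiffness h)
  coarseStiffness : IsBlockToeplitz D.dof D.dof (D.stiffness (2 * h))
  prolongation : IsBlockToeplitz (2 * D.dof) D.dof P
  restriction : IsBlockToeplitz D.dof (2 * D.dof) fun j i => P i j

/-- The symbols in the basis of the quasi-periodic sequences that are unit vectors on a period.
In this basis the two-grid operator depends on `ζ = exp (2 i q θ)` only. -/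
noncomputable def blochTwoGrid (D : Discretization) (h l : ℝ) (P : ℤ → ℤ → ℝ) (ζ : ℂ) :
    Matrix (Fin (2 * D.dof)) (Fin (2 * D.dof)) ℂ :=
  ((1 / l ^ 2 : ℝ) : ℂ) • (blochMatrix (2 * D.dof) (2 * D.dof) (D.mass h) ζ *
    (1 - blochMatrix (2 * D.dof) D.dof P ζ * (blochMatrix D.dof D.dof (D.stiffness (2 * h)) ζ)⁻¹ *
      blochMatrix D.dof (2 * D.dof) (fun j i => P i j) ζ *
      blochMatrix (2 * D.dof) (2 * D.dof) (D.stiffness h) ζ) *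
    (blochMatrix (2 * D.dof) (2 * D.dof) (D.stiffness h) ζ)⁻¹)

/-- The two-grid symbol is similar to the two-grid operator in Bloch form, and is defined if and
only if the Bloch matrices of the stiffness matrices are invertible. -/
theorem isTwoGridSymbol_iff {D : Discretization} {h l θ : ℝ} {P : ℤ → ℤ → ℝ}
    (hP : IsProlongationMatrix D h P) {G : Matrix (Fin (2 * D.dof)) (Fin (2 * D.dof)) ℂ} :
    IsTwoGridSymbol D h l θ G ↔
      IsUnit (blochMatrix (2 * D.dof) (2 * D.dof) (D.stiffness h) (mode θ (2 * D.dof : ℕ))).det ∧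
      IsUnit (blochMatrix D.dof D.dof (D.stiffness (2 * h)) (mode θ (2 * D.dof : ℕ))).det ∧
      G = (modeMatrix (D.fineFreq θ))⁻¹ * blochTwoGrid D h l P (mode θ (2 * D.dof : ℕ)) *
        modeMatrix (D.fineFreq θ) := by
  have hq := hP.dof_pos
  have hq2 : 0 < 2 * D.dof := by omega
  have hω := mode_fineFreq D θ
  have hη := mode_coarseFreq D θ
  have hF := isUnit_det_modeMatrix (fineFreq_eq D θ)
  have hFc := isUnit_det_modeMatrix (coarseFreq_eq D θ)
  set F := modeMatrix (D.fineFreq θ)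
  set Fc := modeMatrix (D.coarseFreq θ)
  have cancel : ∀ {k : ℕ} (A : Matrix (Fin (2 * D.dof)) (Fin k) ℂ), F * (F⁻¹ * A) = A := fun A => by
    rw [← Matrix.mul_assoc, Matrix.mul_nonsing_inv _ hF, Matrix.one_mul]
  have cancelc : ∀ {k : ℕ} (A : Matrix (Fin D.dof) (Fin k) ℂ), Fc * (Fc⁻¹ * A) = A := fun A => by
    rw [← Matrix.mul_assoc, Matrix.mul_nonsing_inv _ hFc, Matrix.one_mul]
  simp only [IsTwoGridSymbol, hP.prolongation_iff]
  constructor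
  · rintro ⟨_, sM, sK, sKc, sP, sR, rfl, hsM, hsK, hsKc, hsP, hsR, hK, hKc, rfl⟩
    rw [isSymbol_iff hq2 hq2 hP.mass hω hω] at hsM
    rw [isSymbol_iff hq2 hq2 hP.stiffness hω hω] at hsK
    rw [isSymbol_iff hq hq hP.coarseStiffness hη hη] at hsKc
    rw [isSymbol_iff hq2 hq hP.prolongation hη hω] at hsP
    rw [isSymbol_iff hq hq2 hP.restriction hω hη] at hsR
    have hK' := (isUnit_det_of_intertwines hF hsK).1 hK
    have hKc' := (isUnit_det_of_intertwines hFc hsKc).1 hKc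
    refine ⟨hK', hKc', ?_⟩
    rw [blochTwoGrid, Matrix.mul_smul, Matrix.smul_mul, Matrix.mul_assoc F⁻¹,
      ← coarseGridCorrection_conj hsM hsK hsKc hsP hsR hK hK' hKc hKc', ← Matrix.mul_assoc,
      Matrix.nonsing_inv_mul _ hF, Matrix.one_mul]
  · rintro ⟨hK', hKc', rfl⟩
    let B := fun m n A => blochMatrix m n A (mode θ (2 * D.dof : ℕ))
    obtain ⟨sM, hsM⟩ : ∃ S, F * S = B (2 * D.dof) (2 * D.dof) (D.mass h) * F :=
      ⟨_, cancel _⟩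
    obtain ⟨sK, hsK⟩ : ∃ S, F * S = B (2 * D.dof) (2 * D.dof) (D.stiffness h) * F :=
      ⟨_, cancel _⟩
    obtain ⟨sKc, hsKc⟩ : ∃ S, Fc * S = B D.dof D.dof (D.stiffness (2 * h)) * Fc :=
      ⟨_, cancelc _⟩
    obtain ⟨sP, hsP⟩ : ∃ S, F * S = B (2 * D.dof) D.dof P * Fc :=
      ⟨_, cancel _⟩
    obtain ⟨sR, hsR⟩ : ∃ S, Fc * S = B D.dof (2 * D.dof) (fun j i => P i j) * F :=
      ⟨_, cancelc _⟩
    have hK := (isUnit_det_of_intertwines hF hsK).2 hK'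
    have hKc := (isUnit_det_of_intertwines hFc hsKc).2 hKc'
    refine ⟨P, sM, sK, sKc, sP, sR, rfl, (isSymbol_iff hq2 hq2 hP.mass hω hω).2 hsM,
      (isSymbol_iff hq2 hq2 hP.stiffness hω hω).2 hsK,
      (isSymbol_iff hq hq hP.coarseStiffness hη hη).2 hsKc,
      (isSymbol_iff hq2 hq hP.prolongation hη hω).2 hsP,
      (isSymbol_iff hq hq2 hP.restriction hω hη).2 hsR, hK, hKc, ?_⟩
    rw [blochTwoGrid, Matrix.mul_smul, Matrix.smul_mul, Matrix.mul_assoc F⁻¹,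
      ← coarseGridCorrection_conj hsM hsK hsKc hsP hsR hK hK' hKc hKc', ← Matrix.mul_assoc,
      Matrix.nonsing_inv_mul _ hF, Matrix.one_mul]

lemma charpoly_of_isTwoGridSymbol {D : Discretization} {h l θ : ℝ} {P : ℤ → ℤ → ℝ}
    (hP : IsProlongationMatrix D h P) {G : Matrix (Fin (2 * D.dof)) (Fin (2 * D.dof)) ℂ}
    (hG : IsTwoGridSymbol D h l θ G) :
    G.charpoly = (blochTwoGrid D h l P (mode θ (2 * D.dof : ℕ))).charpoly := by
  obtain ⟨-, -, rfl⟩ := (isTwoGridSymbol_iff hP).1 hG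
  rw [Matrix.mul_assoc, Matrix.charpoly_mul_comm, Matrix.mul_assoc,
    Matrix.mul_nonsing_inv _ (isUnit_det_modeMatrix (fineFreq_eq D θ)), Matrix.mul_one]

/-- The exceptional frequencies are those for which the constants occur among the modes. -/
lemma mode_eq_one_iff (D : Discretization) (θ : ℝ) :
    mode θ (2 * D.dof : ℕ) = 1 ↔ Real.sin (D.dof * θ) = 0 := by
  rw [mode, Complex.exp_eq_one_iff, Real.sin_eq_zero_iff]
  refine exists_congr fun k => ?_
  have hI : (2 * Complex.I : ℂ) ≠ 0 := by simp
  constructor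
  · intro h1
    have h2 : (k * Real.pi : ℂ) = D.dof * θ := by
      apply mul_left_cancel₀ hI
      push_cast at h1
      linear_combination -h1
    exact_mod_cast h2
  · intro h1
    have h2 : (k * Real.pi : ℂ) = D.dof * θ := by exact_mod_cast congrArg Complex.ofReal h1
    push_cast
    linear_combination -2 * Complex.I * h2

section SpectralRadius

open Matrix

lemma spectralRadius_le {n : ℕ} {G : Matrix (Fin n) (Fin n) ℂ} {C : ℝ}
    (hG : ∀ z, G.charpoly.IsRoot z → ‖z‖ ≤ C) : spectralRadius ℂ G ≤ ENNReal.ofReal C := by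
  refine iSup₂_le fun z hz => ?_
  rw [← ENNReal.ofReal_coe_nnreal, coe_nnnorm]
  exact ENNReal.ofReal_le_ofReal (hG z (mem_spectrum_iff_isRoot_charpoly.1 hz))

lemma isFourierConstant_of {D : Discretization} {h l C θ : ℝ} (hC : 0 ≤ C)
    (hle : ∀ θ G, IsTwoGridSymbol D h l θ G → ∀ z, G.charpoly.IsRoot z → ‖z‖ ≤ C)
    (hθ : θ ∈ Ico 0 (2 * Real.pi)) {G : Matrix (Fin (2 * D.dof)) (Fin (2 * D.dof)) ℂ}
    (hG : IsTwoGridSymbol D h l θ G) (hroot : G.charpoly.IsRoot C) :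
    IsFourierConstant D h l C := by
  constructor
  · rintro r ⟨θ, -, G, hG, rfl⟩
    exact spectralRadius_le (hle θ G hG)
  · intro r hr
    refine le_trans ?_ (hr ⟨θ, hθ, G, hG, rfl⟩)
    have := le_iSup₂ (f := fun (z : ℂ) (_ : z ∈ spectrum ℂ G) => (‖z‖₊ : ℝ≥0∞)) (C : ℂ)
      (mem_spectrum_iff_isRoot_charpoly.2 hroot)
    refine le_trans (le_of_eq ?_) this
    rw [← ENNReal.ofReal_coe_nnreal, coe_nnnorm, Complex.norm_real, Real.norm_of_nonneg hC]

end SpectralRadius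

end TwoGrid

/-! ### Mass and stiffness matrices, and the matrices for Courant elements -/

namespace TwoGrid

open MeasureTheory Set

section Stencils

variable {h : ℝ} {a b c a' b' c' : ℤ → ℝ} {u v : ℝ → ℝ} {S T : Finset ℤ}

lemma integral_mul_of_support (hh : 0 < h) (hu : Pieces h a b c u) (hv : Pieces h a' b' c' v)
    (hS : ∀ k ∉ S, a k = 0 ∧ b k = 0 ∧ c k = 0) (hT : ∀ k ∉ T, a' k = 0 ∧ b' k = 0 ∧ c' k = 0) :
    ∫ x, v x * u x = h * ∑ k ∈ S, massForm (a' k) (b' k) (c' k) (a k) (b k) (c k) := by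
  have hu2 := hu.openPieces.memLp hh (hu.continuous hh).measurable
    (sqSummable_of_support S fun k hk => (hS k hk).1)
    (sqSummable_of_support S fun k hk => (hS k hk).2.1)
    (sqSummable_of_support S fun k hk => (hS k hk).2.2)
  have hv2 := hv.openPieces.memLp hh (hv.continuous hh).measurable
    (sqSummable_of_support T fun k hk => (hT k hk).1)
    (sqSummable_of_support T fun k hk => (hT k hk).2.1)
    (sqSummable_of_support T fun k hk => (hT k hk).2.2)
  rw [Finset.mul_sum]
  refine (hv.openPieces.hasSum_integral_mul hh hu.openPieces (hv2.integrable_mul hu2)).unique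
    (hasSum_sum_of_ne_finset_zero fun k hk => ?_)
  obtain ⟨h1, h2, h3⟩ := hS k hk
  simp [massForm, h1, h2, h3]

lemma integral_deriv_mul_of_support (hh : 0 < h) (hu : Pieces h a b c u) (hv : Pieces h a' b' c' v)
    (hS : ∀ k ∉ S, a k = 0 ∧ b k = 0 ∧ c k = 0) (hT : ∀ k ∉ T, a' k = 0 ∧ b' k = 0 ∧ c' k = 0) :
    ∫ x, deriv v x * deriv u x = 1 / h * ∑ k ∈ S, stiffForm (b' k) (c' k) (b k) (c k) := by
  have hu2 := (hu.deriv_openPieces hh).memLp hh (measurable_deriv u)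
    ((sqSummable_of_support S fun k hk => (hS k hk).2.1).div_const h)
    (((sqSummable_of_support S fun k hk => (hS k hk).2.2).const_mul 2).div_const h) sqSummable_zero
  have hv2 := (hv.deriv_openPieces hh).memLp hh (measurable_deriv v)
    ((sqSummable_of_support T fun k hk => (hT k hk).2.1).div_const h)
    (((sqSummable_of_support T fun k hk => (hT k hk).2.2).const_mul 2).div_const h) sqSummable_zero
  rw [Finset.mul_sum]
  have := ((hv.deriv_openPieces hh).hasSum_integral_mul hh (hu.deriv_openPieces hh)
    (hv2.integrable_mul hu2)).unique (hasSum_sum_of_ne_finset_zero (s := S) fun k hk => by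
      obtain ⟨h1, h2, h3⟩ := hS k hk
      simp [massForm, h2, h3])
  refine this.trans (Finset.sum_congr rfl fun k _ => ?_)
  simp only [massForm, stiffForm]
  field_simp
  ring

/-- The symmetric pentadiagonal pattern with entries `e₀, e₁, e₂` (diagonal, first and second
off-diagonals) in the even rows and `o₀, o₁, o₂` in the odd rows. -/
def stencil (e₀ e₁ e₂ o₀ o₁ o₂ : ℝ) (i j : ℤ) : ℝ :=
  if Even i then
    if j - i = 0 then e₀ else if j - i = 1 ∨ j - i = -1 then e₁
    else if j - i = 2 ∨ j - i = -2 then e₂ else 0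
  else
    if j - i = 0 then o₀ else if j - i = 1 ∨ j - i = -1 then o₁
    else if j - i = 2 ∨ j - i = -2 then o₂ else 0

lemma isBlockToeplitz_stencil {n : ℕ} (hn : 0 < n) {e₀ e₁ e₂ o₀ o₁ o₂ : ℝ}
    (H : Even n ∨ e₀ = o₀ ∧ e₁ = o₁ ∧ e₂ = o₂) :
    IsBlockToeplitz n n (stencil e₀ e₁ e₂ o₀ o₁ o₂) := by
  constructor
  · intro i j
    simp only [stencil, add_sub_add_right_eq_sub]
    rcases H with H | ⟨rfl, rfl, rfl⟩
    · have : Even (i + n) ↔ Even i := by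
        rw [Int.even_add]
        simp [H]
      simp only [this]
    · simp only [ite_self]
  · intro i j h0 h1 hne
    by_contra hcon
    apply hne
    simp only [stencil]
    have a0 : j - i ≠ 0 := by omega
    have a1 : ¬(j - i = 1 ∨ j - i = -1) := by omega
    have a2 : ¬(j - i = 2 ∨ j - i = -2) := by omega
    simp only [a0, a1, a2, if_false, ite_self]

lemma sum_Icc_neg_two_two {M : Type*} [AddCommMonoid M] (f : ℤ → M) :
    ∑ k ∈ Finset.Icc (-2 : ℤ) 2, f k = f (-2) + f (-1) + f 0 + f 1 + f 2 := by
  rw [show Finset.Icc (-2 : ℤ) 2 = {-2, -1, 0, 1, 2} by decide]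
  simp [add_assoc]

variable (e₀ e₁ e₂ o₀ o₁ o₂ : ℝ) (ζ : ℂ)

lemma blochMatrix_stencil_one :
    blochMatrix 1 1 (stencil e₀ e₁ e₂ o₀ o₁ o₂) ζ =
      !![e₀ + e₁ * (ζ + ζ⁻¹) + e₂ * (ζ ^ 2 + (ζ ^ 2)⁻¹)] := by
  ext r s
  fin_cases r; fin_cases s
  simp [blochMatrix, sum_Icc_neg_two_two, stencil, zpow_neg]
  ring

lemma blochMatrix_stencil_two :
    blochMatrix 2 2 (stencil e₀ e₁ e₂ o₀ o₁ o₂) ζ =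
      !![e₀ + e₂ * (ζ + ζ⁻¹), e₁ * (1 + ζ⁻¹); o₁ * (1 + ζ), o₀ + o₂ * (ζ + ζ⁻¹)] := by
  ext r s
  fin_cases r <;> fin_cases s <;>
  · simp [blochMatrix, sum_Icc_neg_two_two, stencil, zpow_neg]
    try ring

lemma blochMatrix_stencil_four :
    blochMatrix 4 4 (stencil e₀ e₁ e₂ o₀ o₁ o₂) ζ =
      !![(e₀ : ℂ), (e₁ : ℂ), e₂ * (1 + ζ⁻¹), e₁ * ζ⁻¹;
        (o₁ : ℂ), (o₀ : ℂ), (o₁ : ℂ), o₂ * (1 + ζ⁻¹);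
        e₂ * (1 + ζ), (e₁ : ℂ), (e₀ : ℂ), (e₁ : ℂ);
        o₁ * ζ, o₂ * (1 + ζ), (o₁ : ℂ), (o₀ : ℂ)] := by
  ext r s
  fin_cases r <;> fin_cases s <;>
  · simp [blochMatrix, sum_Icc_neg_two_two, stencil, zpow_neg, Int.even_iff]
    try ring

end Stencils

/-- The prolongation is determined by functionals that are biorthogonal to the basis. -/
lemma prolongation_iff_of_dual {D : Discretization} {h : ℝ} {P : ℤ → ℤ → ℝ}
    (dual : ℤ → (ℝ → ℝ) → ℝ)
    (hdual : ∀ c : ℤ → ℝ, ∀ i, dual i (fun x => ∑ᶠ k, c k * D.basis h k x) = c i)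
    (hP : IsProlongation D h P) (P' : ℤ → ℤ → ℝ) : IsProlongation D h P' ↔ P' = P := by
  refine ⟨fun hP' => ?_, fun h1 => h1 ▸ hP⟩
  ext i j
  rw [← hdual (fun i => P' i j) i, ← hdual (fun i => P i j) i, ← _root_.funext (hP j),
    ← _root_.funext (hP' j)]

section Courant

variable {h : ℝ}

lemma pieces_hat (hh : 0 < h) (i : ℤ) :
    Pieces h (fun k => if k = i then 1 else 0) (fun k =>
      if k = i then -1 else if k = i - 1 then 1 else 0)
      (fun _ => 0) (hat h i) := by
  intro k t ht
  have hx : h * (k + t) / h - i = ((k - i : ℤ) : ℝ) + t := by field_simp; push_cast; ring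
  rw [hat, hx]
  obtain h1 | h1 | h1 | h1 : k = i ∨ k = i - 1 ∨ k - i ≤ -2 ∨ 1 ≤ k - i := by omega
  · simp [h1, abs_of_nonneg ht.1, ht.2]; ring
  · have : |-1 + t| = 1 - t := by rw [abs_of_nonpos (by linarith [ht.2])]; ring
    simp [h1, this, ht.1]
  · have h2 : ((k - i : ℤ) : ℝ) ≤ -2 := by exact_mod_cast h1
    dsimp only
    rw [if_neg (by omega), if_neg (by omega), if_neg (by omega), max_eq_left]
    · ring
    · linarith [neg_abs_le (((k - i : ℤ) : ℝ) + t), neg_le_abs (((k - i : ℤ) : ℝ) + t), ht.2]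
  · have h2 : (1 : ℝ) ≤ ((k - i : ℤ) : ℝ) := by exact_mod_cast h1
    dsimp only
    rw [if_neg (by omega), if_neg (by omega), if_neg (by omega), max_eq_left]
    · ring
    · linarith [le_abs_self (((k - i : ℤ) : ℝ) + t), ht.1]

lemma support_hat (i k : ℤ) (hk : k ∉ ({i - 1, i} : Finset ℤ)) :
    (if k = i then (1 : ℝ) else 0) = 0 ∧
      (if k = i then (-1 : ℝ) else if k = i - 1 then 1 else 0) = 0 ∧ (0 : ℝ) = 0 := by
  simp only [Finset.mem_insert, Finset.mem_singleton, not_or] at hk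
  simp [hk.1, hk.2]

lemma courant_mass (hh : 0 < h) :
    courant.mass h = stencil (h * (2 / 3)) (h * (1 / 6)) 0 (h * (2 / 3)) (h * (1 / 6)) 0 := by
  ext i j
  refine (integral_mul_of_support hh (pieces_hat hh i) (pieces_hat hh j) (support_hat i)
    (support_hat j)).trans ?_
  rw [Finset.sum_pair (by omega)]
  simp only [stencil, ite_self]
  split_ifs <;> first | omega | (simp only [massForm]; ring)

lemma courant_stiffness (hh : 0 < h) :
    courant.stiffness h = stencil (1 / h * 2) (1 / h * (-1)) 0 (1 / h * 2) (1 / h * (-1)) 0 := by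
  ext i j
  refine (integral_deriv_mul_of_support hh (pieces_hat hh i) (pieces_hat hh j) (support_hat i)
    (support_hat j)).trans ?_
  rw [Finset.sum_pair (by omega)]
  simp only [stencil, ite_self]
  split_ifs <;> first | omega | (simp only [stiffForm]; ring)

lemma finsum_hat (hh : 0 < h) (c : ℤ → ℝ) (k : ℤ) {t : ℝ} (ht : t ∈ Icc (0 : ℝ) 1) :
    ∑ᶠ i, c i * hat h i (h * (k + t)) = c k * (1 - t) + c (k + 1) * t := by
  rw [finsum_eq_sum_of_support_subset (s := {k, k + 1})]
  · rw [Finset.sum_pair (by omega), pieces_hat hh _ k t ht, pieces_hat hh _ k t ht]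
    dsimp only
    rw [if_pos rfl, if_pos rfl, if_neg (by omega), if_neg (by omega), if_pos (by omega)]
    ring
  · intro i hi
    rw [Function.mem_support, pieces_hat hh _ k t ht] at hi
    by_contra hcon
    simp only [Finset.coe_insert, Finset.coe_singleton, mem_insert_iff, mem_singleton_iff,
      not_or] at hcon
    apply hi
    dsimp only
    rw [if_neg (by omega), if_neg (by omega), if_neg (by omega)]
    ring

/-- The prolongation for Courant elements: linear interpolation. -/
noncomputable def courantProlongation (i j : ℤ) : ℝ :=
  if i = 2 * j then 1 else if i = 2 * j + 1 ∨ i = 2 * j - 1 then 1 / 2 else 0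

lemma two_mul_node_even (h t : ℝ) (m : ℤ) :
    h * (((2 * m : ℤ) : ℝ) + t) = 2 * h * (m + t / 2) := by push_cast; ring

lemma two_mul_node_odd (h t : ℝ) (m : ℤ) :
    h * (((2 * m + 1 : ℤ) : ℝ) + t) = 2 * h * (m + (t + 1) / 2) := by push_cast; ring

lemma courant_isProlongation (hh : 0 < h) : IsProlongation courant h courantProlongation := by
  intro j x
  obtain ⟨k, t, ht, rfl⟩ := exists_element hh x
  refine Eq.trans ?_ (finsum_hat hh _ k (Ico_subset_Icc_self ht)).symm
  change hat (2 * h) j _ = _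
  have hp := pieces_hat (mul_pos two_pos hh) j
  obtain ⟨m, rfl | rfl⟩ := Int.even_or_odd' k
  · rw [two_mul_node_even, hp m (t / 2) ⟨by linarith [ht.1], by linarith [ht.2]⟩]
    simp only [courantProlongation]
    split_ifs <;> first | omega | ring
  · rw [two_mul_node_odd, hp m ((t + 1) / 2) ⟨by linarith [ht.1], by linarith [ht.2]⟩]
    simp only [courantProlongation]
    split_ifs <;> first | omega | ring

theorem courant_isProlongationMatrix (hh : 0 < h) :
    IsProlongationMatrix courant h courantProlongation := by
  refine ⟨one_pos, prolongation_iff_of_dual (fun i f => f (h * i)) (fun c i => ?_)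
    (courant_isProlongation hh), ?_, ?_, ?_, ⟨fun i j => ?_, fun i j h0 h1 hne => ?_⟩,
    ⟨fun i j => ?_, fun i j h0 h1 hne => ?_⟩⟩
  · have := finsum_hat hh c i (t := 0) ⟨le_rfl, zero_le_one⟩
    simpa [courant] using this
  · exact courant_mass hh ▸ isBlockToeplitz_stencil two_pos (.inl even_two)
  · exact courant_stiffness hh ▸ isBlockToeplitz_stencil two_pos (.inl even_two)
  · exact courant_stiffness (mul_pos two_pos hh) ▸
      isBlockToeplitz_stencil one_pos (.inr ⟨rfl, rfl, rfl⟩)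
  · simp only [courantProlongation, courant]
    push_cast
    split_ifs <;> first | omega | rfl
  · simp only [courantProlongation, courant] at *
    push_cast at *
    split_ifs at hne <;> first | omega | exact absurd rfl hne
  · simp only [courantProlongation, courant]
    push_cast
    split_ifs <;> first | omega | rfl
  · simp only [courantProlongation, courant] at *
    push_cast at *
    split_ifs at hne <;> first | omega | exact absurd rfl hne

end Courant

end TwoGrid

/-! ### The matrices for quadratic splines -/

namespace TwoGrid

open MeasureTheory Set

section Spline

variable {h : ℝ}

/-- The constant term of the quadratic B-spline number `i` in the local coordinate of the element
number `i + d`. -/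
noncomputable def bsplineLeft (d : ℤ) : ℝ := if d = 0 ∨ d = 1 then 1 / 2 else 0

/-- The coefficients of the linear terms that belong to `bsplineLeft`. -/
noncomputable def bsplineSlope (d : ℤ) : ℝ := if d = 0 then 1 else if d = 1 then -1 else 0

/-- The coefficients of the quadratic terms that belong to `bsplineLeft`. -/
noncomputable def bsplineBend (d : ℤ) : ℝ :=
  if d = 0 then -1 else if d = -1 ∨ d = 1 then 1 / 2 else 0

lemma bspline_outside {d : ℤ} (hd : d < -1 ∨ 1 < d) :
    bsplineLeft d = 0 ∧ bsplineSlope d = 0 ∧ bsplineBend d = 0 := by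
  rw [bsplineLeft, bsplineSlope, bsplineBend, if_neg (by omega), if_neg (by omega),
    if_neg (by omega), if_neg (by omega), if_neg (by omega)]
  exact ⟨rfl, rfl, rfl⟩

lemma pieces_bspline (hh : 0 < h) (i : ℤ) :
    Pieces h (fun k => bsplineLeft (k - i)) (fun k => bsplineSlope (k - i))
      (fun k => bsplineBend (k - i)) (bspline h i) := by
  intro k t ht
  obtain ⟨h0, h1⟩ := ht
  have hx : h * (k + t) / h - i = ((k - i : ℤ) : ℝ) + t := by field_simp; push_cast; ring
  rw [bspline, hx]
  dsimp only
  generalize k - i = d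
  obtain rfl | rfl | rfl | hd : d = 0 ∨ d = -1 ∨ d = 1 ∨ (d < -1 ∨ 1 < d) := by omega
  · norm_num [bsplineLeft, bsplineSlope, bsplineBend, h0]
    rcases h1.eq_or_lt with rfl | h1
    · norm_num
    · rw [if_neg fun h => by linarith [h.2], if_pos h1]
      ring
  · norm_num [bsplineLeft, bsplineSlope, bsplineBend, h0]
    rcases h1.eq_or_lt with rfl | h1
    · norm_num
    · rw [if_pos h1]
      ring
  · norm_num [bsplineLeft, bsplineSlope, bsplineBend, h0]
    rcases h1.eq_or_lt with rfl | h1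
    · norm_num
    · rw [if_neg fun h => by linarith [h.2], if_neg fun h => by linarith [h.2],
        if_pos (by linarith)]
      ring
  · obtain ⟨e1, e2, e3⟩ := bspline_outside hd
    rw [e1, e2, e3]
    rcases hd with hd | hd
    · have h2 : (d : ℝ) ≤ -2 := by exact_mod_cast (by omega : d ≤ -2)
      rcases (by linarith : (d : ℝ) + t ≤ -1).eq_or_lt with h3 | h3
      · rw [h3]
        norm_num
      · rw [if_neg fun h => by linarith [h.1], if_neg fun h => by linarith [h.1],
          if_neg fun h => by linarith [h.1]]
        ring
    · have h2 : (2 : ℝ) ≤ d := by exact_mod_cast (by omega : 2 ≤ d)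
      rw [if_neg fun h => by linarith [h.2], if_neg fun h => by linarith [h.2],
        if_neg fun h => by linarith [h.2]]
      ring

lemma support_bspline (i k : ℤ) (hk : k ∉ ({i - 1, i, i + 1} : Finset ℤ)) :
    bsplineLeft (k - i) = 0 ∧ bsplineSlope (k - i) = 0 ∧ bsplineBend (k - i) = 0 := by
  simp only [Finset.mem_insert, Finset.mem_singleton, not_or] at hk
  exact bspline_outside (by omega)

lemma sum_triple (f : ℤ → ℝ) (i : ℤ) :
    ∑ k ∈ {i - 1, i, i + 1}, f k = f (i - 1) + f i + f (i + 1) := by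
  rw [Finset.sum_insert (by simp; omega), Finset.sum_pair (by omega), add_assoc]

lemma splineP2_mass (hh : 0 < h) :
    splineP2.mass h = stencil (h * (11 / 20)) (h * (13 / 60)) (h * (1 / 120))
      (h * (11 / 20)) (h * (13 / 60)) (h * (1 / 120)) := by
  ext i j
  refine (integral_mul_of_support hh (pieces_bspline hh i) (pieces_bspline hh j) (support_bspline i)
    (support_bspline j)).trans ?_
  rw [sum_triple]
  simp only [stencil, ite_self, show i - 1 - j = -1 - (j - i) by ring,
    show i - j = -(j - i) by ring, show i + 1 - j = 1 - (j - i) by ring,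
      show i - 1 - i = -1 by ring,
    sub_self, add_sub_cancel_left]
  generalize j - i = d
  obtain rfl | rfl | rfl | rfl | rfl | hd : d = 0 ∨ d = 1 ∨ d = -1 ∨ d = 2 ∨ d = -2 ∨
    (d < -2 ∨ 2 < d) := by omega
  iterate 5 norm_num [bsplineLeft, bsplineSlope, bsplineBend, massForm]
  obtain ⟨e1, e2, e3⟩ := bspline_outside (d := -1 - d) (by omega)
  obtain ⟨e4, e5, e6⟩ := bspline_outside (d := -d) (by omega)
  obtain ⟨e7, e8, e9⟩ := bspline_outside (d := 1 - d) (by omega)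
  rw [e1, e2, e3, e4, e5, e6, e7, e8, e9, if_neg (by omega), if_neg (by omega), if_neg (by omega)]
  simp only [massForm]
  ring

lemma splineP2_stiffness (hh : 0 < h) :
    splineP2.stiffness h = stencil (1 / h) (1 / h * (-1 / 3)) (1 / h * (-1 / 6))
      (1 / h) (1 / h * (-1 / 3)) (1 / h * (-1 / 6)) := by
  ext i j
  refine (integral_deriv_mul_of_support hh (pieces_bspline hh i) (pieces_bspline hh j)
    (support_bspline i) (support_bspline j)).trans ?_
  rw [sum_triple]
  simp only [stencil, ite_self, show i - 1 - j = -1 - (j - i) by ring,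
    show i - j = -(j - i) by ring, show i + 1 - j = 1 - (j - i) by ring,
      show i - 1 - i = -1 by ring,
    sub_self, add_sub_cancel_left]
  generalize j - i = d
  obtain rfl | rfl | rfl | rfl | rfl | hd : d = 0 ∨ d = 1 ∨ d = -1 ∨ d = 2 ∨ d = -2 ∨
    (d < -2 ∨ 2 < d) := by omega
  iterate 5 norm_num [bsplineSlope, bsplineBend, stiffForm]
  obtain ⟨-, e2, e3⟩ := bspline_outside (d := -1 - d) (by omega)
  obtain ⟨-, e5, e6⟩ := bspline_outside (d := -d) (by omega)
  obtain ⟨-, e8, e9⟩ := bspline_outside (d := 1 - d) (by omega)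
  rw [e2, e3, e5, e6, e8, e9, if_neg (by omega), if_neg (by omega), if_neg (by omega)]
  simp only [stiffForm]
  ring

lemma finsum_bspline (hh : 0 < h) (c : ℤ → ℝ) (k : ℤ) {t : ℝ} (ht : t ∈ Icc (0 : ℝ) 1) :
    ∑ᶠ i, c i * bspline h i (h * (k + t)) =
      c (k - 1) * (1 - t) ^ 2 / 2 + c k * (1 / 2 + t - t ^ 2) + c (k + 1) * t ^ 2 / 2 := by
  rw [finsum_eq_sum_of_support_subset (s := {k - 1, k, k + 1})]
  · rw [sum_triple, pieces_bspline hh _ k t ht, pieces_bspline hh _ k t ht,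
      pieces_bspline hh _ k t ht]
    norm_num [bsplineLeft, bsplineSlope, bsplineBend]
    ring
  · intro i hi
    rw [Function.mem_support, pieces_bspline hh _ k t ht] at hi
    by_contra hcon
    simp only [Finset.coe_insert, Finset.coe_singleton, mem_insert_iff, mem_singleton_iff,
      not_or] at hcon
    apply hi
    obtain ⟨e1, e2, e3⟩ := bspline_outside (d := k - i) (by omega)
    simp only [e1, e2, e3]
    ring

/-- The prolongation for quadratic splines: the two-scale relation of the quadratic B-spline. -/
noncomputable def splineProlongation (i j : ℤ) : ℝ :=
  if i - 2 * j = 0 ∨ i - 2 * j = 1 then 3 / 4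
  else if i - 2 * j = -1 ∨ i - 2 * j = 2 then 1 / 4 else 0

lemma splineP2_isProlongation (hh : 0 < h) : IsProlongation splineP2 h splineProlongation := by
  intro j x
  obtain ⟨k, t, ht, rfl⟩ := exists_element hh x
  refine Eq.trans ?_ (finsum_bspline hh _ k (Ico_subset_Icc_self ht)).symm
  change bspline (2 * h) j _ = _
  have hp := pieces_bspline (mul_pos two_pos hh) j
  obtain ⟨m, rfl | rfl⟩ := Int.even_or_odd' k
  · rw [two_mul_node_even, hp m (t / 2) ⟨by linarith [ht.1], by linarith [ht.2]⟩]
    simp only [splineProlongation, show 2 * m - 1 - 2 * j = 2 * (m - j) - 1 by ring,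
      show 2 * m - 2 * j = 2 * (m - j) by ring, show 2 * m + 1 - 2 * j = 2 * (m - j) + 1 by ring]
    generalize m - j = d
    obtain rfl | rfl | rfl | hd : d = 0 ∨ d = -1 ∨ d = 1 ∨ (d < -1 ∨ 1 < d) := by omega
    iterate 3
      norm_num [bsplineLeft, bsplineSlope, bsplineBend]
      ring
    obtain ⟨e1, e2, e3⟩ := bspline_outside hd
    rw [e1, e2, e3, if_neg (by omega), if_neg (by omega), if_neg (by omega), if_neg (by omega),
      if_neg (by omega), if_neg (by omega)]
    ring
  · rw [two_mul_node_odd, hp m ((t + 1) / 2) ⟨by linarith [ht.1], by linarith [ht.2]⟩]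
    simp only [splineProlongation, show 2 * m + 1 - 1 - 2 * j = 2 * (m - j) by ring,
      show 2 * m + 1 - 2 * j = 2 * (m - j) + 1 by ring,
      show 2 * m + 1 + 1 - 2 * j = 2 * (m - j) + 2 by ring]
    generalize m - j = d
    obtain rfl | rfl | rfl | hd : d = 0 ∨ d = -1 ∨ d = 1 ∨ (d < -1 ∨ 1 < d) := by omega
    iterate 3
      norm_num [bsplineLeft, bsplineSlope, bsplineBend]
      ring
    obtain ⟨e1, e2, e3⟩ := bspline_outside hd
    rw [e1, e2, e3, if_neg (by omega), if_neg (by omega), if_neg (by omega), if_neg (by omega),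
      if_neg (by omega), if_neg (by omega)]
    ring

theorem splineP2_isProlongationMatrix (hh : 0 < h) :
    IsProlongationMatrix splineP2 h splineProlongation := by
  -- the values `f 0, f (1 / 2), f 1` on an element determine the coefficient of the B-spline
  -- centred there
  refine ⟨one_pos, prolongation_iff_of_dual
    (fun i f => 2 * f (h * (i + 1 / 2)) - (f (h * (i + 0)) + f (h * (i + 1))) / 2) (fun c i => ?_)
    (splineP2_isProlongation hh), ?_, ?_, ?_, ⟨fun i j => ?_, fun i j h0 h1 hne => ?_⟩,
    ⟨fun i j => ?_, fun i j h0 h1 hne => ?_⟩⟩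
  · simp only [splineP2]
    rw [finsum_bspline hh c i (t := 0) ⟨le_rfl, zero_le_one⟩,
      finsum_bspline hh c i (t := 1) ⟨zero_le_one, le_rfl⟩,
      finsum_bspline hh c i (t := 1 / 2) ⟨by norm_num, by norm_num⟩]
    ring
  · exact splineP2_mass hh ▸ isBlockToeplitz_stencil two_pos (.inl even_two)
  · exact splineP2_stiffness hh ▸ isBlockToeplitz_stencil two_pos (.inl even_two)
  · exact splineP2_stiffness (mul_pos two_pos hh) ▸
      isBlockToeplitz_stencil one_pos (.inr ⟨rfl, rfl, rfl⟩)
  · simp only [splineProlongation, splineP2]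
    push_cast
    split_ifs <;> first | omega | rfl
  · simp only [splineProlongation, splineP2] at *
    push_cast at *
    split_ifs at hne <;> first | omega | exact absurd rfl hne
  · simp only [splineProlongation, splineP2]
    push_cast
    split_ifs <;> first | omega | rfl
  · simp only [splineProlongation, splineP2] at *
    push_cast at *
    split_ifs at hne <;> first | omega | exact absurd rfl hne

end Spline

end TwoGrid

/-! ### The matrices for continuous piecewise quadratics -/

namespace TwoGrid

open MeasureTheory Set

section NodalP2

variable {h : ℝ}

/-- The constant term of the nodal basis function number `i` in the local coordinate of the element
whose left end point is the node number `i + d`. -/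
noncomputable def nodalLeft (d : ℤ) : ℝ := if d = 0 then 1 else 0

/-- The coefficients of the linear terms that belong to `nodalLeft`. -/
noncomputable def nodalSlope (d : ℤ) : ℝ :=
  if d = 0 then -3 else if d = -2 then -1 else if d = -1 then 4 else 0

/-- The coefficients of the quadratic terms that belong to `nodalLeft`. -/
noncomputable def nodalBend (d : ℤ) : ℝ := if d = 0 ∨ d = -2 then 2 else if d = -1 then -4 else 0

lemma nodal_outside {d : ℤ} (hd : d < -2 ∨ 0 < d) :
    nodalLeft d = 0 ∧ nodalSlope d = 0 ∧ nodalBend d = 0 := by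
  rw [nodalLeft, nodalSlope, nodalBend, if_neg (by omega), if_neg (by omega),
    if_neg (by omega), if_neg (by omega), if_neg (by omega), if_neg (by omega)]
  exact ⟨rfl, rfl, rfl⟩

lemma pieces_nodalP2 (hh : 0 < h) (i : ℤ) :
    Pieces h (fun k => nodalLeft (2 * k - i)) (fun k => nodalSlope (2 * k - i))
      (fun k => nodalBend (2 * k - i)) (nodalP2 h i) := by
  intro k t ht
  obtain ⟨h0, h1⟩ := ht
  have hx : h * (k + t) / h - i / 2 = ((2 * k - i : ℤ) : ℝ) / 2 + t := by
    field_simp; push_cast; ring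
  have hev : Even i ↔ Even (2 * k - i) := by simp [Int.even_sub]
  rw [nodalP2, hx]
  simp only [hev]
  generalize 2 * k - i = d
  obtain rfl | rfl | rfl | hd : d = 0 ∨ d = -1 ∨ d = -2 ∨ (d < -2 ∨ 0 < d) := by omega
  · norm_num [nodalLeft, nodalSlope, nodalBend, abs_of_nonneg h0, h1]
    ring
  · have : |-1 / 2 + t| ≤ 1 / 2 := abs_le.2 ⟨by linarith, by linarith⟩
    have hodd : ¬Even (-1 : ℤ) := by decide
    rw [if_neg hodd]
    push_cast
    rw [if_pos this]
    norm_num [nodalLeft, nodalSlope, nodalBend]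
    ring
  · have : |-1 + t| = 1 - t := by rw [abs_of_nonpos (by linarith)]; ring
    have heven : Even (-2 : ℤ) := by decide
    rw [if_pos heven]
    push_cast
    rw [show (-2 : ℝ) / 2 = -1 by norm_num, this, if_pos (by linarith)]
    norm_num [nodalLeft, nodalSlope, nodalBend]
    ring
  · obtain ⟨e1, e2, e3⟩ := nodal_outside hd
    rw [e1, e2, e3]
    split_ifs with heven hle hle
    · -- on the boundary of the support, the basis function vanishes
      have h2 : 1 ≤ |(d : ℝ) / 2 + t| := by
        obtain ⟨m, hm⟩ := heven
        rcases hd with hd | hd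
        · have : (d : ℝ) ≤ -4 := by exact_mod_cast (by omega : d ≤ -4)
          exact le_abs.2 (.inr (by linarith))
        · have : (2 : ℝ) ≤ d := by exact_mod_cast (by omega : 2 ≤ d)
          exact le_abs.2 (.inl (by linarith))
      rw [le_antisymm hle h2]
      ring
    · ring
    · have h2 : 1 / 2 ≤ |(d : ℝ) / 2 + t| := by
        rcases hd with hd | hd
        · have : (d : ℝ) ≤ -3 := by exact_mod_cast (by omega : d ≤ -3)
          exact le_abs.2 (.inr (by linarith))
        · have : (1 : ℝ) ≤ d := by exact_mod_cast (by omega : 1 ≤ d)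
          exact le_abs.2 (.inl (by linarith))
      rw [← sq_abs, le_antisymm hle h2]
      ring
    · ring

/-- The elements that contain the node number `i`. -/
def nodalSupport (i : ℤ) : Finset ℤ := if Even i then {i / 2 - 1, i / 2} else {i / 2}

lemma support_nodalP2 (i k : ℤ) (hk : k ∉ nodalSupport i) :
    nodalLeft (2 * k - i) = 0 ∧ nodalSlope (2 * k - i) = 0 ∧ nodalBend (2 * k - i) = 0 := by
  refine nodal_outside ?_
  obtain ⟨m, rfl | rfl⟩ := Int.even_or_odd' i
  · rw [nodalSupport, if_pos (even_two_mul m)] at hk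
    simp only [Finset.mem_insert, Finset.mem_singleton, not_or] at hk
    omega
  · rw [nodalSupport, if_neg (Int.not_even_two_mul_add_one m)] at hk
    simp only [Finset.mem_singleton] at hk
    omega

lemma sum_nodalSupport_even (f : ℤ → ℝ) (m : ℤ) :
    ∑ k ∈ nodalSupport (2 * m), f k = f (m - 1) + f m := by
  rw [nodalSupport, if_pos (even_two_mul m), show 2 * m / 2 = m by omega,
    Finset.sum_pair (by omega)]

lemma sum_nodalSupport_odd (f : ℤ → ℝ) (m : ℤ) :
    ∑ k ∈ nodalSupport (2 * m + 1), f k = f m := by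
  rw [nodalSupport, if_neg (Int.not_even_two_mul_add_one m), show (2 * m + 1) / 2 = m by omega,
    Finset.sum_singleton]

lemma standardP2_mass (hh : 0 < h) :
    standardP2.mass h = stencil (h * (4 / 15)) (h * (1 / 15)) (h * (-1 / 30))
      (h * (8 / 15)) (h * (1 / 15)) 0 := by
  ext i j
  refine (integral_mul_of_support hh (pieces_nodalP2 hh i) (pieces_nodalP2 hh j) (support_nodalP2 i)
    (support_nodalP2 j)).trans ?_
  obtain ⟨m, rfl | rfl⟩ := Int.even_or_odd' i
  · rw [sum_nodalSupport_even, stencil, if_pos (even_two_mul m)]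
    simp only [show 2 * (m - 1) - j = -2 - (j - 2 * m) by ring,
      show 2 * m - j = -(j - 2 * m) by ring, show 2 * (m - 1) - 2 * m = -2 by ring, sub_self]
    generalize j - 2 * m = d
    obtain rfl | rfl | rfl | rfl | rfl | hd : d = 0 ∨ d = 1 ∨ d = -1 ∨ d = 2 ∨ d = -2 ∨
      (d < -2 ∨ 2 < d) := by omega
    iterate 5 norm_num [nodalLeft, nodalSlope, nodalBend, massForm]
    obtain ⟨e1, e2, e3⟩ := nodal_outside (d := -2 - d) (by omega)
    obtain ⟨e4, e5, e6⟩ := nodal_outside (d := -d) (by omega)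
    rw [e1, e2, e3, e4, e5, e6, if_neg (by omega), if_neg (by omega), if_neg (by omega)]
    simp only [massForm]
    ring
  · rw [sum_nodalSupport_odd, stencil, if_neg (Int.not_even_two_mul_add_one m)]
    simp only [show 2 * m - j = -1 - (j - (2 * m + 1)) by ring,
      show 2 * m - (2 * m + 1) = -1 by ring, ite_self]
    generalize j - (2 * m + 1) = d
    obtain rfl | rfl | rfl | hd : d = 0 ∨ d = 1 ∨ d = -1 ∨ (d < -1 ∨ 1 < d) := by omega
    iterate 3 norm_num [nodalLeft, nodalSlope, nodalBend, massForm]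
    obtain ⟨e1, e2, e3⟩ := nodal_outside (d := -1 - d) (by omega)
    rw [e1, e2, e3, if_neg (by omega), if_neg (by omega)]
    simp only [massForm]
    ring

lemma standardP2_stiffness (hh : 0 < h) :
    standardP2.stiffness h = stencil (1 / h * (14 / 3)) (1 / h * (-8 / 3)) (1 / h * (1 / 3))
      (1 / h * (16 / 3)) (1 / h * (-8 / 3)) 0 := by
  ext i j
  refine (integral_deriv_mul_of_support hh (pieces_nodalP2 hh i) (pieces_nodalP2 hh j)
    (support_nodalP2 i) (support_nodalP2 j)).trans ?_
  obtain ⟨m, rfl | rfl⟩ := Int.even_or_odd' i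
  · rw [sum_nodalSupport_even, stencil, if_pos (even_two_mul m)]
    simp only [show 2 * (m - 1) - j = -2 - (j - 2 * m) by ring,
      show 2 * m - j = -(j - 2 * m) by ring, show 2 * (m - 1) - 2 * m = -2 by ring, sub_self]
    generalize j - 2 * m = d
    obtain rfl | rfl | rfl | rfl | rfl | hd : d = 0 ∨ d = 1 ∨ d = -1 ∨ d = 2 ∨ d = -2 ∨
      (d < -2 ∨ 2 < d) := by omega
    iterate 5 norm_num [nodalSlope, nodalBend, stiffForm]
    obtain ⟨-, e2, e3⟩ := nodal_outside (d := -2 - d) (by omega)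
    obtain ⟨-, e5, e6⟩ := nodal_outside (d := -d) (by omega)
    rw [e2, e3, e5, e6, if_neg (by omega), if_neg (by omega), if_neg (by omega)]
    simp only [stiffForm]
    ring
  · rw [sum_nodalSupport_odd, stencil, if_neg (Int.not_even_two_mul_add_one m)]
    simp only [show 2 * m - j = -1 - (j - (2 * m + 1)) by ring,
      show 2 * m - (2 * m + 1) = -1 by ring, ite_self]
    generalize j - (2 * m + 1) = d
    obtain rfl | rfl | rfl | hd : d = 0 ∨ d = 1 ∨ d = -1 ∨ (d < -1 ∨ 1 < d) := by omega
    iterate 3 norm_num [nodalSlope, nodalBend, stiffForm]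
    obtain ⟨-, e2, e3⟩ := nodal_outside (d := -1 - d) (by omega)
    rw [e2, e3, if_neg (by omega), if_neg (by omega)]
    simp only [stiffForm]
    ring

lemma finsum_nodalP2 (hh : 0 < h) (c : ℤ → ℝ) (k : ℤ) {t : ℝ} (ht : t ∈ Icc (0 : ℝ) 1) :
    ∑ᶠ i, c i * nodalP2 h i (h * (k + t)) = c (2 * k) * (1 - 3 * t + 2 * t ^ 2) +
      c (2 * k + 1) * (4 * t - 4 * t ^ 2) + c (2 * k + 2) * (2 * t ^ 2 - t) := by
  rw [finsum_eq_sum_of_support_subset (s := {2 * k, 2 * k + 1, 2 * k + 2})]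
  · rw [Finset.sum_insert (by simp), Finset.sum_pair (by omega),
      pieces_nodalP2 hh _ k t ht, pieces_nodalP2 hh _ k t ht, pieces_nodalP2 hh _ k t ht]
    norm_num [nodalLeft, nodalSlope, nodalBend]
    ring
  · intro i hi
    rw [Function.mem_support, pieces_nodalP2 hh _ k t ht] at hi
    by_contra hcon
    simp only [Finset.coe_insert, Finset.coe_singleton, mem_insert_iff, mem_singleton_iff,
      not_or] at hcon
    apply hi
    obtain ⟨e1, e2, e3⟩ := nodal_outside (d := 2 * k - i) (by omega)
    simp only [e1, e2, e3]
    ring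

/-- The prolongation for continuous piecewise quadratics: the values of the coarse nodal basis
functions at the fine nodes. -/
noncomputable def nodalProlongation (i j : ℤ) : ℝ :=
  if i - 2 * j = 0 then 1
  else if Even j then
    if i - 2 * j = 1 ∨ i - 2 * j = -1 then 3 / 8
    else if i - 2 * j = 3 ∨ i - 2 * j = -3 then -1 / 8 else 0
  else if i - 2 * j = 1 ∨ i - 2 * j = -1 then 3 / 4 else 0

lemma standardP2_isProlongation (hh : 0 < h) : IsProlongation standardP2 h nodalProlongation := by
  intro j x
  obtain ⟨k, t, ht, rfl⟩ := exists_element hh x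
  refine Eq.trans ?_ (finsum_nodalP2 hh _ k (Ico_subset_Icc_self ht)).symm
  change nodalP2 (2 * h) j _ = _
  have hp := pieces_nodalP2 (mul_pos two_pos hh) j
  obtain ⟨m, rfl | rfl⟩ := Int.even_or_odd' k
  · rw [two_mul_node_even, hp m (t / 2) ⟨by linarith [ht.1], by linarith [ht.2]⟩]
    have hev : Even j ↔ Even (2 * m - j) := by simp [Int.even_sub]
    simp only [nodalProlongation, show 2 * (2 * m) - 2 * j = 2 * (2 * m - j) by ring, hev,
      show 2 * (2 * m) + 1 - 2 * j = 2 * (2 * m - j) + 1 by ring,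
      show 2 * (2 * m) + 2 - 2 * j = 2 * (2 * m - j) + 2 by ring]
    generalize 2 * m - j = d
    obtain rfl | rfl | rfl | hd : d = 0 ∨ d = -1 ∨ d = -2 ∨ (d < -2 ∨ 0 < d) := by omega
    iterate 3
      norm_num [nodalLeft, nodalSlope, nodalBend, Int.even_iff]
      try ring
    obtain ⟨e1, e2, e3⟩ := nodal_outside hd
    rw [e1, e2, e3]
    split_ifs with h1 h2 h3 <;> first | (rw [Int.even_iff] at *; omega) | omega | ring
  · rw [two_mul_node_odd, hp m ((t + 1) / 2) ⟨by linarith [ht.1], by linarith [ht.2]⟩]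
    have hev : Even j ↔ Even (2 * m - j) := by simp [Int.even_sub]
    simp only [nodalProlongation, show 2 * (2 * m + 1) - 2 * j = 2 * (2 * m - j) + 2 by ring, hev,
      show 2 * (2 * m + 1) + 1 - 2 * j = 2 * (2 * m - j) + 3 by ring,
      show 2 * (2 * m + 1) + 2 - 2 * j = 2 * (2 * m - j) + 4 by ring]
    generalize 2 * m - j = d
    obtain rfl | rfl | rfl | hd : d = 0 ∨ d = -1 ∨ d = -2 ∨ (d < -2 ∨ 0 < d) := by omega
    iterate 3
      norm_num [nodalLeft, nodalSlope, nodalBend, Int.even_iff]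
      try ring
    obtain ⟨e1, e2, e3⟩ := nodal_outside hd
    rw [e1, e2, e3]
    split_ifs with h1 h2 h3 <;> first | (rw [Int.even_iff] at *; omega) | omega | ring

theorem standardP2_isProlongationMatrix (hh : 0 < h) :
    IsProlongationMatrix standardP2 h nodalProlongation := by
  have hper : ∀ i j : ℤ, nodalProlongation (i + 4) (j + 2) = nodalProlongation i j := by
    intro i j
    have : Even (j + 2) ↔ Even j := by simp
    simp only [nodalProlongation, show i + 4 - 2 * (j + 2) = i - 2 * j by ring, this]
  have hband : ∀ i j : ℤ, nodalProlongation i j ≠ 0 → -3 ≤ i - 2 * j ∧ i - 2 * j ≤ 3 := by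
    intro i j hne
    by_contra hcon
    apply hne
    rw [nodalProlongation]
    split_ifs <;> first | omega | rfl
  refine ⟨two_pos, prolongation_iff_of_dual (fun i f => if Even i then f (h * ((i / 2 : ℤ) + 0))
      else f (h * ((i / 2 : ℤ) + 1 / 2))) (fun c i => ?_)
    (standardP2_isProlongation hh), ?_, ?_, ?_, ⟨hper, fun i j h0 h1 hne => ?_⟩,
    ⟨fun i j => hper j i, fun i j h0 h1 hne => ?_⟩⟩
  · simp only [standardP2]
    rw [finsum_nodalP2 hh c _ (t := 0) ⟨le_rfl, zero_le_one⟩,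
      finsum_nodalP2 hh c _ (t := 1 / 2) ⟨by norm_num, by norm_num⟩]
    obtain ⟨m, rfl | rfl⟩ := Int.even_or_odd' i
    · rw [if_pos (even_two_mul m), show 2 * m / 2 = m by omega]
      ring
    · rw [if_neg (Int.not_even_two_mul_add_one m), show (2 * m + 1) / 2 = m by omega]
      ring
  · exact standardP2_mass hh ▸ isBlockToeplitz_stencil (n := 4) (by norm_num) (.inl (by decide))
  · exact standardP2_stiffness hh ▸ isBlockToeplitz_stencil (n := 4) (by norm_num)
      (.inl (by decide))
  · exact standardP2_stiffness (mul_pos two_pos hh) ▸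
      isBlockToeplitz_stencil two_pos (.inl even_two)
  · have := hband i j hne
    simp only [standardP2] at *
    push_cast at *
    omega
  · have := hband j i hne
    simp only [standardP2] at *
    push_cast at *
    omega

end NodalP2

end TwoGrid

/-! ### Galerkin splittings, and the splitting for Courant elements -/

namespace TwoGrid

open Set Matrix

/-- The ranges of `P` and of a matrix `Z` split the fine space into `K`-orthogonal parts (from the
left, with respect to the ranges of `R` and `Z'`), and on the second part `M` is `N` times `K`. -/
structure IsGalerkinSplitting {m q : ℕ} (M K : Matrix (Fin m) (Fin m) ℂ)
    (Kc : Matrix (Fin q) (Fin q) ℂ)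
    (P : Matrix (Fin m) (Fin q) ℂ) (R : Matrix (Fin q) (Fin m) ℂ) (Z : Matrix (Fin m) (Fin q) ℂ)
    (Z' : Matrix (Fin q) (Fin m) ℂ) (N : Matrix (Fin q) (Fin q) ℂ) : Prop where
  galerkin : R * K * P = Kc
  right_orthogonal : R * K * Z = 0
  left_orthogonal : Z' * K * P = 0
  mass_eq : Z' * M * Z = N * (Z' * K * Z)
  isUnit_det : IsUnit (Z' * K * Z).det

lemma IsGalerkinSplitting.isUnit_det_stiffness {q : ℕ} {M K : Matrix (Fin (2 * q)) (Fin (2 * q)) ℂ}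
    {Kc N : Matrix (Fin q) (Fin q) ℂ} {P Z : Matrix (Fin (2 * q)) (Fin q) ℂ}
    {R Z' : Matrix (Fin q) (Fin (2 * q)) ℂ} (H : IsGalerkinSplitting M K Kc P R Z Z' N)
    (hKc : IsUnit Kc.det) : IsUnit K.det := by
  -- in the bases given by the splitting, `K` is block diagonal with blocks `Kc` and `Z' * K * Z`
  have h1 : fromRows (Kc⁻¹ * R) ((Z' * K * Z)⁻¹ * Z') * (K * fromCols P Z) = 1 := by
    rw [mul_fromCols, fromRows_mul_fromCols, Matrix.mul_assoc _ R, Matrix.mul_assoc _ R,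
      Matrix.mul_assoc _ Z', Matrix.mul_assoc _ Z', ← Matrix.mul_assoc R, ← Matrix.mul_assoc R,
      ← Matrix.mul_assoc Z', ← Matrix.mul_assoc Z', H.galerkin, H.right_orthogonal,
      H.left_orthogonal, nonsing_inv_mul _ hKc, nonsing_inv_mul _ H.isUnit_det,
      Matrix.mul_zero, Matrix.mul_zero, fromBlocks_one]
  have h2 := (mul_eq_one_comm_of_equiv
    (((finCongr (two_mul q)).trans finSumFinEquiv.symm).symm)).1 h1
  rw [Matrix.mul_assoc] at h2
  exact (isUnit_iff_isUnit_det K).1 (IsUnit.of_mul_eq_one _ h2)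

lemma norm_mode (θ : ℝ) (j : ℤ) : ‖mode θ j‖ = 1 := by
  rw [mode, show (j * θ * Complex.I : ℂ) = ((j * θ : ℝ) : ℂ) * Complex.I by push_cast; ring]
  exact Complex.norm_exp_ofReal_mul_I _

section General

variable {D : Discretization} {h l : ℝ} {P : ℤ → ℤ → ℝ} {N : ℂ → Matrix (Fin D.dof) (Fin D.dof) ℂ}

/-- The Bloch matrices of the discretization have a splitting at every `ζ` on the unit circle. -/
def HasSplitting (D : Discretization) (h : ℝ) (P : ℤ → ℤ → ℝ)
    (N : ℂ → Matrix (Fin D.dof) (Fin D.dof) ℂ) : Prop :=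
  ∀ ζ : ℂ, ‖ζ‖ = 1 → ∃ Z Z', IsGalerkinSplitting
    (blochMatrix (2 * D.dof) (2 * D.dof) (D.mass h) ζ)
    (blochMatrix (2 * D.dof) (2 * D.dof) (D.stiffness h) ζ)
    (blochMatrix D.dof D.dof (D.stiffness (2 * h)) ζ)
    (blochMatrix (2 * D.dof) D.dof P ζ)
    (blochMatrix D.dof (2 * D.dof) (fun j i => P i j) ζ) Z Z' (N ζ)

/-- At all but the exceptional frequencies the coarse stiffness matrix is invertible, and then so is
the fine one. -/
theorem HasSplitting.existsUnique (H : HasSplitting D h P N) (hP : IsProlongationMatrix D h P)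
    (hKc : ∀ ζ : ℂ, ‖ζ‖ = 1 → ζ ≠ 1 →
      IsUnit (blochMatrix D.dof D.dof (D.stiffness (2 * h)) ζ).det) {θ : ℝ}
    (hθ : Real.sin (D.dof * θ) ≠ 0) : ∃! G, IsTwoGridSymbol D h l θ G := by
  have h1 := hKc _ (norm_mode θ (2 * D.dof : ℕ)) ((mode_eq_one_iff D θ).not.2 hθ)
  obtain ⟨Z, Z', hZ⟩ := H _ (norm_mode θ (2 * D.dof : ℕ))
  exact ⟨_, (isTwoGridSymbol_iff hP).2 ⟨hZ.isUnit_det_stiffness h1, h1, rfl⟩,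
    fun G hG => ((isTwoGridSymbol_iff hP).1 hG).2.2⟩

theorem HasSplitting.charpoly (H : HasSplitting D h P N) (hP : IsProlongationMatrix D h P) {θ : ℝ}
    {G : Matrix (Fin (2 * D.dof)) (Fin (2 * D.dof)) ℂ} (hG : IsTwoGridSymbol D h l θ G) :
    G.charpoly = X ^ D.dof *
      (((1 / l ^ 2 : ℝ) : ℂ) • N (mode θ (2 * D.dof : ℕ))).charpoly := by
  rw [charpoly_of_isTwoGridSymbol hP hG]
  obtain ⟨hK, hKc, -⟩ := (isTwoGridSymbol_iff hP).1 hG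
  obtain ⟨Z, Z', hZ⟩ := H _ (norm_mode θ (2 * D.dof : ℕ))
  rw [blochTwoGrid, ← Matrix.smul_mul, ← Matrix.smul_mul]
  refine charpoly_coarseGridCorrection hK hKc hZ.galerkin hZ.right_orthogonal hZ.left_orthogonal ?_
    hZ.isUnit_det
  rw [Matrix.mul_smul, Matrix.smul_mul, hZ.mass_eq, Matrix.smul_mul]

end General

lemma charpoly_one_by_one (z : ℂ) : (!![z] : Matrix (Fin 1) (Fin 1) ℂ).charpoly = X - C z := by
  simp [Matrix.charpoly, Matrix.det_unique]

lemma charpoly_diagonal_two (a d : ℂ) :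
    (!![a, 0; 0, d] : Matrix (Fin 2) (Fin 2) ℂ).charpoly = (X - C a) * (X - C d) := by
  simp [Matrix.charpoly, det_fin_two]

section Courant

variable {h : ℝ}

lemma blochMatrix_courantProlongation (ζ : ℂ) :
    blochMatrix 2 1 courantProlongation ζ = !![1; (1 + ζ) / 2] := by
  ext r s
  fin_cases s
  fin_cases r <;> norm_num [blochMatrix, sum_Icc_neg_two_two, courantProlongation]
  ring

lemma blochMatrix_courantRestriction (ζ : ℂ) :
    blochMatrix 1 2 (fun j i => courantProlongation i j) ζ = !![1, (1 + ζ⁻¹) / 2] := by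
  ext r s
  fin_cases r
  fin_cases s <;> norm_num [blochMatrix, sum_Icc_neg_two_two, courantProlongation]
  ring

/-- The complement is spanned by the hat functions at the odd nodes. -/
theorem courant_hasSplitting (hh : 0 < h) :
    HasSplitting courant h courantProlongation fun _ => !![((h ^ 2 / 3 : ℝ) : ℂ)] := by
  intro ζ hζ
  have hζ0 : ζ ≠ 0 := by rintro rfl; simp at hζ
  have hh0 : (h : ℂ) ≠ 0 := by exact_mod_cast hh.ne'
  suffices H : IsGalerkinSplitting (blochMatrix 2 2 (courant.mass h) ζ)
      (blochMatrix 2 2 (courant.stiffness h) ζ) (blochMatrix 1 1 (courant.stiffness (2 * h)) ζ)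
      (blochMatrix 2 1 courantProlongation ζ) (blochMatrix 1 2
        (fun j i => courantProlongation i j) ζ)
      !![0; 1] !![0, 1] !![((h ^ 2 / 3 : ℝ) : ℂ)] from ⟨_, _, H⟩
  rw [courant_mass hh, courant_stiffness hh, courant_stiffness (mul_pos two_pos hh),
    blochMatrix_stencil_two, blochMatrix_stencil_two, blochMatrix_stencil_one,
    blochMatrix_courantProlongation, blochMatrix_courantRestriction]
  constructor
  · ext i j
    fin_cases i; fin_cases j
    simp [Matrix.mul_apply, Fin.sum_univ_two]
    field_simp
    ring
  · ext i j
    fin_cases i; fin_cases j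
    simp [Matrix.mul_apply, Fin.sum_univ_two]
    field_simp
    ring
  · ext i j
    fin_cases i; fin_cases j
    simp [Matrix.mul_apply, Fin.sum_univ_two]
    field_simp
    ring
  · ext i j
    fin_cases i; fin_cases j
    simp [Matrix.mul_apply, Fin.sum_univ_two]
    field_simp
  · simp [hh0]

lemma courant_isUnit_det (hh : 0 < h) {ζ : ℂ} (hζ : ‖ζ‖ = 1) (h1 : ζ ≠ 1) :
    IsUnit (blochMatrix courant.dof courant.dof (courant.stiffness (2 * h)) ζ).det := by
  have hζ0 : ζ ≠ 0 := by rintro rfl; simp at hζ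
  have hh0 : (h : ℂ) ≠ 0 := by exact_mod_cast hh.ne'
  change IsUnit (blochMatrix 1 1 (courant.stiffness (2 * h)) ζ).det
  rw [courant_stiffness (mul_pos two_pos hh), blochMatrix_stencil_one, isUnit_iff_ne_zero]
  intro h2
  apply h1
  simp at h2
  field_simp at h2
  have h3 : (ζ - 1) ^ 2 = 0 := by linear_combination -h2
  exact sub_eq_zero.1 (pow_eq_zero_iff two_ne_zero |>.1 h3)

end Courant

end TwoGrid

/-! ### The splittings for quadratic splines and continuous piecewise quadratics -/

namespace TwoGrid

open Set Matrix

section Circle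

variable {ζ : ℂ}

lemma add_inv_eq_two_mul_re (hζ : ‖ζ‖ = 1) : ζ + ζ⁻¹ = 2 * (ζ.re : ℂ) := by
  rw [Complex.inv_eq_conj hζ, Complex.add_conj]
  push_cast
  ring

lemma abs_re_le_one (hζ : ‖ζ‖ = 1) : -1 ≤ ζ.re ∧ ζ.re ≤ 1 :=
  abs_le.1 (hζ ▸ Complex.abs_re_le_norm ζ)

lemma eq_one_of_re_eq_one (hζ : ‖ζ‖ = 1) (h1 : ζ.re = 1) : ζ = 1 := by
  have h2 := Complex.sq_norm ζ
  rw [hζ, Complex.normSq_apply, h1] at h2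
  have h3 : ζ.im = 0 := by nlinarith
  exact Complex.ext h1 h3

end Circle

section Spline

variable {h : ℝ} {ζ : ℂ}

lemma blochMatrix_splineProlongation (ζ : ℂ) :
    blochMatrix 2 1 splineProlongation ζ = !![(3 + ζ⁻¹) / 4; (3 + ζ) / 4] := by
  ext r s
  fin_cases s
  fin_cases r <;> norm_num [blochMatrix, sum_Icc_neg_two_two, splineProlongation] <;> ring

lemma blochMatrix_splineRestriction (ζ : ℂ) :
    blochMatrix 1 2 (fun j i => splineProlongation i j) ζ = !![(3 + ζ) / 4, (3 + ζ⁻¹) / 4] := by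
  ext r s
  fin_cases r
  fin_cases s <;> norm_num [blochMatrix, sum_Icc_neg_two_two, splineProlongation] <;>
    ring

/-- The nonzero eigenvalue in the spline case as a function of `y = cos (2 θ)`. -/
noncomputable def splineSymbol (y : ℝ) : ℝ := (26 - 7 * y - y ^ 2) / (10 * (7 - y) * (2 + y))

/-- The value of a Toeplitz form on the complement of the coarse splines, where `-5 - ζ⁻¹, 5 + ζ`
are the coefficients of the primitive of the prewavelet in the basis of B-splines. -/
lemma splineComplement_form (hζ : ‖ζ‖ = 1) (a b c : ℂ) :
    (!![-5 - ζ, 5 + ζ⁻¹] : Matrix (Fin 1) (Fin 2) ℂ) *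
      !![a + c * (ζ + ζ⁻¹), b * (1 + ζ⁻¹); b * (1 + ζ), a + c * (ζ + ζ⁻¹)] *
      !![-5 - ζ⁻¹; 5 + ζ] =
      !![4 * ((13 + 5 * ζ.re) * (a + 2 * c * ζ.re) - b * (1 + ζ.re) * (17 + ζ.re))] := by
  have hζ0 : ζ ≠ 0 := by rintro rfl; simp at hζ
  have h1 : (ζ.re : ℂ) = (ζ + ζ⁻¹) / 2 := by rw [add_inv_eq_two_mul_re hζ]; ring
  ext i j
  fin_cases i; fin_cases j
  rw [h1]
  simp [Matrix.mul_apply, Fin.sum_univ_two]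
  field_simp
  ring

theorem splineP2_hasSplitting (hh : 0 < h) :
    HasSplitting splineP2 h splineProlongation
      fun ζ => !![((h ^ 2 * splineSymbol ζ.re : ℝ) : ℂ)] := by
  intro ζ hζ
  have hζ0 : ζ ≠ 0 := by rintro rfl; simp at hζ
  have hh0 : (h : ℂ) ≠ 0 := by exact_mod_cast hh.ne'
  obtain ⟨hy1, hy2⟩ := abs_re_le_one hζ
  have hy3 : (7 - ζ.re : ℂ) ≠ 0 := by exact_mod_cast (by linarith : (0 : ℝ) < 7 - ζ.re).ne'
  have hy4 : (2 + ζ.re : ℂ) ≠ 0 := by exact_mod_cast (by linarith : (0 : ℝ) < 2 + ζ.re).ne'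
  suffices H : IsGalerkinSplitting (blochMatrix 2 2 (splineP2.mass h) ζ)
      (blochMatrix 2 2 (splineP2.stiffness h) ζ) (blochMatrix 1 1 (splineP2.stiffness (2 * h)) ζ)
      (blochMatrix 2 1 splineProlongation ζ) (blochMatrix 1 2 (fun j i => splineProlongation i j) ζ)
      !![-5 - ζ⁻¹; 5 + ζ] !![-5 - ζ, 5 + ζ⁻¹] !![((h ^ 2 * splineSymbol ζ.re : ℝ) : ℂ)] from
    ⟨_, _, H⟩
  rw [splineP2_mass hh, splineP2_stiffness hh, splineP2_stiffness (mul_pos two_pos hh),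
    blochMatrix_stencil_two, blochMatrix_stencil_two, blochMatrix_stencil_one,
    blochMatrix_splineProlongation, blochMatrix_splineRestriction]
  have hK := splineComplement_form hζ ((1 / h : ℝ) : ℂ) ((1 / h * (-1 / 3) : ℝ) : ℂ)
    ((1 / h * (-1 / 6) : ℝ) : ℂ)
  have hM := splineComplement_form hζ ((h * (11 / 20) : ℝ) : ℂ) ((h * (13 / 60) : ℝ) : ℂ)
    ((h * (1 / 120) : ℝ) : ℂ)
  constructor
  · ext i j
    fin_cases i; fin_cases j
    simp [Matrix.mul_apply, Fin.sum_univ_two]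
    field_simp
    ring
  · ext i j
    fin_cases i; fin_cases j
    simp [Matrix.mul_apply, Fin.sum_univ_two]
    field_simp
    ring
  · ext i j
    fin_cases i; fin_cases j
    simp [Matrix.mul_apply, Fin.sum_univ_two]
    field_simp
    ring
  · rw [hK, hM]
    ext i j
    fin_cases i; fin_cases j
    simp [splineSymbol]
    field_simp
    ring
  · rw [hK, isUnit_iff_ne_zero]
    have : (4 * ((13 + 5 * ζ.re) * (((1 / h : ℝ) : ℂ) + 2 * ((1 / h * (-1 / 6) : ℝ) : ℂ) * ζ.re) -
        ((1 / h * (-1 / 3) : ℝ) : ℂ) * (1 + ζ.re) * (17 + ζ.re)) : ℂ) =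
        16 / (3 * h) * (7 - ζ.re) * (2 + ζ.re) := by
      push_cast
      field_simp
      ring
    rw [this]
    simp [hh0, hy3, hy4]

lemma splineP2_isUnit_det (hh : 0 < h) (hζ : ‖ζ‖ = 1) (h1 : ζ ≠ 1) :
    IsUnit (blochMatrix splineP2.dof splineP2.dof (splineP2.stiffness (2 * h)) ζ).det := by
  have hh0 : (h : ℂ) ≠ 0 := by exact_mod_cast hh.ne'
  obtain ⟨hy1, hy2⟩ := abs_re_le_one hζ
  have hy3 : (1 - ζ.re : ℂ) ≠ 0 := by
    intro h2
    exact h1 (eq_one_of_re_eq_one hζ (by exact_mod_cast (sub_eq_zero.1 h2).symm))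
  have hy4 : (2 + ζ.re : ℂ) ≠ 0 := by exact_mod_cast (by linarith : (0 : ℝ) < 2 + ζ.re).ne'
  have h2 : ζ ^ 2 + (ζ ^ 2)⁻¹ = 4 * (ζ.re : ℂ) ^ 2 - 2 := by
    have hζ0 : ζ ≠ 0 := by rintro rfl; simp at hζ
    have h3 : (ζ.re : ℂ) = (ζ + ζ⁻¹) / 2 := by rw [add_inv_eq_two_mul_re hζ]; ring
    rw [h3]
    field_simp
    ring
  change IsUnit (blochMatrix 1 1 (splineP2.stiffness (2 * h)) ζ).det
  rw [splineP2_stiffness (mul_pos two_pos hh), blochMatrix_stencil_one, add_inv_eq_two_mul_re hζ,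
      h2,
    isUnit_iff_ne_zero]
  have h4 : ((1 / (2 * h) : ℝ) : ℂ) + ((1 / (2 * h) * (-1 / 3) : ℝ) : ℂ) * (2 * ζ.re) +
      ((1 / (2 * h) * (-1 / 6) : ℝ) : ℂ) * (4 * (ζ.re : ℂ) ^ 2 - 2) =
      1 / (3 * h) * (1 - ζ.re) * (2 + ζ.re) := by
    push_cast
    field_simp
    ring
  rw [h4]
  simp [hh0, hy3, hy4]

/-- The upper bound is `(y + 1) * (10 - y) ≥ 0`, with equality for `y = -1`. -/
lemma splineSymbol_bounds {y : ℝ} (h1 : -1 ≤ y) (h2 : y ≤ 1) :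
    0 ≤ splineSymbol y ∧ splineSymbol y ≤ 2 / 5 := by
  have h3 : 0 < 10 * (7 - y) * (2 + y) := by
    have : 0 < 7 - y := by linarith
    have : 0 < 2 + y := by linarith
    positivity
  constructor
  · exact div_nonneg (by nlinarith) h3.le
  · rw [splineSymbol, div_le_iff₀ h3]
    nlinarith

lemma splineEigenvalue_eq {c : ℝ} (h1 : -1 ≤ c) (h2 : c ≤ 1) :
    splineEigenvalue c = splineSymbol (2 * c ^ 2 - 1) := by
  have h3 : c ^ 2 ≤ 1 := by nlinarith
  have h4 : (-2 + c) ≠ 0 := by linarith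
  have h5 : (2 + c) ≠ 0 := by linarith
  have h6 : (2 + (2 * c ^ 2 - 1)) ≠ 0 := by nlinarith
  have h7 : 7 - (2 * c ^ 2 - 1) ≠ 0 := by nlinarith
  rw [splineEigenvalue, splineSymbol, div_eq_div_iff (by positivity) (by positivity)]
  ring

theorem splineEigenvalue_isGreatest : IsGreatest (splineEigenvalue '' Icc (-1) 1) (2 / 5) := by
  constructor
  · exact ⟨0, by norm_num, by norm_num [splineEigenvalue]⟩
  · rintro _ ⟨c, ⟨h1, h2⟩, rfl⟩
    rw [splineEigenvalue_eq h1 h2]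
    exact (splineSymbol_bounds (by nlinarith) (by nlinarith)).2

end Spline

section StandardP2

variable {h : ℝ} {ζ : ℂ}

lemma blochMatrix_nodalProlongation (ζ : ℂ) :
    blochMatrix 4 2 nodalProlongation ζ =
      !![1, 0; (3 - ζ) / 8, 3 / 4; 0, 1; (3 * ζ - 1) / 8, 3 / 4] := by
  ext r s
  fin_cases r <;> fin_cases s <;> norm_num [blochMatrix, sum_Icc_neg_two_two, nodalProlongation] <;>
    ring

lemma blochMatrix_nodalRestriction (ζ : ℂ) :
    blochMatrix 2 4 (fun j i => nodalProlongation i j) ζ =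
      !![1, (3 - ζ⁻¹) / 8, 0, (3 * ζ⁻¹ - 1) / 8; 0, 3 / 4, 1, 3 / 4] := by
  ext r s
  fin_cases r <;> fin_cases s <;> norm_num [blochMatrix, sum_Icc_neg_two_two, nodalProlongation] <;>
    ring

/-- The complement is spanned by a function that is odd and one that is even about the midpoints of
the coarse elements. Both vanish at the ends of the coarse elements and have mean value zero there,
so that the splitting does not depend on `ζ`. -/
theorem standardP2_hasSplitting (hh : 0 < h) :
    HasSplitting standardP2 h nodalProlongation
      fun _ => !![((h ^ 2 / 10 : ℝ) : ℂ), 0; 0, ((h ^ 2 / 30 : ℝ) : ℂ)] := by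
  intro ζ hζ
  have hζ0 : ζ ≠ 0 := by rintro rfl; simp at hζ
  have hh0 : (h : ℂ) ≠ 0 := by exact_mod_cast hh.ne'
  suffices H : IsGalerkinSplitting (blochMatrix 4 4 (standardP2.mass h) ζ)
      (blochMatrix 4 4 (standardP2.stiffness h) ζ)
      (blochMatrix 2 2 (standardP2.stiffness (2 * h)) ζ)
      (blochMatrix 4 2 nodalProlongation ζ) (blochMatrix 2 4 (fun j i => nodalProlongation i j) ζ)
      !![0, 0; 1, 1; 0, -4; -1, 1] !![0, 1, 0, -1; 0, 1, -4, 1]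
      !![((h ^ 2 / 10 : ℝ) : ℂ), 0; 0, ((h ^ 2 / 30 : ℝ) : ℂ)] from ⟨_, _, H⟩
  rw [standardP2_mass hh, standardP2_stiffness hh, standardP2_stiffness (mul_pos two_pos hh),
    blochMatrix_stencil_four, blochMatrix_stencil_four, blochMatrix_stencil_two,
    blochMatrix_nodalProlongation, blochMatrix_nodalRestriction]
  constructor
  · ext i j
    fin_cases i <;> fin_cases j <;> simp [Matrix.mul_apply, Fin.sum_univ_four] <;> field_simp <;>
      ring
  · ext i j
    fin_cases i <;> fin_cases j <;> simp [Matrix.mul_apply, Fin.sum_univ_four] <;> field_simp <;>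
      ring
  · ext i j
    fin_cases i <;> fin_cases j <;> simp [Matrix.mul_apply, Fin.sum_univ_four] <;> field_simp <;>
      ring
  · ext i j
    fin_cases i <;> fin_cases j <;>
      simp [Matrix.mul_apply, Fin.sum_univ_four, Fin.sum_univ_two] <;> field_simp <;> ring
  · rw [det_fin_two, isUnit_iff_ne_zero]
    simp [Matrix.mul_apply, Fin.sum_univ_four]
    field_simp
    norm_num [hh.ne']

lemma standardP2_isUnit_det (hh : 0 < h) (hζ : ‖ζ‖ = 1) (h1 : ζ ≠ 1) :
    IsUnit (blochMatrix standardP2.dof standardP2.dof (standardP2.stiffness (2 * h)) ζ).det := by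
  have hh0 : (h : ℂ) ≠ 0 := by exact_mod_cast hh.ne'
  have hζ0 : ζ ≠ 0 := by rintro rfl; simp at hζ
  change IsUnit (blochMatrix 2 2 (standardP2.stiffness (2 * h)) ζ).det
  rw [standardP2_stiffness (mul_pos two_pos hh), blochMatrix_stencil_two, det_fin_two,
    isUnit_iff_ne_zero]
  intro h2
  simp at h2
  field_simp at h2
  have h3 : (ζ - 1) ^ 2 = 0 := by linear_combination (-1 / 48) * h2
  exact h1 (sub_eq_zero.1 (pow_eq_zero_iff two_ne_zero |>.1 h3))

end StandardP2

end TwoGrid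

/-! ### Eigenvalues of the symbols -/

namespace TwoGrid

open Set Matrix

section Charpoly

variable {h l θ : ℝ}

theorem courant_charpoly (hh : 0 < h) {G : Matrix (Fin (2 * courant.dof)) (Fin (2 * courant.dof)) ℂ}
    (hG : IsTwoGridSymbol courant h l θ G) :
    G.charpoly = X * (X - C ((1 / 3 * (h ^ 2 / l ^ 2) : ℝ) : ℂ)) := by
  rw [(courant_hasSplitting hh).charpoly (courant_isProlongationMatrix hh) hG]
  change X ^ 1 * ((((1 / l ^ 2 : ℝ) : ℂ) • !![((h ^ 2 / 3 : ℝ) : ℂ)] :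
    Matrix (Fin 1) (Fin 1) ℂ)).charpoly = _
  rw [smul_of, smul_cons, smul_cons, Matrix.smul_empty, Matrix.smul_empty, charpoly_one_by_one,
      pow_one,
    smul_eq_mul, ← Complex.ofReal_mul]
  congr 4
  ring

theorem splineP2_charpoly (hh : 0 < h)
    {G : Matrix (Fin (2 * splineP2.dof)) (Fin (2 * splineP2.dof)) ℂ}
    (hG : IsTwoGridSymbol splineP2 h l θ G) :
    G.charpoly = X * (X - C ((splineEigenvalue (Real.cos θ) * (h ^ 2 / l ^ 2) : ℝ) : ℂ)) := by
  have hre : (mode θ (2 * splineP2.dof : ℕ)).re = 2 * Real.cos θ ^ 2 - 1 := by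
    rw [mode, ← Real.cos_two_mul]
    have : (((2 * splineP2.dof : ℕ) : ℤ) * θ * Complex.I : ℂ) = ((2 * θ : ℝ) : ℂ) * Complex.I := by
      simp [splineP2]
    rw [this, Complex.exp_ofReal_mul_I_re]
  rw [(splineP2_hasSplitting hh).charpoly (splineP2_isProlongationMatrix hh) hG, hre,
    splineEigenvalue_eq (Real.neg_one_le_cos θ) (Real.cos_le_one θ)]
  change X ^ 1 * ((((1 / l ^ 2 : ℝ) : ℂ) •
      !![((h ^ 2 * splineSymbol (2 * Real.cos θ ^ 2 - 1) : ℝ) : ℂ)] :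
    Matrix (Fin 1) (Fin 1) ℂ)).charpoly = _
  rw [smul_of, smul_cons, smul_cons, Matrix.smul_empty, Matrix.smul_empty, charpoly_one_by_one,
      pow_one,
    smul_eq_mul, ← Complex.ofReal_mul]
  congr 4
  ring

theorem standardP2_charpoly (hh : 0 < h)
    {G : Matrix (Fin (2 * standardP2.dof)) (Fin (2 * standardP2.dof)) ℂ}
    (hG : IsTwoGridSymbol standardP2 h l θ G) :
    G.charpoly = X ^ 2 * (X - C ((1 / 30 * (h ^ 2 / l ^ 2) : ℝ) : ℂ)) *
      (X - C ((1 / 10 * (h ^ 2 / l ^ 2) : ℝ) : ℂ)) := by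
  rw [(standardP2_hasSplitting hh).charpoly (standardP2_isProlongationMatrix hh) hG, mul_assoc]
  change X ^ 2 * ((((1 / l ^ 2 : ℝ) : ℂ) • !![((h ^ 2 / 10 : ℝ) : ℂ), 0; 0,
      ((h ^ 2 / 30 : ℝ) : ℂ)] :
    Matrix (Fin 2) (Fin 2) ℂ)).charpoly = _
  rw [smul_of, smul_cons, smul_cons, smul_cons, smul_cons, smul_cons, smul_cons, Matrix.smul_empty,
    Matrix.smul_empty, smul_zero, charpoly_diagonal_two, smul_eq_mul, smul_eq_mul,
    ← Complex.ofReal_mul, ← Complex.ofReal_mul, mul_comm (X - C _)]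
  congr 5 <;> ring

end Charpoly

section FourierConstant

variable {D : Discretization} {h l : ℝ}

/-- The eigenvalues do not depend on the frequency, and `π / 2` is not exceptional. -/
theorem courant_isFourierConstant (hh : 0 < h) :
    IsFourierConstant courant h l (1 / 3 * (h ^ 2 / l ^ 2)) := by
  have h0 : 0 ≤ 1 / 3 * (h ^ 2 / l ^ 2) := by positivity
  obtain ⟨G, hG, -⟩ := (courant_hasSplitting hh).existsUnique (l := l) (θ := Real.pi / 2)
    (courant_isProlongationMatrix hh) (fun _ => courant_isUnit_det hh) (by simp [courant])
  refine isFourierConstant_of h0 (fun θ G hG z hz => ?_)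
    ⟨by positivity, by linarith [Real.pi_pos]⟩ hG ?_
  · rw [courant_charpoly hh hG] at hz
    rcases root_mul.1 hz with hz | hz
    · rw [IsRoot.def, eval_X] at hz
      simpa [hz] using h0
    · rw [root_X_sub_C] at hz
      rw [← hz, Complex.norm_real, Real.norm_of_nonneg h0]
  · rw [courant_charpoly hh hG]
    exact root_mul.2 (.inr (root_X_sub_C.2 rfl))

/-- The supremum is attained at `θ = π / 2`. -/
theorem splineP2_isFourierConstant (hh : 0 < h) :
    IsFourierConstant splineP2 h l (2 / 5 * (h ^ 2 / l ^ 2)) := by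
  have h0 : 0 ≤ h ^ 2 / l ^ 2 := by positivity
  obtain ⟨G, hG, -⟩ := (splineP2_hasSplitting hh).existsUnique (l := l) (θ := Real.pi / 2)
    (splineP2_isProlongationMatrix hh) (fun _ => splineP2_isUnit_det hh) (by simp [splineP2])
  refine isFourierConstant_of (by positivity) (fun θ G hG z hz => ?_)
    ⟨by positivity, by linarith [Real.pi_pos]⟩ hG ?_
  · rw [splineP2_charpoly hh hG] at hz
    rcases root_mul.1 hz with hz | hz
    · rw [IsRoot.def, eval_X] at hz
      rw [hz, norm_zero]
      positivity
    · have hc := Real.neg_one_le_cos θ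
      have hc' := Real.cos_le_one θ
      obtain ⟨h1, h2⟩ := splineSymbol_bounds (y := 2 * Real.cos θ ^ 2 - 1)
        (by nlinarith) (by nlinarith)
      rw [← splineEigenvalue_eq hc hc'] at h1 h2
      rw [root_X_sub_C] at hz
      rw [← hz, Complex.norm_real, Real.norm_of_nonneg (mul_nonneg h1 h0)]
      exact mul_le_mul_of_nonneg_right h2 h0
  · rw [splineP2_charpoly hh hG]
    refine root_mul.2 (.inr (root_X_sub_C.2 ?_))
    rw [Real.cos_pi_div_two]
    norm_num [splineEigenvalue]

/-- The eigenvalues do not depend on the frequency, and `π / 4` is not exceptional. -/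
theorem standardP2_isFourierConstant (hh : 0 < h) :
    IsFourierConstant standardP2 h l (1 / 10 * (h ^ 2 / l ^ 2)) := by
  have h0 : 0 ≤ h ^ 2 / l ^ 2 := by positivity
  obtain ⟨G, hG, -⟩ := (standardP2_hasSplitting hh).existsUnique (l := l) (θ := Real.pi / 4)
    (standardP2_isProlongationMatrix hh) (fun _ => standardP2_isUnit_det hh) (by
      have : ((standardP2.dof : ℕ) : ℝ) * (Real.pi / 4) = Real.pi / 2 := by
        simp only [standardP2, Nat.cast_ofNat]
        ring
      rw [this, Real.sin_pi_div_two]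
      exact one_ne_zero)
  refine isFourierConstant_of (by positivity) (fun θ G hG z hz => ?_)
    ⟨by positivity, by linarith [Real.pi_pos]⟩ hG ?_
  · rw [standardP2_charpoly hh hG, root_mul, root_mul, root_X_sub_C, root_X_sub_C] at hz
    rcases hz with (hz | hz) | hz
    · rw [IsRoot.def, eval_pow, eval_X, pow_eq_zero_iff two_ne_zero] at hz
      rw [hz, norm_zero]
      positivity
    · rw [← hz, Complex.norm_real, Real.norm_of_nonneg (by positivity)]
      exact mul_le_mul_of_nonneg_right (by norm_num) h0
    · rw [← hz, Complex.norm_real, Real.norm_of_nonneg (by positivity)]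
  · rw [standardP2_charpoly hh hG]
    exact root_mul.2 (.inr (root_X_sub_C.2 rfl))

end FourierConstant

end TwoGrid

theorem mainTheorem2 (h : ℝ) (hh : 0 < h) :
    -- for all but the singular frequencies the two-grid symbols are well defined
    (∀ D ∈ ({TwoGrid.courant, TwoGrid.splineP2, TwoGrid.standardP2} : Set TwoGrid.Discretization),
      ∀ θ : ℝ, Real.sin (D.dof * θ) ≠ 0 → ∃! G, TwoGrid.IsTwoGridSymbol D h h θ G) ∧
    -- Courant elements
    (TwoGrid.IsTwoGridConstant TwoGrid.courant h h (1 / 3) ∧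
      TwoGrid.IsFourierConstant TwoGrid.courant h h (1 / 3) ∧
      ∀ θ G, TwoGrid.IsTwoGridSymbol TwoGrid.courant h h θ G →
        G.charpoly = Polynomial.X * (Polynomial.X - Polynomial.C (1 / 3))) ∧
    -- quadratic splines of class C^1
    (TwoGrid.IsTwoGridConstant TwoGrid.splineP2 h h (2 / 5) ∧
      TwoGrid.IsFourierConstant TwoGrid.splineP2 h h (2 / 5) ∧
      (∀ θ G, TwoGrid.IsTwoGridSymbol TwoGrid.splineP2 h h θ G →
        G.charpoly = Polynomial.X *
          (Polynomial.X - Polynomial.C (TwoGrid.splineEigenvalue (Real.cos θ) : ℂ))) ∧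
      IsGreatest (TwoGrid.splineEigenvalue '' Set.Icc (-1) 1) (2 / 5)) ∧
    -- continuous piecewise quadratics
    (TwoGrid.IsTwoGridConstant TwoGrid.standardP2 h h (1 / 10) ∧
      TwoGrid.IsFourierConstant TwoGrid.standardP2 h h (1 / 10) ∧
      ∀ θ G, TwoGrid.IsTwoGridSymbol TwoGrid.standardP2 h h θ G →
        G.charpoly = Polynomial.X ^ 2 * (Polynomial.X - Polynomial.C (1 / 30)) *
          (Polynomial.X - Polynomial.C (1 / 10))) ∧
    -- the distance of neighbouring nodes as unit of length
    (∀ p ∈ ({(TwoGrid.courant, 1 / 3), (TwoGrid.splineP2, 2 / 5), (TwoGrid.standardP2, 2 / 5)} :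
        Set (TwoGrid.Discretization × ℝ)),
      TwoGrid.IsTwoGridConstant p.1 h (p.1.nodeDistance h) p.2 ∧
      TwoGrid.IsFourierConstant p.1 h (p.1.nodeDistance h) p.2) := by
  have h0 : h ^ 2 / h ^ 2 = 1 := div_self (by positivity)
  have hc : ∀ c : ℝ, c * h ^ 2 / h ^ 2 = c := fun c => by rw [mul_div_assoc, h0, mul_one]
  have hc' : ∀ c : ℝ, c * (h ^ 2 / h ^ 2) = c := fun c => by rw [h0, mul_one]
  have hL1 := TwoGrid.courant_isTwoGridConstant hh hh
  have hL2 := TwoGrid.splineP2_isTwoGridConstant hh hh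
  have hL3 := TwoGrid.standardP2_isTwoGridConstant hh hh
  have hF1 := TwoGrid.courant_isFourierConstant (l := h) hh
  have hF2 := TwoGrid.splineP2_isFourierConstant (l := h) hh
  have hF3 := TwoGrid.standardP2_isFourierConstant (l := h) hh
  rw [hc] at hL1 hL2 hL3
  rw [hc'] at hF1 hF2 hF3
  refine ⟨?_, ⟨hL1, hF1, fun θ G hG => ?_⟩,
    ⟨hL2, hF2, fun θ G hG => ?_, TwoGrid.splineEigenvalue_isGreatest⟩,
    ⟨hL3, hF3, fun θ G hG => ?_⟩, ?_⟩
  · rintro D (rfl | rfl | rfl) θ hθ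
    · exact (TwoGrid.courant_hasSplitting hh).existsUnique (TwoGrid.courant_isProlongationMatrix hh)
        (fun _ => TwoGrid.courant_isUnit_det hh) hθ
    · exact (TwoGrid.splineP2_hasSplitting hh).existsUnique
        (TwoGrid.splineP2_isProlongationMatrix hh) (fun _ => TwoGrid.splineP2_isUnit_det hh) hθ
    · exact (TwoGrid.standardP2_hasSplitting hh).existsUnique
        (TwoGrid.standardP2_isProlongationMatrix hh) (fun _ => TwoGrid.standardP2_isUnit_det hh) hθ
  · rw [TwoGrid.courant_charpoly hh hG, hc']
    norm_num
  · rw [TwoGrid.splineP2_charpoly hh hG, hc']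
  · rw [TwoGrid.standardP2_charpoly hh hG, hc', hc']
    norm_num
  · have h1 : TwoGrid.courant.nodeDistance h = h := by
      simp [TwoGrid.Discretization.nodeDistance, TwoGrid.courant]
    have h2 : TwoGrid.splineP2.nodeDistance h = h := by
      simp [TwoGrid.Discretization.nodeDistance, TwoGrid.splineP2]
    have h3 : TwoGrid.standardP2.nodeDistance h = h / 2 := by
      simp [TwoGrid.Discretization.nodeDistance, TwoGrid.standardP2]
    rintro p (rfl | rfl | rfl)
    · exact ⟨by rwa [h1], by rwa [h1]⟩
    · exact ⟨by rwa [h2], by rwa [h2]⟩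
    · have hL := TwoGrid.standardP2_isTwoGridConstant hh (half_pos hh)
      have hF := TwoGrid.standardP2_isFourierConstant (l := h / 2) hh
      have h4 : (1 / 10 : ℝ) * (h ^ 2 / (h / 2) ^ 2) = 2 / 5 := by
        field_simp
        norm_num
      rw [mul_div_assoc, h4] at hL
      rw [h4] at hF
      exact ⟨by rwa [h3], by rwa [h3]⟩
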